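/- Let $\partial\Gamma$ be a topological circle with a fixed orientation (for example the Gromov boundary of the fundamental group $\Gamma$ of a closed orientable surface of genus at least $2$), and let $\partial\Gamma^{(3)+}\subset(\partial\Gamma)^3$ be the space of positively oriented triples. Let $\xi=(\xi^1,\xi^2,\xi^3)$ be a hyperconvex Frenet curve from $\partial\Gamma$ to the manifold of full flags of $\mathbb R^4$. That is, $\xi$ is continuous and, with $\xi^4(x)=\mathbb R^4$, for all integers $k_1,\dots,k_j\ge 1$ with $p=\sum_l k_l\le 4$: 1. for distinct points $x_1,\dots,x_j\in\partial\Gamma$ the sum $\xi^{k_1}(x_1)+\dots+\xi^{k_j}(x_j)$ is direct; 2. for every $x\in\partial\Gamma$ and every sequence $(x_1^m,\dots,x_j^m)$ of $j$-tuples of distinct points converging to $(x,\dots,x)$, one has $\lim_{m\to\infty}\bigoplus_l\xi^{k_l}(x_l^m)=\xi^p(x)$. Put $\Omega_\xi=\mathbb{RP}^3\setminus\bigcup_{x\in\partial\Gamma}\xi^2(x)$. Let $\Omega^1_\xi$ be the connected component of $\Omega_\xi$ that is the image of $\partial\Gamma^{(3)+}$ under $$(x,y,z)\mapsto\bigl(\xi^1(x)\oplus(\xi^2(z)\cap\xi^3(x))\bigr)\cap\bigl((\xi^2(x)\cap\xi^3(z))\oplus(\xi^2(y)\cap\xi^3(x))\bigr),$$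 and let $\Omega^2_\xi$ be the other connected component of $\Omega_\xi$. **Proposition 3.9.** The formula $$\mathrm{dev}_{\mathrm{ctrf}}(x,y,z)=\bigl(\xi^1(x)\oplus(\xi^2(z)\cap\xi^3(x))\bigr)\cap\xi^3(y)$$ defines a map $\partial\Gamma^{(3)+}\to\Omega^2_\xi$, and this map is a $3$-sheeted covering of $\Omega^2_\xi$. Moreover, let $\mathcal G$ be the codimension-$2$ topological foliation of $\partial\Gamma^{(3)+}$ with leaves $\{(x,y,z)\in\partial\Gamma^{(3)+} : x=x_0,\ z=z_0\}$, where $x_0\neq z_0$ in $\partial\Gamma$. Then $(\partial\Gamma^{(3)+},\mathcal G,\mathrm{dev}_{\mathrm{ctrf}})$ is a codimension-$2$ trifoliation $\mathcal G_{\mathrm{ctrf}}$ of $\Omega^2_\xi$: the spaces $\partial\Gamma^{(3)+}$ and $\Omega^2_\xi$ are topological $3$-manifolds, $\mathcal G$ is a codimension-$2$ foliation of $\partial\Gamma^{(3)+}$, and $\mathrm{dev}_{\mathrm{ctrf}}$ is a $3$-sheeted covering whose restriction to each leaf of $\mathcal G$ is injective. -/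

import Mathlib

open Set Filter Topology
open scoped LinearAlgebra.Projectivization

noncomputable section

namespace HyperconvexFrenet

/-- The vector space `ℝⁿ`. -/
abbrev Vec (n : ℕ) : Type := EuclideanSpace ℝ (Fin n)

/-- The projective space `ℙ(ℝⁿ)` carries the quotient topology from `ℝⁿ ∖ {0}`. -/
instance projTopology (n : ℕ) : TopologicalSpace (ℙ ℝ (Vec n)) :=
  inferInstanceAs (TopologicalSpace (Quotient (projectivizationSetoid ℝ (Vec n))))

/-- A full flag in `ℝⁿ`, written as `V 0 ≤ V 1 ≤ ⋯ ≤ V n` with `dim (V k) = k`. The two extreme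
terms are forced to be `0` and `ℝⁿ`; they carry no information. -/
structure FullFlag (n : ℕ) where
  sub : Fin (n + 1) → Submodule ℝ (Vec n)
  finrank_sub : ∀ k, Module.finrank ℝ (sub k) = (k : ℕ)
  mono : Monotone sub

/-- The topology of the flag manifold, as a subspace of the product of the Grassmannians; a
Grassmannian is topologized by identifying a subspace with the orthogonal projection onto it. -/
instance flagTopology (n : ℕ) : TopologicalSpace (FullFlag n) :=
  TopologicalSpace.induced
    (fun (F : FullFlag n) (k : Fin (n + 1)) => (F.sub k).starProjection) inferInstance

/-- Convergence of a sequence of subspaces of `ℝⁿ` in the Grassmannian topology. -/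
def SubspaceTendsto {n : ℕ} (W : ℕ → Submodule ℝ (Vec n)) (W' : Submodule ℝ (Vec n)) : Prop :=
  Tendsto (fun m => (W m).starProjection) atTop (𝓝 W'.starProjection)

/-- Hyperconvex Frenet curves with values in the full flags of `ℝⁿ`. -/
structure IsHyperconvexFrenet {B : Type*} [TopologicalSpace B] {n : ℕ}
    (ξ : B → FullFlag n) : Prop where
  continuous : Continuous ξ
  /-- General position: sums of total dimension at most `n` over distinct points are direct. -/
  general_position : ∀ (j : ℕ) (k : Fin j → Fin (n + 1)) (x : Fin j → B),
    (∀ l, 0 < (k l : ℕ)) → Function.Injective x → ∑ l, (k l : ℕ) ≤ n →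
      iSupIndep (fun l => (ξ (x l)).sub (k l))
  /-- Limit compatibility: such sums converge to the flag when the points merge. -/
  limit_compatibility : ∀ (j : ℕ) (k : Fin j → Fin (n + 1)) (p : Fin (n + 1)),
    (∀ l, 0 < (k l : ℕ)) → ∑ l, (k l : ℕ) = (p : ℕ) →
      ∀ (x : B) (xs : ℕ → Fin j → B), (∀ m, Function.Injective (xs m)) →
        (∀ l, Tendsto (fun m => xs m l) atTop (𝓝 x)) →
          SubspaceTendsto (fun m => ⨆ l, (ξ (xs m l)).sub (k l)) ((ξ x).sub p)

section Circle

variable {B : Type*} [TopologicalSpace B]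

/-- The space of positively oriented triples in a topological circle `B`, which is oriented by an
identification `θ` with the standard circle `ℝ/ℤ` and its cyclic order. -/
abbrev PosTriple (θ : B ≃ₜ UnitAddCircle) : Type _ :=
  {t : B × B × B // sbtw (θ t.1) (θ t.2.1) (θ t.2.2)}

/-- The leaves `{(x, y, z) positively oriented | x = x₀, z = z₀}`, for distinct `x₀`, `z₀`. -/
def leavesG (θ : B ≃ₜ UnitAddCircle) : Set (Set (PosTriple θ)) :=
  {L | ∃ x₀ z₀ : B, x₀ ≠ z₀ ∧ L = {t : PosTriple θ | t.1.1 = x₀ ∧ t.1.2.2 = z₀}}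

/-- The union in `ℝℙ³` of the projective lines `ξ²(x)`. -/
def bdryOmega (ξ : B → FullFlag 4) : Set (ℙ ℝ (Vec 4)) :=
  {p | ∃ x, p.submodule ≤ (ξ x).sub 2}

/-- The complement in `ℝℙ³` of the union of the projective lines `ξ²(x)`. -/
def Omega (ξ : B → FullFlag 4) : Set (ℙ ℝ (Vec 4)) := (bdryOmega ξ)ᶜ

/-- `(ξ¹(x) ⊕ (ξ²(z) ∩ ξ³(x))) ∩ ((ξ²(x) ∩ ξ³(z)) ⊕ (ξ²(y) ∩ ξ³(x)))`, as a subspace of `ℝ⁴`. -/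
def devPcf (ξ : B → FullFlag 4) (x y z : B) : Submodule ℝ (Vec 4) :=
  ((ξ x).sub 1 ⊔ ((ξ z).sub 2 ⊓ (ξ x).sub 3)) ⊓
    (((ξ x).sub 2 ⊓ (ξ z).sub 3) ⊔ ((ξ y).sub 2 ⊓ (ξ x).sub 3))

/-- `(ξ¹(x) ⊕ (ξ²(z) ∩ ξ³(x))) ∩ ξ³(y)`, as a subspace of `ℝ⁴`. -/
def devCtrf (ξ : B → FullFlag 4) (x y z : B) : Submodule ℝ (Vec 4) :=
  ((ξ x).sub 1 ⊔ ((ξ z).sub 2 ⊓ (ξ x).sub 3)) ⊓ (ξ y).sub 3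

/-- The first component of `Omega ξ`: the set of all points `devPcf ξ x y z`, with `(x, y, z)` a
positively oriented triple. -/
def Omega1 (θ : B ≃ₜ UnitAddCircle) (ξ : B → FullFlag 4) : Set (ℙ ℝ (Vec 4)) :=
  {p | ∃ t : PosTriple θ, p.submodule = devPcf ξ t.1.1 t.1.2.1 t.1.2.2}

/-- The other component of `Omega ξ`: the points of `Omega ξ` whose connected component in
`Omega ξ` is not `Omega1 θ ξ`. -/
def Omega2 (θ : B ≃ₜ UnitAddCircle) (ξ : B → FullFlag 4) : Set (ℙ ℝ (Vec 4)) :=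
  {p | p ∈ Omega ξ ∧ connectedComponentIn (Omega ξ) p ≠ Omega1 θ ξ}

end Circle

/-- Topological manifolds (without boundary) of dimension `n`. -/
structure IsTopManifold (n : ℕ) (M : Type*) [TopologicalSpace M] : Prop where
  t2 : T2Space M
  second_countable : SecondCountableTopology M
  locally_euclidean : ∀ m : M, ∃ e : OpenPartialHomeomorph M (Fin n → ℝ), m ∈ e.source

/-- `leaves` is (the set of leaves of) a topological foliation of `M` by `d`-dimensional leaves, of
codimension `k`: the leaves are path-connected and partition `M`, and around each point there is a
chart in which the connected components of the traces of the leaves are the slices on which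
the last `k` coordinates are constant. -/
structure IsFoliation (d k : ℕ) {M : Type*} [TopologicalSpace M] (leaves : Set (Set M)) :
    Prop where
  partition : Setoid.IsPartition leaves
  path_connected : ∀ L ∈ leaves, IsPathConnected L
  chart : ∀ m : M, ∃ e : OpenPartialHomeomorph M ((Fin d → ℝ) × (Fin k → ℝ)), m ∈ e.source ∧
    ∀ L ∈ leaves, ∀ q ∈ e.source ∩ L,
      connectedComponentIn (e.source ∩ L) q = {q' | q' ∈ e.source ∧ (e q').2 = (e q).2}

/-- `π` is a `j`-sheeted covering map. -/
def IsSheetedCovering (j : ℕ) {M' M : Type*} [TopologicalSpace M'] [TopologicalSpace M]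
    (π : M' → M) : Prop :=
  IsCoveringMap π ∧ ∀ p : M, (π ⁻¹' {p}).encard = j

/-- `(M', leaves, π)` is a `j`-foliation of codimension `k`, with leaves of dimension `d`, of the
manifold `M`. A trifoliation is the case `j = 3`. -/
structure IsJFoliation (j d k : ℕ) {M' M : Type*} [TopologicalSpace M'] [TopologicalSpace M]
    (leaves : Set (Set M')) (π : M' → M) : Prop where
  manifold_base : IsTopManifold (d + k) M
  manifold_cover : IsTopManifold (d + k) M'
  foliation : IsFoliation d k leaves
  covering : IsSheetedCovering j π
  inj_on_leaves : ∀ L ∈ leaves, InjOn π L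

end HyperconvexFrenet

end

noncomputable section

namespace HyperconvexFrenet

/-! Everything is read off in the plane `ξ³(x)`. Take coordinates adapted to the flag at `x` and
parametrize the rest of the circle by the first affine coordinate `t`, so that the curve is `(1, t,
y, z)`, its tangent line contains `(0, 1, u, v)` and its osculating plane contains `(0, 0, 1, w)`.
In the affine plane `ξ³(x) ∖ ξ²(x)` the tangent lines `ξ²(β t)` cut out the points `(u t, v t)`, the
planes `ξ³(β t)` cut out the lines of slope `w t` through these points, and `ξ¹(x) ⊕ (ξ²(β t) ∩
ξ³(x))` is the vertical line at abscissa `u t`. Hyperconvexity makes `(u, v)`, after sign changes,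
the graph of a strictly convex function over all of `ℝ`, with tangent slopes `w` running from `-∞`
to `+∞` (`exists_chart`).

A point of this plane below the graph therefore lies on exactly two tangent lines, touching on
either side of it, and a point above the graph lies on none. The point `devCtrf ξ x y z` is where
the tangent line at `y` meets the vertical line at `z`, hence below the graph; `devPcf ξ x y z` lies
above it. Since every point of projective space lies on some osculating plane (`zeroSet_nonempty`),
a point off all tangent lines lies on exactly one or exactly three osculating planes
(`zeroSet_dichotomy`). The first case is `Omega1` and the second is `Omega2` (`Omega1_eq`,
`Omega2_eq`).

Over a point `q` of `Omega2`, the first entry `x` identifies the fiber with the three osculating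
planes through `q`: the vertical line recovers `z`, and `y` is the point of tangency on the side
prescribed by the orientation (`eq_of_mem_devCtrf`). Off the tangent lines the osculating planes
through a point are simple zeros, which persist, stay unique locally and cannot merge
(`eventually_existsUnique_mem_three`). This makes the developing map locally injective and proper,
and a proper, locally injective map with fibers of constant finite size is a covering. On a leaf `x`
is constant, so injectivity there is the same recovery of a triple from its first entry. -/

theorem tendsto_clm_apply {E ι : Type*} [NormedAddCommGroup E] [NormedSpace ℝ E] {l : Filter ι}
    {T : ι → E →L[ℝ] E} {T₀ : E →L[ℝ] E} {v : ι → E} {v₀ : E}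
    (hT : Tendsto T l (𝓝 T₀)) (hv : Tendsto v l (𝓝 v₀)) :
    Tendsto (fun i => T i (v i)) l (𝓝 (T₀ v₀)) := by
  have h : Continuous fun q : (E →L[ℝ] E) × E => q.1 q.2 :=
    isBoundedBilinearMap_apply.continuous
  exact (h.tendsto (T₀, v₀)).comp (hT.prodMk_nhds hv)

/-! ### Convergence of subspaces through their orthogonal projections. -/

section Grassmannian

variable {E : Type*} [NormedAddCommGroup E] [InnerProductSpace ℝ E] [FiniteDimensional ℝ E]
  {ι : Type*} {l : Filter ι}

/-- Limits of vectors of converging subspaces belong to the limit subspace. -/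
theorem mem_of_tendsto_starProjection {l : Filter ι} [l.NeBot] {W : ι → Submodule ℝ E}
    {W₀ : Submodule ℝ E}
    (hW : Tendsto (fun i => (W i).starProjection) l (𝓝 W₀.starProjection)) {v : ι → E} {v₀ : E}
    (hv : Tendsto v l (𝓝 v₀)) (hmem : ∀ᶠ i in l, v i ∈ W i) : v₀ ∈ W₀ := by
  rw [← Submodule.starProjection_eq_self_iff]
  have h1 : Tendsto (fun i => (W i).starProjection (v i)) l (𝓝 (W₀.starProjection v₀)) :=
    tendsto_clm_apply hW hv
  refine tendsto_nhds_unique h1 (hv.congr' ?_)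
  filter_upwards [hmem] with i hi
  exact (Submodule.starProjection_eq_self_iff.2 hi).symm

theorem trace_starProjection (W : Submodule ℝ E) :
    LinearMap.trace ℝ E (W.starProjection : E →ₗ[ℝ] E) = Module.finrank ℝ W := by
  have h : LinearMap.IsProj W (W.starProjection : E →ₗ[ℝ] E) :=
    ⟨fun x => W.starProjection_apply_mem x,
      fun x hx => Submodule.starProjection_eq_self_iff.2 hx⟩
  exact h.trace

/-- Subspaces of constant dimension converge as soon as limits of their vectors belong to the
limit subspace. -/
theorem tendsto_starProjection_of_mem {W : ι → Submodule ℝ E} {W₀ : Submodule ℝ E}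
    (hdim : ∀ᶠ i in l, Module.finrank ℝ (W i) = Module.finrank ℝ W₀)
    (hmem : ∀ g : Ultrafilter ι, ↑g ≤ l → ∀ (v : ι → E) (v₀ : E), (∀ i, v i ∈ W i) →
      Tendsto v g (𝓝 v₀) → v₀ ∈ W₀) :
    Tendsto (fun i => (W i).starProjection) l (𝓝 W₀.starProjection) := by
  rw [tendsto_iff_ultrafilter]
  intro g hg
  have hcomp : IsCompact (Metric.closedBall (0 : E →L[ℝ] E) 1) := isCompact_closedBall 0 1
  -- Orthogonal projections lie in the compact unit ball of operators, so they have a limit `Q`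
  -- along the ultrafilter. Idempotence and symmetry pass to the limit, and only the range of `Q`
  -- remains to be identified.
  obtain ⟨Q, -, hQ⟩ := hcomp.ultrafilter_le_nhds' (g.map fun i => (W i).starProjection)
    (by
      rw [Ultrafilter.mem_map]
      refine Filter.univ_mem' fun i => ?_
      simpa using (W i).starProjection_norm_le)
  have hQ' : Tendsto (fun i => (W i).starProjection) g (𝓝 Q) := hQ
  have hQv : ∀ v, Tendsto (fun i => (W i).starProjection v) g (𝓝 (Q v)) := fun v =>
    tendsto_clm_apply hQ' tendsto_const_nhds
  have hproj : (Q : E →ₗ[ℝ] E).IsSymmetricProjection := by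
    constructor
    · have h2 : Tendsto (fun i => (W i).starProjection * (W i).starProjection) g (𝓝 (Q * Q)) :=
        hQ'.mul hQ'
      have h3 : Q * Q = Q := by
        refine tendsto_nhds_unique h2 (hQ'.congr fun i => ?_)
        exact ((W i).isIdempotentElem_starProjection).symm
      ext v
      exact congrArg (fun T : E →L[ℝ] E => T v) h3
    · intro v v'
      refine tendsto_nhds_unique ((hQv v).inner (𝕜 := ℝ) tendsto_const_nhds)
        ((tendsto_const_nhds.inner (𝕜 := ℝ) (hQv v')).congr fun i => ?_)
      exact ((W i).inner_starProjection_left_eq_right v v').symm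
  have heq : Q = (LinearMap.range (Q : E →ₗ[ℝ] E)).starProjection := by
    have := LinearMap.isSymmetricProjection_iff_eq_coe_starProjection_range.1 hproj
    obtain ⟨_, h⟩ := this
    ext v
    exact congrArg (fun T : E →ₗ[ℝ] E => T v) h
  have hle : LinearMap.range (Q : E →ₗ[ℝ] E) ≤ W₀ := by
    rintro _ ⟨v, rfl⟩
    exact hmem g hg _ _ (fun i => (W i).starProjection_apply_mem v) (hQv v)
  -- The trace of a projection is its rank and is continuous, so the range of `Q` loses no dimension
  -- and the inclusion into `W₀` is an equality.
  have htr : Module.finrank ℝ (LinearMap.range (Q : E →ₗ[ℝ] E)) = Module.finrank ℝ W₀ := by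
    have hc : Continuous fun T : E →L[ℝ] E => LinearMap.trace ℝ E (T : E →ₗ[ℝ] E) :=
      LinearMap.continuous_of_finiteDimensional
        ((LinearMap.trace ℝ E).comp (ContinuousLinearMap.coeLM ℝ))
    have h1 := (hc.tendsto Q).comp hQ'
    have h2 : Tendsto ((fun T : E →L[ℝ] E => LinearMap.trace ℝ E (T : E →ₗ[ℝ] E)) ∘
        fun i => (W i).starProjection) g (𝓝 (Module.finrank ℝ W₀ : ℝ)) := by
      refine tendsto_const_nhds.congr' ?_
      filter_upwards [hg hdim] with i hi
      simp only [Function.comp]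
      rw [trace_starProjection, hi]
    have h3 := tendsto_nhds_unique h1 h2
    have h4 := trace_starProjection (LinearMap.range (Q : E →ₗ[ℝ] E))
    rw [← heq] at h4
    exact_mod_cast h4.symm.trans h3
  rw [← Submodule.eq_of_le_of_finrank_eq hle htr, ← heq]
  exact hQ'

theorem tendsto_starProjection_inf {W W' : ι → Submodule ℝ E} {W₀ W₀' : Submodule ℝ E}
    (hW : Tendsto (fun i => (W i).starProjection) l (𝓝 W₀.starProjection))
    (hW' : Tendsto (fun i => (W' i).starProjection) l (𝓝 W₀'.starProjection))
    (hdim : ∀ᶠ i in l, Module.finrank ℝ ↥(W i ⊓ W' i) = Module.finrank ℝ ↥(W₀ ⊓ W₀')) :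
    Tendsto (fun i => (W i ⊓ W' i).starProjection) l (𝓝 (W₀ ⊓ W₀').starProjection) :=
  tendsto_starProjection_of_mem hdim fun _ hg _ _ hv hlim =>
    ⟨mem_of_tendsto_starProjection (hW.mono_left hg) hlim (.of_forall fun i => (hv i).1),
      mem_of_tendsto_starProjection (hW'.mono_left hg) hlim (.of_forall fun i => (hv i).2)⟩

theorem tendsto_starProjection_orthogonal {W : ι → Submodule ℝ E} {W₀ : Submodule ℝ E}
    (hW : Tendsto (fun i => (W i).starProjection) l (𝓝 W₀.starProjection)) :
    Tendsto (fun i => (W i)ᗮ.starProjection) l (𝓝 W₀ᗮ.starProjection) := by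
  simp only [Submodule.starProjection_orthogonal]
  exact tendsto_const_nhds.sub hW

/-- Dual to the case of intersections by passing to orthogonal complements. Constancy of the
dimension is what excludes a jump in the limit. -/
theorem tendsto_starProjection_sup {W W' : ι → Submodule ℝ E} {W₀ W₀' : Submodule ℝ E}
    (hW : Tendsto (fun i => (W i).starProjection) l (𝓝 W₀.starProjection))
    (hW' : Tendsto (fun i => (W' i).starProjection) l (𝓝 W₀'.starProjection))
    (hdim : ∀ᶠ i in l, Module.finrank ℝ ↥(W i ⊔ W' i) = Module.finrank ℝ ↥(W₀ ⊔ W₀')) :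
    Tendsto (fun i => (W i ⊔ W' i).starProjection) l (𝓝 (W₀ ⊔ W₀').starProjection) := by
  have h := tendsto_starProjection_orthogonal (tendsto_starProjection_inf
    (tendsto_starProjection_orthogonal hW) (tendsto_starProjection_orthogonal hW') ?_)
  · simpa only [Submodule.inf_orthogonal, Submodule.orthogonal_orthogonal] using h
  · filter_upwards [hdim] with i hi
    rw [Submodule.inf_orthogonal, Submodule.inf_orthogonal]
    have h1 := (W i ⊔ W' i).finrank_add_finrank_orthogonal
    have h2 := (W₀ ⊔ W₀').finrank_add_finrank_orthogonal
    omega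

end Grassmannian

/-! ### The oriented circle, positive triples and the foliation `leavesG`. -/

section CircleCoordinates

variable {B : Type*} [TopologicalSpace B] (θ : B ≃ₜ UnitAddCircle)

/-- The point of the circle at oriented distance `τ` from `x`. -/
def arcPt (x : B) (τ : ℝ) : B := θ.symm (θ x + (τ : UnitAddCircle))

/-- The oriented distance in `[0, 1)` from `x` to `y`. -/
def gap (x y : B) : ℝ := AddCircle.equivIco 1 0 (θ y - θ x)

theorem continuous_arcPt : Continuous fun q : B × ℝ => arcPt θ q.1 q.2 := by
  unfold arcPt
  have : Continuous fun q : B × ℝ => (q.2 : UnitAddCircle) :=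
    (AddCircle.continuous_mk' 1).comp continuous_snd
  fun_prop

theorem gap_nonneg (x y : B) : 0 ≤ gap θ x y :=
  (AddCircle.equivIco 1 0 (θ y - θ x)).2.1

theorem gap_lt_one (x y : B) : gap θ x y < 1 := by
  exact (AddCircle.equivIco 1 0 (θ y - θ x)).2.2.trans_eq (zero_add 1)

theorem coe_gap (x y : B) : (gap θ x y : UnitAddCircle) = θ y - θ x :=
  AddCircle.coe_equivIco

theorem arcPt_gap (x y : B) : arcPt θ x (gap θ x y) = y := by
  simp [arcPt, coe_gap]

theorem gap_arcPt (x : B) {τ : ℝ} (h : τ ∈ Ico (0 : ℝ) 1) : gap θ x (arcPt θ x τ) = τ := by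
  unfold gap arcPt
  simp only [Homeomorph.apply_symm_apply, add_sub_cancel_left]
  rw [AddCircle.equivIco_coe_of_mem (by simpa using h)]

theorem gap_self (x : B) : gap θ x x = 0 := by
  have : arcPt θ x 0 = x := by simp [arcPt]
  simpa [this] using gap_arcPt θ x (τ := 0) ⟨le_rfl, one_pos⟩

theorem gap_pos {x y : B} (h : x ≠ y) : 0 < gap θ x y := by
  refine (gap_nonneg θ x y).lt_of_ne fun h0 => h ?_
  have := arcPt_gap θ x y
  rw [← h0] at this
  simpa [arcPt] using this

theorem gap_pos_iff {x y : B} : 0 < gap θ x y ↔ x ≠ y :=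
  ⟨fun h e => by rw [e, gap_self] at h; exact lt_irrefl _ h, gap_pos θ⟩

theorem gap_injective (x : B) : Function.Injective (gap θ x) := fun y z h => by
  rw [← arcPt_gap θ x y, h, arcPt_gap]

theorem arcPt_ne (x : B) {τ : ℝ} (h : τ ∈ Ioo (0 : ℝ) 1) : x ≠ arcPt θ x τ := by
  rw [← gap_pos_iff θ, gap_arcPt θ x (Ioo_subset_Ico_self h)]
  exact h.1

/-- The diagonal has to be avoided: there the oriented distance jumps between `0` and `1`. -/
theorem continuousAt_gap {q : B × B} (h : q.1 ≠ q.2) :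
    ContinuousAt (fun q : B × B => gap θ q.1 q.2) q := by
  have hne : θ q.2 - θ q.1 ≠ ((0 : ℝ) : UnitAddCircle) := by
    rw [AddCircle.coe_zero, sub_ne_zero]
    exact fun e => h (θ.injective e).symm
  have h1 : ContinuousAt (fun q : B × B => θ q.2 - θ q.1) q := by fun_prop
  exact continuous_subtype_val.continuousAt.comp
    ((AddCircle.continuousAt_equivIco 1 0 hne).comp_of_eq h1 rfl)

theorem continuousAt_gap_comp {X : Type*} [TopologicalSpace X] {f g : X → B} {a : X}
    (hf : ContinuousAt f a) (hg : ContinuousAt g a) (h : f a ≠ g a) :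
    ContinuousAt (fun t => gap θ (f t) (g t)) a :=
  ContinuousAt.comp (g := fun q : B × B => gap θ q.1 q.2) (f := fun t => (f t, g t))
    (continuousAt_gap θ (q := (f a, g a)) h) (hf.prodMk hg)

/-- Cutting the circle at `x` turns the cyclic order into the linear order of `[0, 1)`; all later
arguments on orientation go through this. -/
theorem sbtw_iff_gap {x y z : B} :
    sbtw (θ x) (θ y) (θ z) ↔ 0 < gap θ x y ∧ gap θ x y < gap θ x z := by
  by_cases hxy : x = y
  · subst hxy
    simp only [gap_self, lt_irrefl, false_and, iff_false]
    exact sbtw_irrefl_left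
  by_cases hxz : x = z
  · subst hxz
    simp only [gap_self]
    exact iff_of_false sbtw_irrefl_left_right fun h => (h.1.trans h.2).false
  have hy : θ y = θ x + (gap θ x y : UnitAddCircle) := by rw [coe_gap]; abel
  have hz : θ z = θ x + (gap θ x z : UnitAddCircle) := by rw [coe_gap]; abel
  have h1 := gap_pos θ hxy
  have h2 := gap_pos θ hxz
  rw [sbtw_iff_not_btw, btw_cyclic]
  obtain ⟨a, ha⟩ : ∃ a : ℝ, (a : UnitAddCircle) = θ x := QuotientAddGroup.mk_surjective _
  rw [hy, hz, ← ha, ← AddCircle.coe_add, ← AddCircle.coe_add]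
  have := @QuotientAddGroup.btw_coe_iff' ℝ _ _ _ _ 1 ⟨zero_lt_one⟩ a (a + gap θ x z) (a + gap θ x y)
  refine (not_congr this).trans ?_
  rw [add_sub_cancel_left, add_sub_cancel_left,
    (toIcoMod_eq_self _).2 (by simpa using ⟨h2.le, gap_lt_one θ x z⟩),
    (toIocMod_eq_self _).2 (by simpa using ⟨h1, (gap_lt_one θ x y).le⟩)]
  simp [h1]

theorem ne_of_sbtw {x y z : B} (h : sbtw (θ x) (θ y) (θ z)) : x ≠ y ∧ y ≠ z ∧ x ≠ z :=
  ⟨fun e => by rw [e] at h; exact sbtw_irrefl_left h,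
    fun e => by rw [e] at h; exact sbtw_irrefl_right h,
    fun e => by rw [e] at h; exact sbtw_irrefl_left_right h⟩

theorem isOpen_sbtw : IsOpen {t : B × B × B | sbtw (θ t.1) (θ t.2.1) (θ t.2.2)} := by
  have : T2Space B := θ.isEmbedding.t2Space
  rw [isOpen_iff_mem_nhds]
  rintro ⟨x, y, z⟩ h
  obtain ⟨h1, -, h3⟩ := ne_of_sbtw θ h
  have c1 : ContinuousAt (fun t : B × B × B => gap θ t.1 t.2.1) (x, y, z) :=
    continuousAt_gap_comp θ (by fun_prop) (by fun_prop) h1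
  have c2 : ContinuousAt (fun t : B × B × B => gap θ t.1 t.2.2) (x, y, z) :=
    continuousAt_gap_comp θ (by fun_prop) (by fun_prop) h3
  have hg := (sbtw_iff_gap θ).1 h
  filter_upwards [c1.eventually_lt c2 hg.2, c1.eventually (lt_mem_nhds hg.1)] with t h4 h5
  exact (sbtw_iff_gap θ).2 ⟨h5, h4⟩

theorem sbtw_total {x y z : B} (h1 : x ≠ y) (h2 : y ≠ z) (h3 : x ≠ z) :
    sbtw (θ x) (θ y) (θ z) ∨ sbtw (θ x) (θ z) (θ y) := by
  rw [sbtw_iff_gap, sbtw_iff_gap]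
  rcases lt_trichotomy (gap θ x y) (gap θ x z) with h | h | h
  · exact .inl ⟨gap_pos θ h1, h⟩
  · exact absurd (gap_injective θ x h) h2
  · exact .inr ⟨gap_pos θ h3, h⟩

/-- The positively oriented triple `(x, x + a, x + b)`. -/
def arcTriple (q : B × {q : ℝ × ℝ // 0 < q.1 ∧ q.1 < q.2 ∧ q.2 < 1}) : PosTriple θ :=
  ⟨(q.1, arcPt θ q.1 q.2.1.1, arcPt θ q.1 q.2.1.2), by
    obtain ⟨x, ⟨a, b⟩, h1, h2, h3⟩ := q
    simp only at h1 h2 h3 ⊢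
    rw [sbtw_iff_gap, gap_arcPt θ x ⟨h1.le, h2.trans h3⟩, gap_arcPt θ x ⟨(h1.trans h2).le, h3⟩]
    exact ⟨h1, h2⟩⟩

theorem continuous_arcTriple : Continuous (arcTriple θ) := by
  have h := continuous_arcPt θ
  refine Continuous.subtype_mk (continuous_fst.prodMk (Continuous.prodMk ?_ ?_)) _
  · exact h.comp (continuous_fst.prodMk (by fun_prop))
  · exact h.comp (continuous_fst.prodMk (by fun_prop))

theorem surjective_arcTriple : Function.Surjective (arcTriple θ) := by
  rintro ⟨⟨x, y, z⟩, h⟩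
  have h' := (sbtw_iff_gap θ).1 h
  refine ⟨(x, ⟨(gap θ x y, gap θ x z), h'.1, h'.2, gap_lt_one θ x z⟩), Subtype.ext ?_⟩
  simp [arcTriple, arcPt_gap]

/-- Triples are the image of the product of the circle and a convex triangle of gaps. -/
theorem preconnectedSpace_posTriple : PreconnectedSpace (PosTriple θ) := by
  have : PreconnectedSpace UnitAddCircle := inferInstance
  have : PreconnectedSpace B := θ.symm.surjective.denseRange.preconnectedSpace θ.symm.continuous
  have : PreconnectedSpace {q : ℝ × ℝ // 0 < q.1 ∧ q.1 < q.2 ∧ q.2 < 1} := by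
    refine Subtype.preconnectedSpace (Convex.isPreconnected ?_)
    have h1 : Convex ℝ {q : ℝ × ℝ | 0 < q.1} := convex_halfSpace_gt (LinearMap.fst ℝ ℝ ℝ).isLinear 0
    have h2 : Convex ℝ {q : ℝ × ℝ | q.1 - q.2 < 0} :=
      convex_halfSpace_lt (LinearMap.fst ℝ ℝ ℝ - LinearMap.snd ℝ ℝ ℝ).isLinear 0
    have h3 : Convex ℝ {q : ℝ × ℝ | q.2 < 1} := convex_halfSpace_lt (LinearMap.snd ℝ ℝ ℝ).isLinear 1
    have h4 := h1.inter (h2.inter h3)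
    have e : {q : ℝ × ℝ | 0 < q.1} ∩ ({q | q.1 - q.2 < 0} ∩ {q | q.2 < 1}) =
        {q : ℝ × ℝ | 0 < q.1 ∧ q.1 < q.2 ∧ q.2 < 1} := by
      ext q
      simp
    rw [e] at h4
    exact h4
  exact (surjective_arcTriple θ).denseRange.preconnectedSpace (continuous_arcTriple θ)

/-- The coordinates `(y - x, (x - x₁, z - x))` on the positively oriented triples `(x, y, z)` with
`x ≠ x₁`. -/
def tripleChart (x₁ : B) :
    OpenPartialHomeomorph (PosTriple θ) ((Fin 1 → ℝ) × (Fin 2 → ℝ)) where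
  toFun t := (![gap θ t.1.1 t.1.2.1], ![gap θ x₁ t.1.1, gap θ t.1.1 t.1.2.2])
  invFun q := if h : 0 < q.1 0 ∧ q.1 0 < q.2 1 ∧ q.2 1 < 1 then
      arcTriple θ (arcPt θ x₁ (q.2 0), ⟨(q.1 0, q.2 1), h⟩)
    -- An arbitrary positive triple, never reached on the target.
    else arcTriple θ (x₁, ⟨(1 / 3, 1 / 2), by norm_num⟩)
  source := {t | x₁ ≠ t.1.1}
  target := {q | (0 < q.2 0 ∧ q.2 0 < 1) ∧ 0 < q.1 0 ∧ q.1 0 < q.2 1 ∧ q.2 1 < 1}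
  map_source' := by
    rintro ⟨⟨x, y, z⟩, h⟩ hx
    have h' := (sbtw_iff_gap θ).1 h
    exact ⟨⟨gap_pos θ hx, gap_lt_one _ _ _⟩, h'.1, h'.2, gap_lt_one _ _ _⟩
  map_target' := by
    rintro q ⟨h1, h2⟩
    rw [dif_pos h2]
    exact arcPt_ne θ x₁ h1
  left_inv' := by
    rintro ⟨⟨x, y, z⟩, h⟩ hx
    have h' := (sbtw_iff_gap θ).1 h
    rw [dif_pos ⟨h'.1, h'.2, gap_lt_one _ _ _⟩]
    apply Subtype.ext
    simp [arcTriple, arcPt_gap]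
  right_inv' := by
    rintro ⟨q1, q2⟩ ⟨h1, h2⟩
    rw [dif_pos h2]
    simp only [arcTriple] at h1 h2 ⊢
    rw [gap_arcPt θ _ ⟨h2.1.le, h2.2.1.trans h2.2.2⟩,
      gap_arcPt θ _ ⟨(h2.1.trans h2.2.1).le, h2.2.2⟩, gap_arcPt θ _ ⟨h1.1.le, h1.2⟩]
    refine Prod.ext ?_ ?_
    · ext i; fin_cases i; rfl
    · ext i; fin_cases i <;> rfl
  open_source := by
    have : T2Space B := θ.isEmbedding.t2Space
    exact isOpen_ne_fun continuous_const (by fun_prop)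
  open_target := by
    have e1 : IsOpen {q : (Fin 1 → ℝ) × (Fin 2 → ℝ) | 0 < q.2 0} :=
      isOpen_lt (by fun_prop) (by fun_prop)
    have e2 : IsOpen {q : (Fin 1 → ℝ) × (Fin 2 → ℝ) | q.2 0 < 1} :=
      isOpen_lt (by fun_prop) (by fun_prop)
    have e3 : IsOpen {q : (Fin 1 → ℝ) × (Fin 2 → ℝ) | 0 < q.1 0} :=
      isOpen_lt (by fun_prop) (by fun_prop)
    have e4 : IsOpen {q : (Fin 1 → ℝ) × (Fin 2 → ℝ) | q.1 0 < q.2 1} :=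
      isOpen_lt (by fun_prop) (by fun_prop)
    have e5 : IsOpen {q : (Fin 1 → ℝ) × (Fin 2 → ℝ) | q.2 1 < 1} :=
      isOpen_lt (by fun_prop) (by fun_prop)
    exact (e1.inter e2).inter (e3.inter (e4.inter e5))
  continuousOn_toFun := by
    rintro ⟨⟨x, y, z⟩, h⟩ hx
    obtain ⟨h1, -, h3⟩ := ne_of_sbtw θ h
    apply ContinuousAt.continuousWithinAt
    have c1 : ContinuousAt (fun t : PosTriple θ => gap θ t.1.1 t.1.2.1) ⟨(x, y, z), h⟩ :=
      continuousAt_gap_comp θ (by fun_prop) (by fun_prop) h1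
    have c2 : ContinuousAt (fun t : PosTriple θ => gap θ t.1.1 t.1.2.2) ⟨(x, y, z), h⟩ :=
      continuousAt_gap_comp θ (by fun_prop) (by fun_prop) h3
    have c3 : ContinuousAt (fun t : PosTriple θ => gap θ x₁ t.1.1) ⟨(x, y, z), h⟩ :=
      continuousAt_gap_comp θ (by fun_prop) (by fun_prop) hx
    refine ContinuousAt.prodMk ?_ ?_
    · refine continuousAt_pi.2 fun i => ?_
      fin_cases i
      exact c1
    · refine continuousAt_pi.2 fun i => ?_
      fin_cases i
      · exact c3
      · exact c2
  continuousOn_invFun := by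
    rw [continuousOn_iff_continuous_domRestrict]
    have : Continuous fun q : {q : (Fin 1 → ℝ) × (Fin 2 → ℝ) |
        (0 < q.2 0 ∧ q.2 0 < 1) ∧ 0 < q.1 0 ∧ q.1 0 < q.2 1 ∧ q.2 1 < 1} =>
        arcTriple θ (arcPt θ x₁ (q.1.2 0), ⟨(q.1.1 0, q.1.2 1), q.2.2⟩) := by
      refine (continuous_arcTriple θ).comp (Continuous.prodMk ?_ ?_)
      · exact (continuous_arcPt θ).comp (continuous_const.prodMk (by fun_prop))
      · exact Continuous.subtype_mk (by fun_prop) _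
    refine this.congr fun q => ?_
    simp only [Set.domRestrict_apply]
    rw [dif_pos q.2.2]

theorem exists_tripleChart (t : PosTriple θ) : ∃ x₁, t ∈ (tripleChart θ x₁).source := by
  exact ⟨arcPt θ t.1.1 (1 / 2), (arcPt_ne θ _ (by norm_num)).symm⟩

theorem isTopManifold_posTriple : IsTopManifold 3 (PosTriple θ) where
  t2 := by
    have : T2Space B := θ.isEmbedding.t2Space
    infer_instance
  second_countable := by
    have : SecondCountableTopology B := θ.secondCountableTopology
    exact TopologicalSpace.Subtype.secondCountableTopology _
  locally_euclidean t := by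
    obtain ⟨x₁, h⟩ := exists_tripleChart θ t
    have e : ((Fin 1 → ℝ) × (Fin 2 → ℝ)) ≃L[ℝ] (Fin 3 → ℝ) :=
      ContinuousLinearEquiv.ofFinrankEq (by simp)
    exact ⟨(tripleChart θ x₁).transHomeomorph e.toHomeomorph, h⟩

theorem isPathConnected_leaf {x₀ z₀ : B} (h : x₀ ≠ z₀) :
    IsPathConnected {t : PosTriple θ | t.1.1 = x₀ ∧ t.1.2.2 = z₀} := by
  have hg := gap_pos θ h
  let f : Ioo (0 : ℝ) (gap θ x₀ z₀) → PosTriple θ := fun a =>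
    arcTriple θ (x₀, ⟨(a.1, gap θ x₀ z₀), a.2.1, a.2.2, gap_lt_one _ _ _⟩)
  have hf : Continuous f := (continuous_arcTriple θ).comp
    (continuous_const.prodMk (Continuous.subtype_mk (by fun_prop) _))
  have : PathConnectedSpace (Ioo (0 : ℝ) (gap θ x₀ z₀)) :=
    isPathConnected_iff_pathConnectedSpace.1
      ((convex_Ioo _ _).isPathConnected (nonempty_Ioo.2 hg))
  convert isPathConnected_range hf using 1
  ext t
  constructor
  · obtain ⟨⟨x, y, z⟩, ht⟩ := t
    rintro ⟨rfl, rfl⟩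
    have h' := (sbtw_iff_gap θ).1 ht
    exact ⟨⟨_, h'⟩, Subtype.ext (by simp [f, arcTriple, arcPt_gap])⟩
  · rintro ⟨a, rfl⟩
    exact ⟨rfl, arcPt_gap θ _ _⟩

theorem isFoliation_leavesG : IsFoliation 1 2 (leavesG θ) where
  partition := by
    constructor
    · rintro ⟨x₀, z₀, h, he⟩
      have := (isPathConnected_leaf θ h).nonempty
      rw [← he] at this
      exact Set.not_nonempty_empty this
    · intro t
      refine ⟨_, ⟨⟨t.1.1, t.1.2.2, (ne_of_sbtw θ t.2).2.2, rfl⟩, rfl, rfl⟩, ?_⟩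
      rintro _ ⟨⟨x₀, z₀, -, rfl⟩, h1, h2⟩
      rw [h1, h2]
  path_connected := by
    rintro _ ⟨x₀, z₀, h, rfl⟩
    exact isPathConnected_leaf θ h
  chart t := by
    obtain ⟨x₁, h⟩ := exists_tripleChart θ t
    refine ⟨tripleChart θ x₁, h, ?_⟩
    rintro _ ⟨x₀, z₀, hxz, rfl⟩ q ⟨hq, hx, hz⟩
    -- The source only constrains `x`, which is constant on a leaf. So a leaf meeting the source
    -- lies in it entirely, and its trace is connected.
    have hinter : (tripleChart θ x₁).source ∩ {t : PosTriple θ | t.1.1 = x₀ ∧ t.1.2.2 = z₀} =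
        {t : PosTriple θ | t.1.1 = x₀ ∧ t.1.2.2 = z₀} := by
      refine inter_eq_right.2 fun t' ht' => ?_
      change x₁ ≠ t'.1.1
      rw [ht'.1, ← hx]
      exact hq
    rw [hinter, IsPreconnected.connectedComponentIn
      (isPathConnected_leaf θ hxz).isConnected.isPreconnected ⟨hx, hz⟩]
    ext q'
    constructor
    · rintro ⟨h1, h2⟩
      refine ⟨?_, ?_⟩
      · change x₁ ≠ q'.1.1
        rw [h1, ← hx]
        exact hq
      · change ![gap θ x₁ q'.1.1, gap θ q'.1.1 q'.1.2.2] = ![gap θ x₁ q.1.1, gap θ q.1.1 q.1.2.2]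
        rw [h1, h2, hx, hz]
    · rintro ⟨h1, h2⟩
      change ![gap θ x₁ q'.1.1, gap θ q'.1.1 q'.1.2.2] =
        ![gap θ x₁ q.1.1, gap θ q.1.1 q.1.2.2] at h2
      have e1 : q'.1.1 = q.1.1 := gap_injective θ x₁ (congrFun h2 0)
      have e2 : gap θ q'.1.1 q'.1.2.2 = gap θ q.1.1 q.1.2.2 := congrFun h2 1
      rw [e1] at e2
      exact ⟨e1.trans hx, (gap_injective θ _ e2).trans hz⟩

end CircleCoordinates

/-! ### Convexity and growth of the coordinate functions. -/

section RealFunctions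

open Asymptotics

/-- The remainder `f s - f t - (s - t) f'(t)` of the first order expansion. -/
def taylorRem (f f' : ℝ → ℝ) (t s : ℝ) : ℝ := f s - f t - (s - t) * f' t

theorem taylorRem_self (f f' : ℝ → ℝ) (t : ℝ) : taylorRem f f' t t = 0 := by
  simp [taylorRem]

theorem taylorRem_add (f f' : ℝ → ℝ) (t s : ℝ) :
    taylorRem f f' t s + taylorRem f f' s t = (s - t) * (f' s - f' t) := by
  simp only [taylorRem]; ring

theorem taylorRem_neg (f f' : ℝ → ℝ) (t s : ℝ) :
    taylorRem (fun a => -f a) (fun a => -f' a) t s = -taylorRem f f' t s := by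
  simp only [taylorRem]; ring

theorem hasDerivAt_taylorRem {f f' : ℝ → ℝ} {t s : ℝ} (hf : HasDerivAt f (f' s) s) :
    HasDerivAt (taylorRem f f' t) (f' s - f' t) s := by
  have := (hf.sub_const (f t)).sub (((hasDerivAt_id s).sub_const t).mul_const (f' t))
  rw [one_mul] at this
  exact this

/-- The quotient `N / D` with value `c` at `t`. -/
def quotientAt (N D : ℝ → ℝ) (c t : ℝ) : ℝ → ℝ := Function.update (fun s => N s / D s) t c

theorem quotientAt_of_ne {N D : ℝ → ℝ} {c t s : ℝ} (h : s ≠ t) :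
    quotientAt N D c t s = N s / D s := by
  simp [quotientAt, h]

theorem quotientAt_self (N D : ℝ → ℝ) (c t : ℝ) : quotientAt N D c t t = c := by
  simp [quotientAt]

/-- A continuous injective function on `ℝ` is strictly monotone. The little-o hypothesis is
continuity at `t`, and the non-equalities `hinj` and `hne` are injectivity away from `t` and at `t`.
-/
theorem strictMono_or_strictAnti_quotientAt {N D : ℝ → ℝ} {c t : ℝ} (hN : Continuous N)
    (hD : Continuous D) (hD0 : ∀ s, s ≠ t → D s ≠ 0)
    (hlim : (fun s => N s - c * D s) =o[𝓝 t] D)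
    (hinj : ∀ s₁ s₂, s₁ ≠ t → s₂ ≠ t → s₁ ≠ s₂ → N s₁ * D s₂ ≠ N s₂ * D s₁)
    (hne : ∀ s, s ≠ t → N s ≠ c * D s) :
    StrictMono (quotientAt N D c t) ∨ StrictAnti (quotientAt N D c t) := by
  refine Continuous.strictMono_of_inj ?_ ?_
  · rw [continuous_iff_continuousAt]
    intro s
    by_cases hs : s = t
    · subst hs
      refine continuousAt_update_same.2 ?_
      have h1 : Tendsto (fun r => (N r - c * D r) / D r) (𝓝[≠] s) (𝓝 0) :=
        hlim.tendsto_div_nhds_zero.mono_left nhdsWithin_le_nhds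
      have h2 := h1.add_const c
      rw [zero_add] at h2
      refine h2.congr' ?_
      filter_upwards [self_mem_nhdsWithin] with r hr
      have := hD0 r hr
      field_simp
      ring
    · refine (continuousAt_update_of_ne hs).2 ?_
      exact hN.continuousAt.div hD.continuousAt (hD0 s hs)
  · intro s₁ s₂ h
    by_contra hs
    by_cases h1 : s₁ = t
    · have h2 : s₂ ≠ t := fun e => hs (h1.trans e.symm)
      rw [h1, quotientAt_self, quotientAt_of_ne h2] at h
      exact hne s₂ h2 (by rw [h, div_mul_cancel₀ _ (hD0 s₂ h2)])
    by_cases h2 : s₂ = t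
    · rw [h2, quotientAt_self, quotientAt_of_ne h1] at h
      exact hne s₁ h1 (by rw [← h, div_mul_cancel₀ _ (hD0 s₁ h1)])
    rw [quotientAt_of_ne h1, quotientAt_of_ne h2, div_eq_div_iff (hD0 _ h1) (hD0 _ h2)] at h
    exact hinj s₁ s₂ h1 h2 hs h

theorem pos_or_neg_of_continuous {f : ℝ → ℝ} (hf : Continuous f) (h0 : ∀ t, f t ≠ 0) :
    (∀ t, 0 < f t) ∨ ∀ t, f t < 0 := by
  by_contra! h
  obtain ⟨⟨a, ha⟩, b, hb⟩ := h
  obtain ⟨c, -, hc⟩ := isPreconnected_univ.intermediate_value (mem_univ a) (mem_univ b)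
    hf.continuousOn ⟨ha, hb⟩
  exact h0 c hc

/-- The properties of the coordinate functions of a hyperconvex Frenet curve in `ℝℙ³` in an affine
chart, where the curve is `(1, t, y, z)`, its tangent vector is `(0, 1, u, v)` and the osculating
plane contains `(0, 0, 1, w)`. -/
structure FrenetFunctions (y z u v w : ℝ → ℝ) : Prop where
  hasDerivAt_y : ∀ t, HasDerivAt y (u t) t
  hasDerivAt_z : ∀ t, HasDerivAt z (v t) t
  continuous_u : Continuous u
  continuous_v : Continuous v
  continuous_w : Continuous w
  isLittleO_rem : ∀ t, (fun s => taylorRem z v t s - w t * taylorRem y u t s) =o[𝓝 t]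
    taylorRem y u t
  isLittleO_id_y : (fun t => t) =o[cocompact ℝ] y
  isLittleO_id_z : (fun t => t) =o[cocompact ℝ] z
  isLittleO_y_z : y =o[cocompact ℝ] z
  ne_chord : ∀ t s₁ s₂, s₁ ≠ t → s₂ ≠ t → s₁ ≠ s₂ →
    (y s₁ - y t) * (s₂ - t) ≠ (y s₂ - y t) * (s₁ - t)
  rem_y_ne : ∀ t s, s ≠ t → taylorRem y u t s ≠ 0
  ne_rem : ∀ t s₁ s₂, s₁ ≠ t → s₂ ≠ t → s₁ ≠ s₂ →
    taylorRem z v t s₁ * taylorRem y u t s₂ ≠ taylorRem z v t s₂ * taylorRem y u t s₁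
  rem_z_ne : ∀ t s, s ≠ t → taylorRem z v t s ≠ w t * taylorRem y u t s
  ne_tangent : ∀ t s, s ≠ t →
    taylorRem y u t s * (v s - v t) ≠ taylorRem z v t s * (u s - u t)

namespace FrenetFunctions

variable {y z u v w : ℝ → ℝ} (h : FrenetFunctions y z u v w)
include h

theorem continuous_y : Continuous y :=
  continuous_iff_continuousAt.2 fun t => (h.hasDerivAt_y t).continuousAt

theorem continuous_z : Continuous z :=
  continuous_iff_continuousAt.2 fun t => (h.hasDerivAt_z t).continuousAt

/-- The slopes of chords from `t` are strictly monotone with value `u t` at `t`, so the graph of `y`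
stays strictly on one side of its tangent at `t`. The side does not depend on `t`, because the
remainder at `t + 1` is continuous in `t` and never vanishes. -/
theorem rem_y_pos_or_neg :
    (∀ t s, s ≠ t → 0 < taylorRem y u t s) ∨ ∀ t s, s ≠ t → taylorRem y u t s < 0 := by
  have key : ∀ t, (∀ s, s ≠ t → 0 < taylorRem y u t s) ∨ ∀ s, s ≠ t → taylorRem y u t s < 0 := by
    intro t
    have hc := h.continuous_y
    rcases strictMono_or_strictAnti_quotientAt (N := fun s => y s - y t) (D := fun s => s - t)
      (c := u t) (t := t) (by fun_prop) (by fun_prop) (fun s hs => sub_ne_zero.2 hs)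
      (by simpa [mul_comm] using (hasDerivAt_iff_isLittleO.1 (h.hasDerivAt_y t)))
      (h.ne_chord t) (fun s hs e => h.rem_y_ne t s hs (by simp only [taylorRem]; linarith))
      with hm | hm
    · left
      intro s hs
      have e : taylorRem y u t s = (s - t) * ((y s - y t) / (s - t) - u t) := by
        have := sub_ne_zero.2 hs
        simp only [taylorRem]
        field_simp
      rw [e]
      rcases lt_or_gt_of_ne hs with h1 | h1
      · have := hm h1
        rw [quotientAt_self, quotientAt_of_ne hs] at this
        exact mul_pos_of_neg_of_neg (by linarith) (by linarith)
      · have := hm h1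
        rw [quotientAt_self, quotientAt_of_ne hs] at this
        exact mul_pos (by linarith) (by linarith)
    · right
      intro s hs
      have e : taylorRem y u t s = (s - t) * ((y s - y t) / (s - t) - u t) := by
        have := sub_ne_zero.2 hs
        simp only [taylorRem]
        field_simp
      rw [e]
      rcases lt_or_gt_of_ne hs with h1 | h1
      · have := hm h1
        rw [quotientAt_self, quotientAt_of_ne hs] at this
        exact mul_neg_of_neg_of_pos (by linarith) (by linarith)
      · have := hm h1
        rw [quotientAt_self, quotientAt_of_ne hs] at this
        exact mul_neg_of_pos_of_neg (by linarith) (by linarith)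
  have hcont : Continuous fun t => taylorRem y u t (t + 1) := by
    have h1 := h.continuous_y
    have h2 := h.continuous_u
    unfold taylorRem
    fun_prop
  rcases pos_or_neg_of_continuous hcont fun t => h.rem_y_ne t _ (by simp) with h1 | h1
  · exact .inl fun t => (key t).resolve_right fun h2 =>
      (h1 t).not_gt (h2 (t + 1) (by simp))
  · exact .inr fun t => (key t).resolve_left fun h2 =>
      (h1 t).not_gt (h2 (t + 1) (by simp))

theorem continuous_rem_y (t : ℝ) : Continuous (taylorRem y u t) := by
  have h1 := h.continuous_y
  unfold taylorRem
  fun_prop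

theorem continuous_rem_z (t : ℝ) : Continuous (taylorRem z v t) := by
  have h1 := h.continuous_z
  unfold taylorRem
  fun_prop

/-- The same argument one order higher: the quotient of the two remainders extends by `w t`, and
comparing its value at `t + 1` with `w t` shows that the direction of monotonicity does not depend
on `t`. -/
theorem ratio_strictMono_or_strictAnti :
    (∀ t, StrictMono (quotientAt (taylorRem z v t) (taylorRem y u t) (w t) t)) ∨
      ∀ t, StrictAnti (quotientAt (taylorRem z v t) (taylorRem y u t) (w t) t) := by
  have key := fun t => strictMono_or_strictAnti_quotientAt (h.continuous_rem_z t)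
    (h.continuous_rem_y t) (h.rem_y_ne t) (h.isLittleO_rem t) (h.ne_rem t) (h.rem_z_ne t)
  have hcont : Continuous fun t =>
      taylorRem z v t (t + 1) / taylorRem y u t (t + 1) - w t := by
    have h1 := h.continuous_y
    have h2 := h.continuous_u
    have h3 := h.continuous_z
    have h4 := h.continuous_v
    have h5 := h.continuous_w
    refine Continuous.sub (Continuous.div ?_ ?_ fun t => h.rem_y_ne t _ (by simp)) h5
    · unfold taylorRem; fun_prop
    · unfold taylorRem; fun_prop
  have hq : ∀ t, quotientAt (taylorRem z v t) (taylorRem y u t) (w t) t (t + 1) =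
      taylorRem z v t (t + 1) / taylorRem y u t (t + 1) := fun t => quotientAt_of_ne (by simp)
  rcases pos_or_neg_of_continuous hcont (fun t e => h.rem_z_ne t (t + 1) (by simp) (by
    have := h.rem_y_ne t (t + 1) (by simp)
    rw [← sub_eq_zero.1 e, div_mul_cancel₀ _ this])) with h1 | h1
  · refine .inl fun t => (key t).resolve_right fun h2 => ?_
    have := h2 (lt_add_one t)
    rw [hq, quotientAt_self] at this
    linarith [h1 t]
  · refine .inr fun t => (key t).resolve_left fun h2 => ?_
    have := h2 (lt_add_one t)
    rw [hq, quotientAt_self] at this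
    linarith [h1 t]

end FrenetFunctions

/-- The convexity and growth properties of the coordinate functions of a hyperconvex Frenet curve
in a chart with suitable signs. -/
structure ConvexFunctions (y z u v w : ℝ → ℝ) : Prop where
  continuous_y : Continuous y
  continuous_z : Continuous z
  continuous_u : Continuous u
  continuous_v : Continuous v
  continuous_w : Continuous w
  tendsto_u_top : Tendsto u atTop atTop
  tendsto_u_bot : Tendsto u atBot atBot
  tendsto_w_top : Tendsto w atTop atTop
  tendsto_w_bot : Tendsto w atBot atBot
  strictMono_u : StrictMono u
  strictMono_w : StrictMono w
  lt_sub_v : ∀ t s, t < s → w t * (u s - u t) < v s - v t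
  sub_v_lt : ∀ t s, t < s → v s - v t < w s * (u s - u t)
  lt_rem_right : ∀ t s, t < s → w t * taylorRem y u t s < taylorRem z v t s
  lt_rem_left : ∀ t s, t < s → w t * taylorRem y u s t < taylorRem z v s t
  rem_left_lt : ∀ t s, t < s → taylorRem z v s t < w s * taylorRem y u s t

theorem tendsto_slope_atTop_of_isLittleO {y u : ℝ → ℝ}
    (hpos : ∀ t s, s ≠ t → 0 < taylorRem y u t s) (hu : StrictMono u)
    (hy : (fun t => t) =o[atTop] y) : Tendsto u atTop atTop := by
  refine hu.monotone.tendsto_atTop_atTop fun M => ?_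
  -- If `u` stayed below `M`, the tangents at `0` and at `t` would bound `y t` between affine
  -- functions of `t`, so `|y t| ≤ C * t`, against `t = o(y)`.
  by_contra! hM
  set C := |y 0| + |M| + |u 0| + 1 with hC
  have hC0 : 0 < C := by positivity
  have hbd : ∀ t, 1 ≤ t → |y t| ≤ C * t := by
    intro t ht
    have h1 := hpos t 0 (by linarith)
    have h2 := hpos 0 t (by linarith)
    simp only [taylorRem] at h1 h2
    have h3 : t * u t ≤ t * M := mul_le_mul_of_nonneg_left (hM t).le (by linarith)
    have h4 : |y 0| ≤ |y 0| * t := le_mul_of_one_le_right (abs_nonneg _) ht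
    have h5 : M * t ≤ |M| * t := mul_le_mul_of_nonneg_right (le_abs_self _) (by linarith)
    have h6 : -|u 0| * t ≤ u 0 * t :=
      mul_le_mul_of_nonneg_right (neg_abs_le _) (by linarith)
    have h7 := abs_nonneg M
    have h8 := abs_nonneg (u 0)
    have h9 : 0 ≤ |M| * t := by positivity
    have h10 : 0 ≤ |u 0| * t := by positivity
    rw [abs_le, hC]
    constructor
    · nlinarith [neg_abs_le (y 0)]
    · nlinarith [le_abs_self (y 0)]
  have h1 := hy.def (c := 1 / (2 * C)) (by positivity)
  obtain ⟨t, h2, h3⟩ := (h1.and (eventually_ge_atTop 1)).exists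
  rw [Real.norm_eq_abs, Real.norm_eq_abs, abs_of_pos (by linarith)] at h2
  have h4 := mul_le_mul_of_nonneg_left (hbd t h3) (show 0 ≤ 1 / (2 * C) by positivity)
  have h5 : 1 / (2 * C) * (C * t) = t / 2 := by field_simp
  linarith

theorem tendsto_slope_atBot_of_isLittleO {y u : ℝ → ℝ}
    (hpos : ∀ t s, s ≠ t → 0 < taylorRem y u t s) (hu : StrictMono u)
    (hy : (fun t => t) =o[atBot] y) : Tendsto u atBot atBot := by
  have h := tendsto_slope_atTop_of_isLittleO (y := fun t => y (-t)) (u := fun t => -u (-t))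
    (fun t s hs => by
      have := hpos (-t) (-s) (fun e => hs (neg_injective e))
      simp only [taylorRem] at this ⊢
      linarith)
    (fun a b hab => neg_lt_neg (hu (neg_lt_neg hab)))
    ((hy.comp_tendsto tendsto_neg_atTop_atBot).neg_left.congr_left fun t => by simp)
  have h2 := (tendsto_neg_atTop_atBot.comp h).comp tendsto_neg_atBot_atTop
  simpa [Function.comp_def] using h2

namespace FrenetFunctions

variable {y z u v w : ℝ → ℝ} (h : FrenetFunctions y z u v w)
  (hpos : ∀ t s, s ≠ t → 0 < taylorRem y u t s)
  (hmono : ∀ t, StrictMono (quotientAt (taylorRem z v t) (taylorRem y u t) (w t) t))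

include hpos in
theorem strictMono_u : StrictMono u := by
  intro t s hts
  have h1 := taylorRem_add y u t s
  have h2 := hpos t s hts.ne'
  have h3 := hpos s t hts.ne
  have : 0 < (s - t) * (u s - u t) := by linarith
  linarith [(pos_iff_pos_of_mul_pos this).1 (by linarith)]

include hpos hmono in
theorem lt_rem_of_lt {t s : ℝ} (hts : t < s) : w t * taylorRem y u t s < taylorRem z v t s := by
  have h1 := hmono t hts
  rwa [quotientAt_self, quotientAt_of_ne hts.ne', lt_div_iff₀ (hpos t s hts.ne')] at h1

include hpos hmono in
theorem rem_lt_of_lt {t s : ℝ} (hts : t < s) : taylorRem z v s t < w s * taylorRem y u s t := by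
  have h1 := hmono s hts
  rwa [quotientAt_self, quotientAt_of_ne hts.ne, div_lt_iff₀ (hpos s t hts.ne)] at h1

include h hpos hmono in
-- The monotone quotient of remainders has nonnegative derivative at `s`. The derivative is not zero
-- by `ne_tangent`, which expresses transversality of two tangent lines.
theorem rem_mul_lt {t s : ℝ} (hts : t < s) :
    taylorRem z v t s * (u s - u t) < taylorRem y u t s * (v s - v t) := by
  refine lt_of_le_of_ne ?_ (h.ne_tangent t s hts.ne').symm
  have hD := hpos t s hts.ne'
  have d1 : HasDerivAt (taylorRem z v t) (v s - v t) s :=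
    hasDerivAt_taylorRem (h.hasDerivAt_z s)
  have d2 : HasDerivAt (taylorRem y u t) (u s - u t) s :=
    hasDerivAt_taylorRem (h.hasDerivAt_y s)
  have d3 := d1.div d2 hD.ne'
  have h0 : 0 ≤ ((v s - v t) * taylorRem y u t s - taylorRem z v t s * (u s - u t)) /
      taylorRem y u t s ^ 2 := by
    refine ge_of_tendsto (hasDerivAt_iff_tendsto_slope.1 d3) ?_
    have hnt : ∀ᶠ r in 𝓝[≠] s, r ≠ t :=
      eventually_nhdsWithin_of_eventually_nhds (eventually_ne_nhds hts.ne')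
    filter_upwards [hnt, self_mem_nhdsWithin] with r hr hrs
    have hrs : r ≠ s := hrs
    have e1 : (taylorRem z v t / taylorRem y u t) r =
        quotientAt (taylorRem z v t) (taylorRem y u t) (w t) t r := (quotientAt_of_ne hr).symm
    have e2 : (taylorRem z v t / taylorRem y u t) s =
        quotientAt (taylorRem z v t) (taylorRem y u t) (w t) t s := (quotientAt_of_ne hts.ne').symm
    rw [slope_def_field, e1, e2]
    rcases lt_or_gt_of_ne hrs with h1 | h1
    · exact div_nonneg_of_nonpos (by linarith [hmono t h1]) (by linarith)
    · exact div_nonneg (by linarith [hmono t h1]) (by linarith)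
  have h1 := (div_nonneg_iff.1 h0).resolve_right fun h2 => by
    have : 0 < taylorRem y u t s ^ 2 := by positivity
    linarith [h2.2]
  linarith [h1.1]

include h hpos hmono in
-- With `taylorRem_add` the sign of the derivative becomes a comparison symmetric in the base
-- points. Writing `ρ t s` for the quotient of the remainders of `z` and `y` based at `t`, it gives
-- the chain `w t < ρ t s < ρ s t < w s`, from which the next lemmas follow.
theorem rem_mul_rem_lt {t s : ℝ} (hts : t < s) :
    taylorRem z v t s * taylorRem y u s t < taylorRem z v s t * taylorRem y u t s := by
  have h1 := h.rem_mul_lt hpos hmono hts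
  have e1 := taylorRem_add y u t s
  have e2 := taylorRem_add z v t s
  have h2 := mul_lt_mul_of_pos_left h1 (sub_pos.2 hts)
  have e3 : (s - t) * (taylorRem z v t s * (u s - u t)) =
      taylorRem z v t s * (taylorRem y u t s + taylorRem y u s t) := by rw [e1]; ring
  have e4 : (s - t) * (taylorRem y u t s * (v s - v t)) =
      taylorRem y u t s * (taylorRem z v t s + taylorRem z v s t) := by rw [e2]; ring
  rw [e3, e4] at h2
  linarith

include h hpos hmono in
theorem lt_rem_left {t s : ℝ} (hts : t < s) : w t * taylorRem y u s t < taylorRem z v s t := by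
  have h1 := h.rem_mul_rem_lt hpos hmono hts
  have h2 := lt_rem_of_lt hpos hmono hts
  have hD := hpos t s hts.ne'
  have hD' := hpos s t hts.ne
  have h3 := mul_lt_mul_of_pos_right h2 hD'
  exact lt_of_mul_lt_mul_right (by linarith) hD.le

include h hpos hmono in
theorem rem_right_lt {t s : ℝ} (hts : t < s) : taylorRem z v t s < w s * taylorRem y u t s := by
  have h1 := h.rem_mul_rem_lt hpos hmono hts
  have h2 := rem_lt_of_lt hpos hmono hts
  have hD := hpos t s hts.ne'
  have hD' := hpos s t hts.ne
  have h3 := mul_lt_mul_of_pos_right h2 hD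
  exact lt_of_mul_lt_mul_right (by linarith) hD'.le

include h hpos hmono in
-- By `taylorRem_add`, the slope of the chord of `(u, v)` is a mediant of the quotients `ρ t s` and
-- `ρ s t`, both of which exceed `w t`.
theorem lt_sub_v {t s : ℝ} (hts : t < s) : w t * (u s - u t) < v s - v t := by
  have h1 := lt_rem_of_lt hpos hmono hts
  have h2 := h.lt_rem_left hpos hmono hts
  have e1 := taylorRem_add y u t s
  have e2 := taylorRem_add z v t s
  refine lt_of_mul_lt_mul_left ?_ (sub_nonneg.2 hts.le)
  rw [← e2, mul_left_comm, ← e1]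
  linarith

include h hpos hmono in
theorem sub_v_lt {t s : ℝ} (hts : t < s) : v s - v t < w s * (u s - u t) := by
  have h1 := h.rem_right_lt hpos hmono hts
  have h2 := rem_lt_of_lt hpos hmono hts
  have e1 := taylorRem_add y u t s
  have e2 := taylorRem_add z v t s
  refine lt_of_mul_lt_mul_left ?_ (sub_nonneg.2 hts.le)
  rw [← e2, mul_left_comm, ← e1]
  linarith

include h hpos hmono in
theorem strictMono_w : StrictMono w := by
  intro t s hts
  have h1 := (h.lt_sub_v hpos hmono hts).trans (h.sub_v_lt hpos hmono hts)
  exact lt_of_mul_lt_mul_right h1 (sub_nonneg.2 (strictMono_u hpos hts).le)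

include h in
-- The remainders based at `0` differ from `y` and `z` by affine functions, which are negligible
-- against `z`.
theorem isLittleO_rem_cocompact :
    taylorRem y u 0 =o[cocompact ℝ] taylorRem z v 0 := by
  have h1 : (fun _ => (1 : ℝ)) =o[cocompact ℝ] fun t : ℝ => t := by
    refine isLittleO_const_left.2 (.inr ?_)
    exact tendsto_norm_cocompact_atTop
  have hc : ∀ c : ℝ, (fun _ => c) =o[cocompact ℝ] z := fun c => by
    have := (h1.trans h.isLittleO_id_z).const_mul_left c
    simpa using this
  have h2 : taylorRem y u 0 =o[cocompact ℝ] z := by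
    have := (h.isLittleO_y_z.sub (hc (y 0))).sub (h.isLittleO_id_z.const_mul_left (u 0))
    refine this.congr_left fun t => ?_
    simp [taylorRem, mul_comm]
  have h3 : (fun t => taylorRem z v 0 t - z t) =o[cocompact ℝ] z := by
    have := (hc (-z 0)).sub (h.isLittleO_id_z.const_mul_left (v 0))
    refine this.congr_left fun t => ?_
    simp only [taylorRem]
    ring
  exact h2.trans_isBigO (IsEquivalent.isBigO_symm h3)

include h hpos hmono in
theorem tendsto_w_atTop : Tendsto w atTop atTop := by
  refine (h.strictMono_w hpos hmono).monotone.tendsto_atTop_atTop fun M => ?_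
  -- With this constant the remainder of `z` is at least `|M| + |w 0| + 1` times that of `y` in
  -- absolute value. The lower bound by `w 0` excludes the negative sign, and the upper bound by `w
  -- s` then forces `M ≤ w s`.
  have h1 := (h.isLittleO_rem_cocompact.mono atTop_le_cocompact).def
    (c := 1 / (|M| + |w 0| + 1)) (by positivity)
  obtain ⟨s, h2, h3⟩ := (h1.and (eventually_gt_atTop 0)).exists
  refine ⟨s, ?_⟩
  have hD := hpos 0 s h3.ne'
  have h4 := lt_rem_of_lt hpos hmono h3
  have h5 := h.rem_right_lt hpos hmono h3
  rw [Real.norm_eq_abs, Real.norm_eq_abs, abs_of_pos hD, div_mul_eq_mul_div, one_mul,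
    le_div_iff₀ (by positivity)] at h2
  set D := taylorRem y u 0 s
  rcases abs_cases (taylorRem z v 0 s) with ⟨e, -⟩ | ⟨e, -⟩
  · rw [e] at h2
    by_contra! hM
    have h6 : w s * D < M * D := mul_lt_mul_of_pos_right hM hD
    nlinarith [le_abs_self M, abs_nonneg (w 0)]
  · rw [e] at h2
    nlinarith [neg_abs_le (w 0), abs_nonneg M]

include h hpos hmono in
theorem tendsto_w_atBot : Tendsto w atBot atBot := by
  refine (h.strictMono_w hpos hmono).monotone.tendsto_atBot_atBot fun M => ?_
  have h1 := (h.isLittleO_rem_cocompact.mono atBot_le_cocompact).def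
    (c := 1 / (|M| + |w 0| + 1)) (by positivity)
  obtain ⟨s, h2, h3⟩ := (h1.and (eventually_lt_atBot 0)).exists
  refine ⟨s, ?_⟩
  have hD := hpos 0 s h3.ne
  have h4 := rem_lt_of_lt hpos hmono h3
  have h5 := h.lt_rem_left hpos hmono h3
  rw [Real.norm_eq_abs, Real.norm_eq_abs, abs_of_pos hD, div_mul_eq_mul_div, one_mul,
    le_div_iff₀ (by positivity)] at h2
  set D := taylorRem y u 0 s
  rcases abs_cases (taylorRem z v 0 s) with ⟨e, -⟩ | ⟨e, -⟩
  · rw [e] at h2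
    nlinarith [le_abs_self (w 0), abs_nonneg M]
  · rw [e] at h2
    by_contra! hM
    have h6 : M * D < w s * D := mul_lt_mul_of_pos_right hM hD
    nlinarith [neg_abs_le M, abs_nonneg (w 0)]

include h hpos hmono in
theorem convexFunctions : ConvexFunctions y z u v w where
  continuous_y := h.continuous_y
  continuous_z := h.continuous_z
  continuous_u := h.continuous_u
  continuous_v := h.continuous_v
  continuous_w := h.continuous_w
  tendsto_u_top := tendsto_slope_atTop_of_isLittleO hpos (strictMono_u hpos)
    (h.isLittleO_id_y.mono atTop_le_cocompact)
  tendsto_u_bot := tendsto_slope_atBot_of_isLittleO hpos (strictMono_u hpos)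
    (h.isLittleO_id_y.mono atBot_le_cocompact)
  tendsto_w_top := h.tendsto_w_atTop hpos hmono
  tendsto_w_bot := h.tendsto_w_atBot hpos hmono
  strictMono_u := strictMono_u hpos
  strictMono_w := h.strictMono_w hpos hmono
  lt_sub_v _ _ hts := h.lt_sub_v hpos hmono hts
  sub_v_lt _ _ hts := h.sub_v_lt hpos hmono hts
  lt_rem_right _ _ hts := lt_rem_of_lt hpos hmono hts
  lt_rem_left _ _ hts := h.lt_rem_left hpos hmono hts
  rem_left_lt _ _ hts := rem_lt_of_lt hpos hmono hts

end FrenetFunctions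

end RealFunctions

/-! ### Quantitative convergence, general position and adapted coordinates. -/

section Frames

/-- If subspaces `W i` converge to `W₀`, the map `φ` is injective on `W₀` and `ψ` vanishes on `W₀`,
then `ψ` is small compared to `φ` on `W i`. -/
theorem eventually_norm_le_of_tendsto_starProjection {E F G ι : Type*} [NormedAddCommGroup E]
    [InnerProductSpace ℝ E] [FiniteDimensional ℝ E] [NormedAddCommGroup F] [NormedSpace ℝ F]
    [NormedAddCommGroup G] [NormedSpace ℝ G] {l : Filter ι} {W : ι → Submodule ℝ E}
    {W₀ : Submodule ℝ E}
    (hW : Tendsto (fun i => (W i).starProjection) l (𝓝 W₀.starProjection))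
    (φ : E →L[ℝ] F) (ψ : E →L[ℝ] G) (hφ : ∀ v ∈ W₀, φ v = 0 → v = 0) (hψ : ∀ v ∈ W₀, ψ v = 0)
    {ε : ℝ} (hε : 0 < ε) : ∀ᶠ i in l, ∀ v ∈ W i, ‖ψ v‖ ≤ ε * ‖φ v‖ := by
  obtain ⟨K, hK0, hK⟩ := ((φ : E →ₗ[ℝ] F).comp W₀.subtype).exists_antilipschitzWith
    (LinearMap.ker_eq_bot'.2 fun v hv => Subtype.ext (hφ v v.2 hv))
  have hK' : ∀ v ∈ W₀, ‖v‖ ≤ K * ‖φ v‖ := fun v hv => by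
    simpa using hK.le_mul_norm_sub ⟨v, hv⟩ 0
  have hK0 : (0 : ℝ) < K := hK0
  -- The first bound lets half of `‖v‖` be absorbed, giving `‖v‖ ≤ 2 * K * ‖φ v‖`; the second turns
  -- `‖ψ v‖ ≤ ‖ψ‖ * δ * ‖v‖` into the claim.
  set δ : ℝ := min (1 / (2 * (1 + K * ‖φ‖))) (ε / (2 * K * (‖ψ‖ + 1))) with hδ
  have hδ0 : 0 < δ := lt_min (by positivity) (by positivity)
  filter_upwards [Metric.tendsto_nhds.1 hW δ hδ0] with i hi v hv
  set v' := W₀.starProjection v with hv'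
  have hmem : v' ∈ W₀ := W₀.starProjection_apply_mem v
  have h1 : ‖v - v'‖ ≤ δ * ‖v‖ := by
    have : v - v' = ((W i).starProjection - W₀.starProjection) v := by
      rw [sub_apply, Submodule.starProjection_eq_self_iff.2 hv]
    rw [this]
    refine (ContinuousLinearMap.le_opNorm _ _).trans
      (mul_le_mul_of_nonneg_right ?_ (norm_nonneg _))
    rw [← dist_eq_norm]
    exact hi.le
  have h2 : ‖φ (v - v')‖ ≤ ‖φ‖ * ‖v - v'‖ := φ.le_opNorm _
  have h3 : ‖ψ (v - v')‖ ≤ ‖ψ‖ * ‖v - v'‖ := ψ.le_opNorm _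
  rw [map_sub, hψ v' hmem, sub_zero] at h3
  have h4 : ‖v'‖ ≤ K * ‖φ v'‖ := hK' v' hmem
  have h5 : ‖v‖ ≤ ‖v'‖ + ‖v - v'‖ := by
    have := norm_add_le v' (v - v')
    rwa [add_sub_cancel] at this
  have h6 : ‖φ v'‖ ≤ ‖φ v‖ + ‖φ (v - v')‖ := by
    have := norm_sub_le (φ v) (φ (v - v'))
    rwa [← map_sub, sub_sub_cancel] at this
  have h7 : ‖v‖ ≤ K * ‖φ v‖ + (1 + K * ‖φ‖) * (δ * ‖v‖) := by
    have e1 : K * ‖φ v'‖ ≤ K * (‖φ v‖ + ‖φ‖ * (δ * ‖v‖)) := by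
      gcongr
      exact h6.trans (by gcongr; exact h2.trans (by gcongr))
    linarith
  have h8 : (1 + K * ‖φ‖) * (δ * ‖v‖) ≤ ‖v‖ / 2 := by
    have e : (1 + K * ‖φ‖) * δ ≤ 1 / 2 := by
      have := mul_le_mul_of_nonneg_left (min_le_left (1 / (2 * (1 + K * ‖φ‖)))
        (ε / (2 * K * (‖ψ‖ + 1)))) (show 0 ≤ 1 + K * ‖φ‖ by positivity)
      refine this.trans (le_of_eq ?_)
      field_simp
    have := mul_le_mul_of_nonneg_right e (norm_nonneg v)
    linarith
  have h9 : ‖v‖ ≤ 2 * K * ‖φ v‖ := by linarith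
  have h10 : ‖ψ‖ * δ * (2 * K) ≤ ε := by
    have := mul_le_mul_of_nonneg_left (min_le_right (1 / (2 * (1 + K * ‖φ‖)))
        (ε / (2 * K * (‖ψ‖ + 1)))) (show 0 ≤ (‖ψ‖ + 1) * (2 * K) by positivity)
    have e : (‖ψ‖ + 1) * (2 * K) * (ε / (2 * K * (‖ψ‖ + 1))) = ε := by field_simp
    rw [e] at this
    refine le_trans ?_ this
    have : 0 ≤ δ * (2 * K) := by positivity
    linarith
  calc ‖ψ v‖ ≤ ‖ψ‖ * (δ * ‖v‖) := h3.trans (by gcongr)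
    _ ≤ ‖ψ‖ * (δ * (2 * K * ‖φ v‖)) := by gcongr
    _ = ‖ψ‖ * δ * (2 * K) * ‖φ v‖ := by ring
    _ ≤ ε * ‖φ v‖ := by gcongr

namespace IsHyperconvexFrenet

variable {B : Type*} [TopologicalSpace B] {n : ℕ} {ξ : B → FullFlag n} (hξ : IsHyperconvexFrenet ξ)
include hξ

theorem tendsto_sub (k : Fin (n + 1)) (x : B) :
    Tendsto (fun b => ((ξ b).sub k).starProjection) (𝓝 x) (𝓝 ((ξ x).sub k).starProjection) := by
  have h1 : Continuous fun F : FullFlag n => fun k => (F.sub k).starProjection :=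
    continuous_induced_dom
  have h2 := (continuous_apply k).comp (h1.comp hξ.continuous)
  exact h2.tendsto x

theorem eq_zero_of_sum_eq_zero {j : ℕ} (k : Fin j → Fin (n + 1)) (x : Fin j → B) (v : Fin j → Vec n)
    (hk : ∀ l, 0 < (k l : ℕ)) (hx : Function.Injective x) (hn : ∑ l, (k l : ℕ) ≤ n)
    (hv : ∀ l, v l ∈ (ξ (x l)).sub (k l)) (h0 : ∑ l, v l = 0) (l : Fin j) : v l = 0 := by
  refine Submodule.disjoint_def.1 (hξ.general_position j k x hk hx hn l) _ (hv l) ?_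
  rw [← Finset.add_sum_erase _ _ (Finset.mem_univ l)] at h0
  rw [eq_neg_of_add_eq_zero_left h0]
  refine neg_mem (sum_mem fun i hi => ?_)
  have hle : (ξ (x i)).sub (k i) ≤ ⨆ j', ⨆ (_ : j' ≠ l), (ξ (x j')).sub (k j') :=
    le_iSup₂_of_le i (Finset.ne_of_mem_erase hi) le_rfl
  exact hle (hv i)

theorem eq_zero_of_mem_two {k₁ k₂ : Fin (n + 1)} {x₁ x₂ : B} {v : Vec n}
    (hk₁ : 0 < (k₁ : ℕ)) (hk₂ : 0 < (k₂ : ℕ)) (hn : (k₁ : ℕ) + k₂ ≤ n) (hx : x₁ ≠ x₂)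
    (h₁ : v ∈ (ξ x₁).sub k₁) (h₂ : v ∈ (ξ x₂).sub k₂) : v = 0 := by
  refine hξ.eq_zero_of_sum_eq_zero ![k₁, k₂] ![x₁, x₂] ![v, -v] ?_ ?_ ?_ ?_ ?_ 0
  · intro l; fin_cases l <;> assumption
  · intro i j hij
    fin_cases i <;> fin_cases j <;> simp_all
  · simpa [Fin.sum_univ_two] using hn
  · intro l
    fin_cases l
    · exact h₁
    · exact neg_mem h₂
  · simp [Fin.sum_univ_two]

theorem eq_zero_of_add_eq_zero {k₁ k₂ k₃ : Fin (n + 1)} {x₁ x₂ x₃ : B} {v₁ v₂ v₃ : Vec n}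
    (hk₁ : 0 < (k₁ : ℕ)) (hk₂ : 0 < (k₂ : ℕ)) (hk₃ : 0 < (k₃ : ℕ))
    (hn : (k₁ : ℕ) + k₂ + k₃ ≤ n) (hx₁₂ : x₁ ≠ x₂) (hx₁₃ : x₁ ≠ x₃) (hx₂₃ : x₂ ≠ x₃)
    (h₁ : v₁ ∈ (ξ x₁).sub k₁) (h₂ : v₂ ∈ (ξ x₂).sub k₂) (h₃ : v₃ ∈ (ξ x₃).sub k₃)
    (h : v₁ + v₂ + v₃ = 0) : v₁ = 0 := by
  refine hξ.eq_zero_of_sum_eq_zero ![k₁, k₂, k₃] ![x₁, x₂, x₃] ![v₁, v₂, v₃] ?_ ?_ ?_ ?_ ?_ 0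
  · intro l; fin_cases l <;> assumption
  · intro i j hij
    fin_cases i <;> fin_cases j <;> simp_all
  · simpa [Fin.sum_univ_three] using hn
  · intro l
    fin_cases l <;> assumption
  · simpa [Fin.sum_univ_three] using h

theorem eq_zero_of_add_add_eq_zero {k₁ k₂ k₃ k₄ : Fin (n + 1)} {x₁ x₂ x₃ x₄ : B}
    {v₁ v₂ v₃ v₄ : Vec n}
    (hk₁ : 0 < (k₁ : ℕ)) (hk₂ : 0 < (k₂ : ℕ)) (hk₃ : 0 < (k₃ : ℕ)) (hk₄ : 0 < (k₄ : ℕ))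
    (hn : (k₁ : ℕ) + k₂ + k₃ + k₄ ≤ n) (hx₁₂ : x₁ ≠ x₂) (hx₁₃ : x₁ ≠ x₃) (hx₁₄ : x₁ ≠ x₄)
    (hx₂₃ : x₂ ≠ x₃) (hx₂₄ : x₂ ≠ x₄) (hx₃₄ : x₃ ≠ x₄)
    (h₁ : v₁ ∈ (ξ x₁).sub k₁) (h₂ : v₂ ∈ (ξ x₂).sub k₂) (h₃ : v₃ ∈ (ξ x₃).sub k₃)
    (h₄ : v₄ ∈ (ξ x₄).sub k₄) (h : v₁ + v₂ + v₃ + v₄ = 0) : v₁ = 0 := by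
  refine hξ.eq_zero_of_sum_eq_zero ![k₁, k₂, k₃, k₄] ![x₁, x₂, x₃, x₄] ![v₁, v₂, v₃, v₄]
    ?_ ?_ ?_ ?_ ?_ 0
  · intro l; fin_cases l <;> assumption
  · intro i j hij
    fin_cases i <;> fin_cases j <;> simp_all
  · simpa [Fin.sum_univ_four] using hn
  · intro l
    fin_cases l <;> assumption
  · simpa [Fin.sum_univ_four] using h

/-- Limit compatibility with one of the two points held at `x`. This is the source of the
derivatives and of the behavior at infinity. -/
theorem tendsto_sub_sup_sub [FirstCountableTopology B] {k₁ k₂ p : Fin (n + 1)}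
    (hk₁ : 0 < (k₁ : ℕ)) (hk₂ : 0 < (k₂ : ℕ)) (hp : (k₁ : ℕ) + k₂ = p) (x : B) :
    Tendsto (fun b => ((ξ x).sub k₁ ⊔ (ξ b).sub k₂).starProjection) (𝓝[≠] x)
      (𝓝 ((ξ x).sub p).starProjection) := by
  rw [tendsto_iff_seq_tendsto]
  intro s hs
  obtain ⟨hs1, hs2⟩ := tendsto_nhdsWithin_iff.1 hs
  -- Limit compatibility asks for distinct points at every index, so an initial segment of the
  -- sequence is dropped.
  obtain ⟨N, hN⟩ := eventually_atTop.1 hs2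
  rw [← tendsto_add_atTop_iff_nat N]
  have h := hξ.limit_compatibility 2 ![k₁, k₂] p (fun l => by fin_cases l <;> assumption)
    (by simpa [Fin.sum_univ_two] using hp) x (fun m => ![x, s (m + N)])
    (fun m i j hij => by
      have h1 : s (m + N) ≠ x := hN (m + N) (Nat.le_add_left _ _)
      fin_cases i <;> fin_cases j <;> simp_all [eq_comm])
    (fun l => by
      fin_cases l
      · exact tendsto_const_nhds
      · exact (tendsto_add_atTop_iff_nat N).2 hs1)
  refine h.congr fun m => ?_
  congr 1
  refine le_antisymm (iSup_le fun l => ?_) (sup_le ?_ ?_)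
  · fin_cases l
    · exact le_sup_left
    · exact le_sup_right
  · exact le_iSup (fun l => (ξ ((![x, s (m + N)] : Fin 2 → B) l)).sub
      ((![k₁, k₂] : Fin 2 → Fin (n + 1)) l)) 0
  · exact le_iSup (fun l => (ξ ((![x, s (m + N)] : Fin 2 → B) l)).sub
      ((![k₁, k₂] : Fin 2 → Fin (n + 1)) l)) 1

end IsHyperconvexFrenet

/-- Linear coordinates on `ℝ⁴` for which the flag is the standard descending flag. -/
structure AdaptedCoords (F : FullFlag 4) (Φ : Vec 4 ≃L[ℝ] (Fin 4 → ℝ)) : Prop where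
  mem_one : ∀ p, p ∈ F.sub 1 ↔ Φ p 0 = 0 ∧ Φ p 1 = 0 ∧ Φ p 2 = 0
  mem_two : ∀ p, p ∈ F.sub 2 ↔ Φ p 0 = 0 ∧ Φ p 1 = 0
  mem_three : ∀ p, p ∈ F.sub 3 ↔ Φ p 0 = 0

/-- The basis is filled from its last vector: `e3` spans the line, and each of `e2`, `e1`, `e0` is
chosen outside the preceding subspace, so that belonging to the flag means vanishing of the first
coordinates. -/
theorem exists_adaptedCoords (F : FullFlag 4) : ∃ Φ, AdaptedCoords F Φ := by
  have m12 : F.sub 1 ≤ F.sub 2 := F.mono (by decide)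
  have m23 : F.sub 2 ≤ F.sub 3 := F.mono (by decide)
  have d1 : Module.finrank ℝ (F.sub 1) = 1 := F.finrank_sub 1
  have d2 : Module.finrank ℝ (F.sub 2) = 2 := F.finrank_sub 2
  have d3 : Module.finrank ℝ (F.sub 3) = 3 := F.finrank_sub 3
  have key : ∀ W W' : Submodule ℝ (Vec 4), W ≤ W' → Module.finrank ℝ W ≠ Module.finrank ℝ W' →
      ∃ e ∈ W', e ∉ W := fun W W' hW hd => by
    by_contra! hcon
    exact hd (congrArg (fun U : Submodule ℝ (Vec 4) => Module.finrank ℝ U) (le_antisymm hW hcon))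
  obtain ⟨e3, h3, h3'⟩ := key ⊥ (F.sub 1) bot_le (by simp [d1])
  obtain ⟨e2, h2, h2'⟩ := key _ _ m12 (by omega)
  obtain ⟨e1, h1, h1'⟩ := key _ _ m23 (by omega)
  obtain ⟨e0, -, h0'⟩ := key (F.sub 3) ⊤ le_top (by simp [d3])
  have hmem : ∀ (W : Submodule ℝ (Vec 4)) (c : ℝ) (e : Vec 4), e ∉ W → c • e ∈ W → c = 0 :=
    fun W c e he hc => by
      by_contra hc0
      exact he ((W.smul_mem_iff hc0).1 hc)
  have f3 : ∀ a b c d : ℝ, a • e0 + b • e1 + c • e2 + d • e3 ∈ F.sub 3 ↔ a = 0 := by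
    intro a b c d
    have hr : b • e1 + c • e2 + d • e3 ∈ F.sub 3 :=
      add_mem (add_mem (Submodule.smul_mem _ _ h1) (Submodule.smul_mem _ _ (m23 h2)))
        (Submodule.smul_mem _ _ (m23 (m12 h3)))
    constructor
    · intro h
      refine hmem _ a e0 h0' ?_
      have := sub_mem h hr
      rwa [show a • e0 + b • e1 + c • e2 + d • e3 - (b • e1 + c • e2 + d • e3) = a • e0 by
        abel] at this
    · rintro rfl
      rwa [zero_smul, zero_add]
  have f2 : ∀ a b c d : ℝ, a • e0 + b • e1 + c • e2 + d • e3 ∈ F.sub 2 ↔ a = 0 ∧ b = 0 := by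
    intro a b c d
    have hr : c • e2 + d • e3 ∈ F.sub 2 :=
      add_mem (Submodule.smul_mem _ _ h2) (Submodule.smul_mem _ _ (m12 h3))
    constructor
    · intro h
      have ha := (f3 a b c d).1 (m23 h)
      subst ha
      refine ⟨rfl, hmem _ b e1 h1' ?_⟩
      have := sub_mem h hr
      rwa [show (0 : ℝ) • e0 + b • e1 + c • e2 + d • e3 - (c • e2 + d • e3) = b • e1 by
        rw [zero_smul]; abel] at this
    · rintro ⟨rfl, rfl⟩
      rwa [zero_smul, zero_smul, zero_add, zero_add]
  have f1 : ∀ a b c d : ℝ, a • e0 + b • e1 + c • e2 + d • e3 ∈ F.sub 1 ↔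
      a = 0 ∧ b = 0 ∧ c = 0 := by
    intro a b c d
    have hr : d • e3 ∈ F.sub 1 := Submodule.smul_mem _ _ h3
    constructor
    · intro h
      obtain ⟨rfl, rfl⟩ := (f2 a b c d).1 (m12 h)
      refine ⟨rfl, rfl, hmem _ c e2 h2' ?_⟩
      have := sub_mem h hr
      rwa [show (0 : ℝ) • e0 + (0 : ℝ) • e1 + c • e2 + d • e3 - d • e3 = c • e2 by
        rw [zero_smul, zero_smul]; abel] at this
    · rintro ⟨rfl, rfl, rfl⟩
      rwa [zero_smul, zero_smul, zero_smul, zero_add, zero_add, zero_add]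
  have hli : LinearIndependent ℝ ![e0, e1, e2, e3] := by
    rw [Fintype.linearIndependent_iff]
    intro g hg
    rw [Fin.sum_univ_four] at hg
    have hg' : g 0 • e0 + g 1 • e1 + g 2 • e2 + g 3 • e3 = 0 := hg
    obtain ⟨g0, g1, g2⟩ := (f1 _ _ _ _).1 (hg' ▸ zero_mem (F.sub 1))
    have g3 : g 3 = 0 := by
      rw [g0, g1, g2, zero_smul, zero_smul, zero_smul, zero_add, zero_add, zero_add] at hg'
      exact (smul_eq_zero.1 hg').resolve_right fun h => h3' (h ▸ zero_mem _)
    intro i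
    fin_cases i <;> assumption
  let b := basisOfLinearIndependentOfCardEqFinrank hli (by simp)
  have hb : ∀ p, p = b.equivFun p 0 • e0 + b.equivFun p 1 • e1 + b.equivFun p 2 • e2 +
      b.equivFun p 3 • e3 := by
    intro p
    conv_lhs => rw [← b.sum_equivFun p, Fin.sum_univ_four]
    simp [b]
  refine ⟨b.equivFun.toContinuousLinearEquiv, fun p => ?_, fun p => ?_, fun p => ?_⟩
  · conv_lhs => rw [hb p]
    exact f1 _ _ _ _
  · conv_lhs => rw [hb p]
    exact f2 _ _ _ _
  · conv_lhs => rw [hb p]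
    exact f3 _ _ _ _

end Frames

/-! ### Vectors given by their coordinates. -/

section Vectors

variable (Φ : Vec 4 ≃L[ℝ] (Fin 4 → ℝ))

/-- The vector with given coordinates. -/
def coordVec (a b c d : ℝ) : Vec 4 := Φ.symm ![a, b, c, d]

@[simp] theorem apply_coordVec (a b c d : ℝ) : Φ (coordVec Φ a b c d) = ![a, b, c, d] := by
  simp [coordVec]

theorem coordVec_apply (p : Vec 4) : coordVec Φ (Φ p 0) (Φ p 1) (Φ p 2) (Φ p 3) = p := by
  apply Φ.injective
  rw [apply_coordVec]
  ext i
  fin_cases i <;> rfl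

theorem coordVec_add (a b c d a' b' c' d' : ℝ) :
    coordVec Φ a b c d + coordVec Φ a' b' c' d' =
      coordVec Φ (a + a') (b + b') (c + c') (d + d') := by
  apply Φ.injective
  simp

theorem smul_coordVec (r a b c d : ℝ) :
    r • coordVec Φ a b c d = coordVec Φ (r * a) (r * b) (r * c) (r * d) := by
  apply Φ.injective
  simp

theorem coordVec_zero : coordVec Φ 0 0 0 0 = 0 := by
  apply Φ.injective
  rw [apply_coordVec, map_zero]
  ext i
  fin_cases i <;> rfl

theorem coordVec_eq_zero {a b c d : ℝ} (h : coordVec Φ a b c d = 0) :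
    a = 0 ∧ b = 0 ∧ c = 0 ∧ d = 0 := by
  have h1 := congrArg Φ h
  rw [apply_coordVec, map_zero] at h1
  exact ⟨congrFun h1 0, congrFun h1 1, congrFun h1 2, congrFun h1 3⟩

/-- The coordinate functionals. -/
def coordFun (i : Fin 4) : Vec 4 →L[ℝ] ℝ :=
  (ContinuousLinearMap.proj i).comp (Φ : Vec 4 →L[ℝ] (Fin 4 → ℝ))

@[simp] theorem coordFun_apply (i : Fin 4) (p : Vec 4) : coordFun Φ i p = Φ p i := rfl

/-- The coordinates with the sign of the `i`-th coordinate changed. -/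
def flipCoord (i : Fin 4) : Vec 4 ≃L[ℝ] (Fin 4 → ℝ) :=
  Φ.trans (ContinuousLinearEquiv.piCongrRight fun j =>
    if j = i then ContinuousLinearEquiv.neg ℝ else ContinuousLinearEquiv.refl ℝ ℝ)

theorem flipCoord_apply (i j : Fin 4) (p : Vec 4) :
    flipCoord Φ i p j = if j = i then -Φ p j else Φ p j := by
  by_cases h : j = i <;> simp [flipCoord, h]

theorem coordVec_flip_one (a b c d : ℝ) :
    coordVec (flipCoord Φ 1) a b c d = coordVec Φ a (-b) c d := by
  apply (flipCoord Φ 1).injective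
  ext i
  rw [apply_coordVec, flipCoord_apply]
  fin_cases i <;> simp

theorem coordVec_flip_two (a b c d : ℝ) :
    coordVec (flipCoord Φ 2) a b c d = coordVec Φ a b (-c) d := by
  apply (flipCoord Φ 2).injective
  ext i
  rw [apply_coordVec, flipCoord_apply]
  fin_cases i <;> simp

theorem coordVec_flip_three (a b c d : ℝ) :
    coordVec (flipCoord Φ 3) a b c d = coordVec Φ a b c (-d) := by
  apply (flipCoord Φ 3).injective
  ext i
  rw [apply_coordVec, flipCoord_apply]
  fin_cases i <;> simp

variable {Φ} in
theorem AdaptedCoords.flip {F : FullFlag 4} (h : AdaptedCoords F Φ) (i : Fin 4) :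
    AdaptedCoords F (flipCoord Φ i) := by
  have key : ∀ (p : Vec 4) (j : Fin 4), flipCoord Φ i p j = 0 ↔ Φ p j = 0 := fun p j => by
    rw [flipCoord_apply]
    split_ifs <;> simp
  refine ⟨fun p => ?_, fun p => ?_, fun p => ?_⟩
  · rw [key, key, key]; exact h.mem_one p
  · rw [key, key]; exact h.mem_two p
  · rw [key]; exact h.mem_three p

end Vectors

theorem FullFlag.exists_mem_notMem (F : FullFlag 4) {i j : Fin 5} (hij : i < j) :
    ∃ e ∈ F.sub j, e ∉ F.sub i := by
  by_contra! hcon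
  have h1 := congrArg (fun U : Submodule ℝ (Vec 4) => Module.finrank ℝ U)
    (le_antisymm (F.mono hij.le) hcon)
  simp only [F.finrank_sub] at h1
  exact hij.ne (Fin.ext h1)

/-- The remainder of a coordinate of a vector after subtracting multiples of the point and the
tangent vector of the curve. -/
def jetRem (f f' : ℝ → ℝ) (t a b c : ℝ) : ℝ := c - a * f t - (b - a * t) * f' t

/-- The linear functional defining the osculating plane. -/
def oscFun (y z u v w : ℝ → ℝ) (t : ℝ) (q : Fin 4 → ℝ) : ℝ :=
  jetRem z v t (q 0) (q 1) (q 3) - w t * jetRem y u t (q 0) (q 1) (q 2)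

theorem coordVec_decomp_two (Φ : Vec 4 ≃L[ℝ] (Fin 4 → ℝ)) (y z u v : ℝ → ℝ) (t : ℝ) (p : Vec 4) :
    p = Φ p 0 • coordVec Φ 1 t (y t) (z t) + (Φ p 1 - Φ p 0 * t) • coordVec Φ 0 1 (u t) (v t) +
      coordVec Φ 0 0 (jetRem y u t (Φ p 0) (Φ p 1) (Φ p 2))
        (jetRem z v t (Φ p 0) (Φ p 1) (Φ p 3)) := by
  conv_lhs => rw [← coordVec_apply Φ p]
  simp only [smul_coordVec, coordVec_add, jetRem]
  congr 1 <;> ring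

theorem coordVec_decomp_three (Φ : Vec 4 ≃L[ℝ] (Fin 4 → ℝ)) (y z u v w : ℝ → ℝ) (t : ℝ)
    (p : Vec 4) :
    p = Φ p 0 • coordVec Φ 1 t (y t) (z t) + (Φ p 1 - Φ p 0 * t) • coordVec Φ 0 1 (u t) (v t) +
      jetRem y u t (Φ p 0) (Φ p 1) (Φ p 2) • coordVec Φ 0 0 1 (w t) +
      coordVec Φ 0 0 0 (oscFun y z u v w t (Φ p)) := by
  conv_lhs => rw [coordVec_decomp_two Φ y z u v t p]
  rw [add_assoc _ (_ • coordVec Φ 0 0 1 (w t))]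
  congr 1
  simp only [smul_coordVec, coordVec_add, oscFun]
  congr 1 <;> ring

/-! ### Charts of the curve centered at a point of the circle. -/

variable {B : Type*} [TopologicalSpace B]

/-- A parametrization of the complement of a point `x` of the circle in which the curve has the
form `(1, t, y, z)`, with the tangent vector `(0, 1, u, v)` and the vector `(0, 0, 1, w)` in the
osculating plane, in coordinates adapted to the flag at `x`. -/
structure RawChart (ξ : B → FullFlag 4) (x : B) (Φ : Vec 4 ≃L[ℝ] (Fin 4 → ℝ)) (β : ℝ → B)
    (y z u v w : ℝ → ℝ) : Prop where
  adapted : AdaptedCoords (ξ x) Φ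
  continuous_param : Continuous β
  injective_param : Function.Injective β
  param_ne : ∀ t, β t ≠ x
  tendsto_param : Tendsto β (cocompact ℝ) (𝓝[≠] x)
  curve_mem : ∀ t, coordVec Φ 1 t (y t) (z t) ∈ (ξ (β t)).sub 1
  tangent_mem : ∀ t, coordVec Φ 0 1 (u t) (v t) ∈ (ξ (β t)).sub 2
  osculating_mem : ∀ t, coordVec Φ 0 0 1 (w t) ∈ (ξ (β t)).sub 3

namespace RawChart

variable {ξ : B → FullFlag 4} {x : B} {Φ : Vec 4 ≃L[ℝ] (Fin 4 → ℝ)} {β : ℝ → B}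
  {y z u v w : ℝ → ℝ}

theorem neg_y (h : RawChart ξ x Φ β y z u v w) :
    RawChart ξ x (flipCoord Φ 2) β (fun t => -y t) z (fun t => -u t) v (fun t => -w t) where
  adapted := h.adapted.flip 2
  continuous_param := h.continuous_param
  injective_param := h.injective_param
  param_ne := h.param_ne
  tendsto_param := h.tendsto_param
  curve_mem t := by
    rw [coordVec_flip_two, neg_neg]
    exact h.curve_mem t
  tangent_mem t := by
    rw [coordVec_flip_two, neg_neg]
    exact h.tangent_mem t
  osculating_mem t := by
    rw [coordVec_flip_two]
    have := neg_mem (h.osculating_mem t)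
    rw [← neg_one_smul ℝ, smul_coordVec] at this
    simpa using this

theorem neg_z (h : RawChart ξ x Φ β y z u v w) :
    RawChart ξ x (flipCoord Φ 3) β y (fun t => -z t) u (fun t => -v t) (fun t => -w t) where
  adapted := h.adapted.flip 3
  continuous_param := h.continuous_param
  injective_param := h.injective_param
  param_ne := h.param_ne
  tendsto_param := h.tendsto_param
  curve_mem t := by
    rw [coordVec_flip_three, neg_neg]
    exact h.curve_mem t
  tangent_mem t := by
    rw [coordVec_flip_three, neg_neg]
    exact h.tangent_mem t
  osculating_mem t := by
    rw [coordVec_flip_three, neg_neg]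
    exact h.osculating_mem t

variable (h : RawChart ξ x Φ β y z u v w)
include h

theorem tangent_mem_three (t : ℝ) : coordVec Φ 0 1 (u t) (v t) ∈ (ξ (β t)).sub 3 :=
  (ξ (β t)).mono (by decide) (h.tangent_mem t)

theorem curve_mem_two (t : ℝ) : coordVec Φ 1 t (y t) (z t) ∈ (ξ (β t)).sub 2 :=
  (ξ (β t)).mono (by decide) (h.curve_mem t)

theorem curve_mem_three (t : ℝ) : coordVec Φ 1 t (y t) (z t) ∈ (ξ (β t)).sub 3 :=
  (ξ (β t)).mono (by decide) (h.curve_mem t)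

theorem coordVec_last_mem (d : ℝ) : coordVec Φ 0 0 0 d ∈ (ξ x).sub 1 := by
  rw [h.adapted.mem_one]
  simp

theorem coordVec_mem_two (c d : ℝ) : coordVec Φ 0 0 c d ∈ (ξ x).sub 2 := by
  rw [h.adapted.mem_two]
  simp

theorem coordVec_mem_three (b c d : ℝ) : coordVec Φ 0 b c d ∈ (ξ x).sub 3 := by
  rw [h.adapted.mem_three]
  simp

theorem tendsto_param_nhdsNE (t : ℝ) : Tendsto β (𝓝[≠] t) (𝓝[≠] (β t)) :=
  tendsto_nhdsWithin_of_tendsto_nhds_of_eventually_within _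
    (h.continuous_param.continuousAt.tendsto.mono_left nhdsWithin_le_nhds)
    (eventually_nhdsWithin_of_forall fun _ hs => h.injective_param.ne hs)

variable (hξ : IsHyperconvexFrenet ξ)
include hξ

/-- After subtracting multiples of the point and the tangent vector, what is left lies in `ξ²(x)`,
which is transversal to `ξ²(β t)`. The proof of `mem_three_iff` is the same with `ξ¹(x)` and `ξ³(β
t)`. -/
theorem mem_two_iff (t : ℝ) (p : Vec 4) : p ∈ (ξ (β t)).sub 2 ↔
    jetRem y u t (Φ p 0) (Φ p 1) (Φ p 2) = 0 ∧ jetRem z v t (Φ p 0) (Φ p 1) (Φ p 3) = 0 := by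
  have hr := add_mem (Submodule.smul_mem _ (Φ p 0) (h.curve_mem_two t))
    (Submodule.smul_mem _ (Φ p 1 - Φ p 0 * t) (h.tangent_mem t))
  have hd := coordVec_decomp_two Φ y z u v t p
  constructor
  · intro hp
    have h1 := (Submodule.add_mem_iff_right _ hr).1 (hd ▸ hp)
    have h2 := hξ.eq_zero_of_mem_two (by decide) (by decide) (by decide) (h.param_ne t) h1
      (h.coordVec_mem_two _ _)
    exact (coordVec_eq_zero Φ h2).2.2
  · rintro ⟨h1, h2⟩
    rw [h1, h2, coordVec_zero, add_zero] at hd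
    rw [hd]
    exact hr

theorem mem_three_iff (t : ℝ) (p : Vec 4) :
    p ∈ (ξ (β t)).sub 3 ↔ oscFun y z u v w t (Φ p) = 0 := by
  have hr := add_mem (add_mem (Submodule.smul_mem _ (Φ p 0) (h.curve_mem_three t))
    (Submodule.smul_mem _ (Φ p 1 - Φ p 0 * t) (h.tangent_mem_three t)))
    (Submodule.smul_mem _ (jetRem y u t (Φ p 0) (Φ p 1) (Φ p 2)) (h.osculating_mem t))
  have hd := coordVec_decomp_three Φ y z u v w t p
  constructor
  · intro hp
    have h1 := (Submodule.add_mem_iff_right _ hr).1 (hd ▸ hp)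
    have h2 := hξ.eq_zero_of_mem_two (by decide) (by decide) (by decide) (h.param_ne t) h1
      (h.coordVec_last_mem _)
    exact (coordVec_eq_zero Φ h2).2.2.2
  · intro h1
    rw [h1, coordVec_zero, add_zero] at hd
    rw [hd]
    exact hr

/-- The two functionals defining the tangent line. -/
theorem eventually_jetRem_le (t : ℝ) {ι : Type*} {l : Filter ι} {W : ι → Submodule ℝ (Vec 4)}
    (hW : Tendsto (fun i => (W i).starProjection) l (𝓝 ((ξ (β t)).sub 2).starProjection))
    {ε : ℝ} (hε : 0 < ε) : ∀ᶠ i in l, ∀ a b c d : ℝ, coordVec Φ a b c d ∈ W i →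
      |jetRem y u t a b c| ≤ ε * max |a| |b| ∧ |jetRem z v t a b d| ≤ ε * max |a| |b| := by
  have h1 := eventually_norm_le_of_tendsto_starProjection hW
    ((coordFun Φ 0).prod (coordFun Φ 1))
    ((coordFun Φ 2 - y t • coordFun Φ 0 - u t • (coordFun Φ 1 - t • coordFun Φ 0)).prod
      (coordFun Φ 3 - z t • coordFun Φ 0 - v t • (coordFun Φ 1 - t • coordFun Φ 0)))
    (fun p hp h0 => by
      have h2 : Φ p 0 = 0 ∧ Φ p 1 = 0 := by simpa using h0
      exact hξ.eq_zero_of_mem_two (by decide) (by decide) (by decide) (h.param_ne t) hp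
        ((h.adapted.mem_two p).2 h2))
    (fun p hp => by
      obtain ⟨h2, h3⟩ := (h.mem_two_iff hξ t p).1 hp
      simp only [jetRem] at h2 h3
      simp only [ContinuousLinearMap.prod_apply, sub_apply, smul_apply, smul_eq_mul,
        coordFun_apply]
      refine Prod.ext ?_ ?_
      · simp only [Prod.fst_zero]; linarith
      · simp only [Prod.snd_zero]; linarith) hε
  filter_upwards [h1] with i hi a b c d hm
  have h2 := hi _ hm
  simp only [ContinuousLinearMap.prod_apply, sub_apply, smul_apply, smul_eq_mul,
    coordFun_apply, apply_coordVec, Prod.norm_def, Real.norm_eq_abs] at h2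
  have h3 : |c - y t * a - u t * (b - t * a)| ≤ ε * max |a| |b| := (le_max_left _ _).trans h2
  have h4 : |d - z t * a - v t * (b - t * a)| ≤ ε * max |a| |b| := (le_max_right _ _).trans h2
  simp only [jetRem]
  rw [show c - a * y t - (b - a * t) * u t = c - y t * a - u t * (b - t * a) by ring,
    show d - a * z t - (b - a * t) * v t = d - z t * a - v t * (b - t * a) by ring]
  exact ⟨h3, h4⟩

theorem eventually_oscFun_le (t : ℝ) {ι : Type*} {l : Filter ι} {W : ι → Submodule ℝ (Vec 4)}
    (hW : Tendsto (fun i => (W i).starProjection) l (𝓝 ((ξ (β t)).sub 3).starProjection))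
    {ε : ℝ} (hε : 0 < ε) : ∀ᶠ i in l, ∀ c d : ℝ, coordVec Φ 0 0 c d ∈ W i →
      |d - w t * c| ≤ ε * |c| := by
  have h1 := eventually_norm_le_of_tendsto_starProjection hW
    ((coordFun Φ 0).prod ((coordFun Φ 1).prod (coordFun Φ 2)))
    ((coordFun Φ 3 - z t • coordFun Φ 0 - v t • (coordFun Φ 1 - t • coordFun Φ 0)) -
      w t • (coordFun Φ 2 - y t • coordFun Φ 0 - u t • (coordFun Φ 1 - t • coordFun Φ 0)))
    (fun p hp h0 => by
      have h2 : Φ p 0 = 0 ∧ Φ p 1 = 0 ∧ Φ p 2 = 0 := by simpa using h0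
      exact hξ.eq_zero_of_mem_two (by decide) (by decide) (by decide) (h.param_ne t) hp
        ((h.adapted.mem_one p).2 h2))
    (fun p hp => by
      have h2 := (h.mem_three_iff hξ t p).1 hp
      simp only [oscFun, jetRem] at h2
      simp only [sub_apply, smul_apply, smul_eq_mul, coordFun_apply]
      linarith) hε
  filter_upwards [h1] with i hi c d hm
  have h2 := hi _ hm
  simpa [Prod.norm_def] using h2

omit hξ in
-- Near the flag at `x`, coordinates that vanish on the limit subspace are negligible against the
-- others. This version drives `zeroSet_nonempty`; the two after it give the growth of `y` and `z`
-- at infinity.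
theorem eventually_zero_le {ι : Type*} {l : Filter ι} {W : ι → Submodule ℝ (Vec 4)}
    (hW : Tendsto (fun i => (W i).starProjection) l (𝓝 ((ξ x).sub 3).starProjection))
    {ε : ℝ} (hε : 0 < ε) : ∀ᶠ i in l, ∀ a b c d : ℝ, coordVec Φ a b c d ∈ W i →
      |a| ≤ ε * max |b| (max |c| |d|) := by
  have h1 := eventually_norm_le_of_tendsto_starProjection hW
    ((coordFun Φ 1).prod ((coordFun Φ 2).prod (coordFun Φ 3))) (coordFun Φ 0)
    (fun p hp h0 => by
      have h2 : Φ p 1 = 0 ∧ Φ p 2 = 0 ∧ Φ p 3 = 0 := by simpa using h0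
      rw [← coordVec_apply Φ p, (h.adapted.mem_three p).1 hp, h2.1, h2.2.1, h2.2.2, coordVec_zero])
    (fun p hp => (h.adapted.mem_three p).1 hp) hε
  filter_upwards [h1] with i hi a b c d hm
  simpa [Prod.norm_def] using hi _ hm

omit hξ in
theorem eventually_one_le {ι : Type*} {l : Filter ι} {W : ι → Submodule ℝ (Vec 4)}
    (hW : Tendsto (fun i => (W i).starProjection) l (𝓝 ((ξ x).sub 2).starProjection))
    {ε : ℝ} (hε : 0 < ε) : ∀ᶠ i in l, ∀ a b c d : ℝ, coordVec Φ a b c d ∈ W i →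
      |b| ≤ ε * max |c| |d| := by
  have h1 := eventually_norm_le_of_tendsto_starProjection hW
    ((coordFun Φ 2).prod (coordFun Φ 3)) (coordFun Φ 1)
    (fun p hp h0 => by
      have h2 : Φ p 2 = 0 ∧ Φ p 3 = 0 := by simpa using h0
      have h3 := (h.adapted.mem_two p).1 hp
      rw [← coordVec_apply Φ p, h3.1, h3.2, h2.1, h2.2, coordVec_zero])
    (fun p hp => ((h.adapted.mem_two p).1 hp).2) hε
  filter_upwards [h1] with i hi a b c d hm
  simpa [Prod.norm_def] using hi _ hm

omit hξ in
theorem eventually_two_le {ι : Type*} {l : Filter ι} {W : ι → Submodule ℝ (Vec 4)}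
    (hW : Tendsto (fun i => (W i).starProjection) l (𝓝 ((ξ x).sub 1).starProjection))
    {ε : ℝ} (hε : 0 < ε) : ∀ᶠ i in l, ∀ a b c d : ℝ, coordVec Φ a b c d ∈ W i →
      max |b| |c| ≤ ε * |d| := by
  have h1 := eventually_norm_le_of_tendsto_starProjection hW
    (coordFun Φ 3) ((coordFun Φ 1).prod (coordFun Φ 2))
    (fun p hp h0 => by
      have h2 : Φ p 3 = 0 := by simpa using h0
      have h3 := (h.adapted.mem_one p).1 hp
      rw [← coordVec_apply Φ p, h3.1, h3.2.1, h3.2.2, h2, coordVec_zero])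
    (fun p hp => by
      have h3 := (h.adapted.mem_one p).1 hp
      simp [h3.2]) hε
  filter_upwards [h1] with i hi a b c d hm
  simpa [Prod.norm_def] using hi _ hm

end RawChart

/-! ### From hyperconvexity to convex charts. -/

section ConvexCharts

open Asymptotics

variable {B : Type*} [TopologicalSpace B]

namespace RawChart

variable {ξ : B → FullFlag 4} {x : B} {Φ : Vec 4 ≃L[ℝ] (Fin 4 → ℝ)} {β : ℝ → B}
  {y z u v w : ℝ → ℝ} (h : RawChart ξ x Φ β y z u v w)
include h

theorem curve_sub_mem (t s : ℝ) :
    coordVec Φ 0 (s - t) (y s - y t) (z s - z t) ∈ (ξ (β t)).sub 1 ⊔ (ξ (β s)).sub 1 := by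
  have e : coordVec Φ 0 (s - t) (y s - y t) (z s - z t) =
      (-1 : ℝ) • coordVec Φ 1 t (y t) (z t) + coordVec Φ 1 s (y s) (z s) := by
    rw [smul_coordVec, coordVec_add]
    congr 1 <;> ring
  rw [e]
  exact Submodule.add_mem_sup (Submodule.smul_mem _ _ (h.curve_mem t)) (h.curve_mem s)

/-- Ties the Taylor remainders to `ξ²(β t) ⊕ ξ¹(β s)`, whose limit is `ξ³(β t)`; hence the quotient
of the remainders tends to `w t`. -/
theorem rem_mem (t s : ℝ) :
    coordVec Φ 0 0 (taylorRem y u t s) (taylorRem z v t s) ∈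
      (ξ (β t)).sub 2 ⊔ (ξ (β s)).sub 1 := by
  have e : coordVec Φ 0 0 (taylorRem y u t s) (taylorRem z v t s) =
      ((-1 : ℝ) • coordVec Φ 1 t (y t) (z t) + (t - s) • coordVec Φ 0 1 (u t) (v t)) +
        coordVec Φ 1 s (y s) (z s) := by
    rw [smul_coordVec, smul_coordVec, coordVec_add, coordVec_add]
    simp only [taylorRem]
    congr 1 <;> ring
  rw [e]
  exact Submodule.add_mem_sup (add_mem (Submodule.smul_mem _ _ (h.curve_mem_two t))
    (Submodule.smul_mem _ _ (h.tangent_mem t))) (h.curve_mem s)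

variable (hξ : IsHyperconvexFrenet ξ)
include hξ

/-- Equality would be a linear relation in a sum that is direct by general position. Here the
dimensions are `1+1+1+1`, with `x` among the points; the four lemmas that follow use `1+2+1` (again
with `x`), `1+1+2`, `1+3` and `2+2`. -/
theorem ne_chord {t s₁ s₂ : ℝ} (h1 : s₁ ≠ t) (h2 : s₂ ≠ t) (h12 : s₁ ≠ s₂) :
    (y s₁ - y t) * (s₂ - t) ≠ (y s₂ - y t) * (s₁ - t) := by
  intro e
  have h0 := hξ.eq_zero_of_add_add_eq_zero (k₁ := 1) (k₂ := 1) (k₃ := 1) (k₄ := 1)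
    (by decide) (by decide) (by decide) (by decide)
    (by decide) (h.injective_param.ne h12) (h.injective_param.ne h1) (h.param_ne s₁)
    (h.injective_param.ne h2) (h.param_ne s₂) (h.param_ne t)
    (Submodule.smul_mem _ (s₂ - t) (h.curve_mem s₁))
    (Submodule.smul_mem _ (t - s₁) (h.curve_mem s₂))
    (Submodule.smul_mem _ (s₁ - s₂) (h.curve_mem t))
    (h.coordVec_last_mem (-((s₂ - t) * z s₁ + (t - s₁) * z s₂ + (s₁ - s₂) * z t))) (by
      simp only [smul_coordVec, coordVec_add]
      rw [← coordVec_zero Φ]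
      congr 1
      · ring
      · ring
      · linear_combination e
      · ring)
  rw [smul_coordVec] at h0
  have := (coordVec_eq_zero Φ h0).1
  exact h2 (by linarith)

theorem rem_y_ne {t s : ℝ} (hs : s ≠ t) : taylorRem y u t s ≠ 0 := by
  intro e
  have h0 := hξ.eq_zero_of_add_eq_zero (k₁ := 1) (k₂ := 2) (k₃ := 1)
    (by decide) (by decide) (by decide) (by decide) (h.injective_param.ne hs) (h.param_ne s)
    (h.param_ne t) (h.curve_mem s)
    (add_mem (Submodule.smul_mem _ (-1) (h.curve_mem_two t))
      (Submodule.smul_mem _ (t - s) (h.tangent_mem t)))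
    (h.coordVec_last_mem (-taylorRem z v t s)) (by
      simp only [smul_coordVec, coordVec_add]
      rw [← coordVec_zero Φ]
      simp only [taylorRem] at e ⊢
      congr 1
      · ring
      · ring
      · linear_combination e
      · ring)
  exact one_ne_zero (coordVec_eq_zero Φ h0).1

theorem ne_rem {t s₁ s₂ : ℝ} (h1 : s₁ ≠ t) (h2 : s₂ ≠ t) (h12 : s₁ ≠ s₂) :
    taylorRem z v t s₁ * taylorRem y u t s₂ ≠ taylorRem z v t s₂ * taylorRem y u t s₁ := by
  intro e
  have hD := h.rem_y_ne hξ h2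
  set D₁ := taylorRem y u t s₁ with hD₁
  set D₂ := taylorRem y u t s₂ with hD₂
  have h0 := hξ.eq_zero_of_add_eq_zero (k₁ := 1) (k₂ := 1) (k₃ := 2)
    (by decide) (by decide) (by decide) (by decide) (h.injective_param.ne h12)
    (h.injective_param.ne h1) (h.injective_param.ne h2)
    (Submodule.smul_mem _ D₂ (h.curve_mem s₁)) (Submodule.smul_mem _ (-D₁) (h.curve_mem s₂))
    (add_mem (Submodule.smul_mem _ (D₁ - D₂) (h.curve_mem_two t))
      (Submodule.smul_mem _ (D₁ * (s₂ - t) - D₂ * (s₁ - t)) (h.tangent_mem t))) (by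
      simp only [smul_coordVec, coordVec_add]
      rw [← coordVec_zero Φ]
      simp only [taylorRem] at e hD₁ hD₂
      congr 1
      · ring
      · ring
      · linear_combination D₁ * hD₂ - D₂ * hD₁
      · linear_combination e)
  rw [smul_coordVec] at h0
  exact hD (by simpa using (coordVec_eq_zero Φ h0).1)

theorem rem_z_ne {t s : ℝ} (hs : s ≠ t) : taylorRem z v t s ≠ w t * taylorRem y u t s := by
  intro e
  have h0 := hξ.eq_zero_of_mem_two (k₁ := 1) (k₂ := 3) (by decide) (by decide) (by decide)
    (h.injective_param.ne hs) (h.curve_mem s) (by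
      have h3 := add_mem (add_mem (h.curve_mem_three t)
        (Submodule.smul_mem _ (s - t) (h.tangent_mem_three t)))
        (Submodule.smul_mem _ (taylorRem y u t s) (h.osculating_mem t))
      convert h3 using 1
      simp only [smul_coordVec, coordVec_add]
      simp only [taylorRem] at e ⊢
      congr 1
      · ring
      · ring
      · ring
      · linear_combination e)
  exact one_ne_zero (coordVec_eq_zero Φ h0).1

theorem ne_tangent {t s : ℝ} (hs : s ≠ t) :
    taylorRem y u t s * (v s - v t) ≠ taylorRem z v t s * (u s - u t) := by
  intro e
  have hD := h.rem_y_ne hξ hs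
  set D := taylorRem y u t s with hD'
  have h0 := hξ.eq_zero_of_mem_two (k₁ := 2) (k₂ := 2) (by decide) (by decide) (by decide)
    (h.injective_param.ne hs)
    (add_mem (Submodule.smul_mem _ D (h.tangent_mem s))
      (Submodule.smul_mem _ (u t - u s) (h.curve_mem_two s))) (by
      have h3 := add_mem (Submodule.smul_mem _ (D - (u s - u t) * (s - t)) (h.tangent_mem t))
        (Submodule.smul_mem _ (u t - u s) (h.curve_mem_two t))
      convert h3 using 1
      simp only [smul_coordVec, coordVec_add]
      simp only [taylorRem] at e hD'
      congr 1
      · ring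
      · ring
      · linear_combination (u s - u t) * hD'
      · linear_combination e)
  rw [smul_coordVec, smul_coordVec, coordVec_add] at h0
  obtain ⟨e1, e2, -⟩ := coordVec_eq_zero Φ h0
  have e3 : u t - u s = 0 := by linarith
  rw [e3] at e2
  exact hD (by linarith)

theorem continuous_uv : Continuous u ∧ Continuous v := by
  have key : ∀ t ε, 0 < ε → ∀ᶠ s in 𝓝 t, |u s - u t| ≤ ε ∧ |v s - v t| ≤ ε := by
    intro t ε hε
    filter_upwards [h.eventually_jetRem_le hξ t
      ((hξ.tendsto_sub 2 (β t)).comp h.continuous_param.continuousAt) hε] with s hs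
    simpa [jetRem] using hs _ _ _ _ (h.tangent_mem s)
  constructor
  · refine continuous_iff_continuousAt.2 fun t => Metric.tendsto_nhds.2 fun ε hε => ?_
    filter_upwards [key t (ε / 2) (half_pos hε)] with s hs
    rw [Real.dist_eq]
    linarith [hs.1]
  · refine continuous_iff_continuousAt.2 fun t => Metric.tendsto_nhds.2 fun ε hε => ?_
    filter_upwards [key t (ε / 2) (half_pos hε)] with s hs
    rw [Real.dist_eq]
    linarith [hs.2]

theorem continuous_w : Continuous w := by
  refine continuous_iff_continuousAt.2 fun t => Metric.tendsto_nhds.2 fun ε hε => ?_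
  filter_upwards [h.eventually_oscFun_le hξ t
    ((hξ.tendsto_sub 3 (β t)).comp h.continuous_param.continuousAt) (half_pos hε)] with s hs
  have := hs _ _ (h.osculating_mem s)
  rw [Real.dist_eq]
  simp only [mul_one, abs_one] at this
  linarith

variable [FirstCountableTopology B]

/-- The chord vector lies in `ξ¹(β t) ⊕ ξ¹(β s)`, which tends to `ξ²(β t)`; differentiability is
this convergence written in coordinates. -/
theorem hasDerivAt_yz (t : ℝ) : HasDerivAt y (u t) t ∧ HasDerivAt z (v t) t := by
  have key : ∀ ε, 0 < ε → ∀ᶠ s in 𝓝 t, |y s - y t - (s - t) * u t| ≤ ε * |s - t| ∧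
      |z s - z t - (s - t) * v t| ≤ ε * |s - t| := by
    intro ε hε
    have h1 := h.eventually_jetRem_le hξ t ((hξ.tendsto_sub_sup_sub (k₁ := 1) (k₂ := 1) (p := 2)
      (by decide) (by decide) (by decide) (β t)).comp (h.tendsto_param_nhdsNE t)) hε
    filter_upwards [eventually_nhdsWithin_iff.1 h1] with s hs
    by_cases hst : s = t
    · subst hst
      simp
    · simpa [jetRem] using hs hst _ _ _ _ (h.curve_sub_mem t s)
  constructor
  · refine hasDerivAt_iff_isLittleO.2 (isLittleO_iff.2 fun ε hε => ?_)
    filter_upwards [key ε hε] with s hs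
    exact hs.1
  · refine hasDerivAt_iff_isLittleO.2 (isLittleO_iff.2 fun ε hε => ?_)
    filter_upwards [key ε hε] with s hs
    exact hs.2

theorem frenetFunctions : FrenetFunctions y z u v w where
  hasDerivAt_y t := (h.hasDerivAt_yz hξ t).1
  hasDerivAt_z t := (h.hasDerivAt_yz hξ t).2
  continuous_u := (h.continuous_uv hξ).1
  continuous_v := (h.continuous_uv hξ).2
  continuous_w := h.continuous_w hξ
  isLittleO_rem t := by
    refine isLittleO_iff.2 fun ε hε => ?_
    have h1 := h.eventually_oscFun_le hξ t ((hξ.tendsto_sub_sup_sub (k₁ := 2) (k₂ := 1) (p := 3)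
      (by decide) (by decide) (by decide) (β t)).comp (h.tendsto_param_nhdsNE t)) hε
    filter_upwards [eventually_nhdsWithin_iff.1 h1] with s hs
    by_cases hst : s = t
    · subst hst
      simp [taylorRem_self]
    · exact hs hst _ _ (h.rem_mem t s)
  isLittleO_id_y := by
    refine isLittleO_iff.2 fun ε hε => ?_
    filter_upwards [h.eventually_one_le ((hξ.tendsto_sub_sup_sub (k₁ := 1) (k₂ := 1) (p := 2)
      (by decide) (by decide) (by decide) x).comp h.tendsto_param) hε] with s hs
    -- Adding an element of `ξ¹(x)` removes the coordinate `z s`, so that only `y s` appears in the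
    -- bound on `s`.
    have e : coordVec Φ 1 s (y s) 0 = coordVec Φ 0 0 0 (-z s) + coordVec Φ 1 s (y s) (z s) := by
      rw [coordVec_add]
      congr 1 <;> ring
    have h1 := hs 1 s (y s) 0 (by
      rw [e]
      exact Submodule.add_mem_sup (h.coordVec_last_mem _) (h.curve_mem s))
    simpa using h1
  isLittleO_id_z := by
    refine isLittleO_iff.2 fun ε hε => ?_
    filter_upwards [h.eventually_two_le (((hξ.tendsto_sub 1 x).mono_left nhdsWithin_le_nhds).comp
      h.tendsto_param) hε] with s hs
    exact (le_max_left _ _).trans (hs _ _ _ _ (h.curve_mem s))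
  isLittleO_y_z := by
    refine isLittleO_iff.2 fun ε hε => ?_
    filter_upwards [h.eventually_two_le (((hξ.tendsto_sub 1 x).mono_left nhdsWithin_le_nhds).comp
      h.tendsto_param) hε] with s hs
    exact (le_max_right _ _).trans (hs _ _ _ _ (h.curve_mem s))
  ne_chord _ _ _ h1 h2 h12 := h.ne_chord hξ h1 h2 h12
  rem_y_ne _ _ hs := h.rem_y_ne hξ hs
  ne_rem _ _ _ h1 h2 h12 := h.ne_rem hξ h1 h2 h12
  rem_z_ne _ _ hs := h.rem_z_ne hξ hs
  ne_tangent _ _ hs := h.ne_tangent hξ hs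

end RawChart

/-- A chart with coordinates of suitable signs, compatible with the orientation of the circle. -/
structure Chart (θ : B ≃ₜ UnitAddCircle) (ξ : B → FullFlag 4) (x : B)
    (Φ : Vec 4 ≃L[ℝ] (Fin 4 → ℝ)) (β : ℝ → B) (y z u v w : ℝ → ℝ) : Prop
    extends RawChart ξ x Φ β y z u v w, ConvexFunctions y z u v w where
  isOpenEmbedding : IsOpenEmbedding β
  range_eq : range β = {x}ᶜ
  lt_iff : ∀ s t, s < t ↔ sbtw (θ x) (θ (β s)) (θ (β t))

section Existence

variable {ξ : B → FullFlag 4} (hξ : IsHyperconvexFrenet ξ) {x : B}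
  {Φ : Vec 4 ≃L[ℝ] (Fin 4 → ℝ)}
include hξ

/-- Gaussian elimination along the flag at `b`. The pivots are nonzero because `ξᵏ(b)` is
transversal to `ξ⁴⁻ᵏ(x)`. -/
theorem exists_frame (hΦ : AdaptedCoords (ξ x) Φ) {b : B} (hb : b ≠ x) : ∃ t y z u v w : ℝ,
    coordVec Φ 1 t y z ∈ (ξ b).sub 1 ∧ coordVec Φ 0 1 u v ∈ (ξ b).sub 2 ∧
      coordVec Φ 0 0 1 w ∈ (ξ b).sub 3 := by
  have m12 : (ξ b).sub 1 ≤ (ξ b).sub 2 := (ξ b).mono (by decide)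
  have m23 : (ξ b).sub 2 ≤ (ξ b).sub 3 := (ξ b).mono (by decide)
  have hzero : ∀ e, e ∈ (ξ b).sub 0 ↔ e = 0 := by
    intro e
    have h0 : Module.finrank ℝ ((ξ b).sub 0) = 0 := (ξ b).finrank_sub 0
    rw [Submodule.finrank_eq_zero] at h0
    rw [h0, Submodule.mem_bot]
  obtain ⟨e0, h0, h0'⟩ := (ξ b).exists_mem_notMem (i := 0) (j := 1) (by decide)
  have n0 : Φ e0 0 ≠ 0 := fun h => h0' ((hzero _).2
    (hξ.eq_zero_of_mem_two (by decide) (by decide) (by decide) hb h0 ((hΦ.mem_three _).2 h)))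
  have c0 := h0
  rw [← coordVec_apply Φ e0] at c0
  have f0 := Submodule.smul_mem _ (Φ e0 0)⁻¹ c0
  rw [smul_coordVec, inv_mul_cancel₀ n0] at f0
  set t := (Φ e0 0)⁻¹ * Φ e0 1
  set y := (Φ e0 0)⁻¹ * Φ e0 2
  set z := (Φ e0 0)⁻¹ * Φ e0 3
  obtain ⟨e1, h1, h1'⟩ := (ξ b).exists_mem_notMem (i := 1) (j := 2) (by decide)
  have g1 := add_mem h1 (Submodule.smul_mem _ (-Φ e1 0) (m12 f0))
  have d1 : e1 + -Φ e1 0 • coordVec Φ 1 t y z ≠ 0 := fun h => h1' (by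
    have h2 : e1 = Φ e1 0 • coordVec Φ 1 t y z := by
      rw [neg_smul] at h
      exact add_neg_eq_zero.1 h
    rw [h2]
    exact Submodule.smul_mem _ _ f0)
  have e1' : e1 + -Φ e1 0 • coordVec Φ 1 t y z =
      coordVec Φ 0 (Φ e1 1 - Φ e1 0 * t) (Φ e1 2 - Φ e1 0 * y) (Φ e1 3 - Φ e1 0 * z) := by
    conv_lhs => rw [← coordVec_apply Φ e1]
    rw [smul_coordVec, coordVec_add]
    simp only [apply_coordVec]
    congr 1 <;> simp <;> ring
  rw [e1'] at g1 d1
  set a1 := Φ e1 1 - Φ e1 0 * t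
  have n1 : a1 ≠ 0 := fun h => d1 (hξ.eq_zero_of_mem_two (by decide) (by decide) (by decide) hb g1
    ((hΦ.mem_two _).2 (by simp [h])))
  have f1 := Submodule.smul_mem _ a1⁻¹ g1
  rw [smul_coordVec, inv_mul_cancel₀ n1, mul_zero] at f1
  set u := a1⁻¹ * (Φ e1 2 - Φ e1 0 * y)
  set v := a1⁻¹ * (Φ e1 3 - Φ e1 0 * z)
  obtain ⟨e2, h2, h2'⟩ := (ξ b).exists_mem_notMem (i := 2) (j := 3) (by decide)
  have r2 := add_mem (Submodule.smul_mem _ (Φ e2 0) (m12 f0))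
    (Submodule.smul_mem _ (Φ e2 1 - Φ e2 0 * t) f1)
  have g2 := sub_mem h2 (m23 r2)
  have d2 : e2 - (Φ e2 0 • coordVec Φ 1 t y z + (Φ e2 1 - Φ e2 0 * t) • coordVec Φ 0 1 u v) ≠ 0 :=
    fun h => h2' (by rw [sub_eq_zero.1 h]; exact r2)
  have e2' : e2 - (Φ e2 0 • coordVec Φ 1 t y z + (Φ e2 1 - Φ e2 0 * t) • coordVec Φ 0 1 u v) =
      coordVec Φ 0 0 (Φ e2 2 - Φ e2 0 * y - (Φ e2 1 - Φ e2 0 * t) * u)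
        (Φ e2 3 - Φ e2 0 * z - (Φ e2 1 - Φ e2 0 * t) * v) := by
    rw [sub_eq_iff_eq_add]
    conv_lhs => rw [← coordVec_apply Φ e2]
    simp only [smul_coordVec, coordVec_add]
    congr 1 <;> ring
  rw [e2'] at g2 d2
  set a2 := Φ e2 2 - Φ e2 0 * y - (Φ e2 1 - Φ e2 0 * t) * u
  have n2 : a2 ≠ 0 := fun h => d2 (hξ.eq_zero_of_mem_two (by decide) (by decide) (by decide) hb g2
    ((hΦ.mem_one _).2 (by simp [h])))
  have f2 := Submodule.smul_mem _ a2⁻¹ g2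
  rw [smul_coordVec, inv_mul_cancel₀ n2, mul_zero] at f2
  exact ⟨t, y, z, u, v, _, f0, f1, f2⟩

/-- The first affine coordinate is continuous. -/
theorem continuousAt_affineCoord (hΦ : AdaptedCoords (ξ x) Φ) {T Y Z : B → ℝ}
    (hT : ∀ b, b ≠ x → coordVec Φ 1 (T b) (Y b) (Z b) ∈ (ξ b).sub 1) [T1Space B] {b : B}
    (hb : b ≠ x) : ContinuousAt T b := by
  refine Metric.tendsto_nhds.2 fun ε hε => ?_
  have h1 := eventually_norm_le_of_tendsto_starProjection (hξ.tendsto_sub 1 b)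
    (coordFun Φ 0) (coordFun Φ 1 - T b • coordFun Φ 0)
    (fun p hp h0 => hξ.eq_zero_of_mem_two (by decide) (by decide) (by decide) hb hp
      ((hΦ.mem_three p).2 h0))
    (fun p hp => by
      have e : Φ p - Φ p 0 • Φ (coordVec Φ 1 (T b) (Y b) (Z b)) = 0 := by
        rw [← map_smul, ← map_sub]
        rw [hξ.eq_zero_of_mem_two (k₁ := 1) (k₂ := 3) (by decide) (by decide) (by decide) hb
          (sub_mem hp (Submodule.smul_mem _ (Φ p 0) (hT b hb))) ((hΦ.mem_three _).2 (by simp)),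
          map_zero]
      have e1 := congrFun e 1
      simp at e1
      simp only [sub_apply, smul_apply, smul_eq_mul, coordFun_apply]
      linarith) (half_pos hε)
  filter_upwards [h1, isOpen_ne.mem_nhds hb] with b' hb' hne
  have h2 := hb' _ (hT b' hne)
  simp at h2
  rw [Real.dist_eq]
  linarith

/-- Modulo `ξ²(x)` the point of the curve becomes `(1, T, 0, 0)`. It lies in `ξ²(x) ⊕ ξ¹(b)`, which
tends to `ξ³(x)`, where the coordinate `0` vanishes; so `1` is negligible against `T`. -/
theorem tendsto_abs_affineCoord [FirstCountableTopology B] (hΦ : AdaptedCoords (ξ x) Φ)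
    {T Y Z : B → ℝ}
    (hT : ∀ b, b ≠ x → coordVec Φ 1 (T b) (Y b) (Z b) ∈ (ξ b).sub 1) :
    Tendsto (fun b => |T b|) (𝓝[≠] x) atTop := by
  refine tendsto_atTop.2 fun M => ?_
  have h1 := eventually_norm_le_of_tendsto_starProjection
    (hξ.tendsto_sub_sup_sub (k₁ := 2) (k₂ := 1) (p := 3) (by decide) (by decide) (by decide) x)
    ((coordFun Φ 1).prod ((coordFun Φ 2).prod (coordFun Φ 3))) (coordFun Φ 0)
    (fun p hp h0 => by
      have h2 : Φ p 1 = 0 ∧ Φ p 2 = 0 ∧ Φ p 3 = 0 := by simpa using h0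
      rw [← coordVec_apply Φ p, (hΦ.mem_three p).1 hp, h2.1, h2.2.1, h2.2.2, coordVec_zero])
    (fun p hp => (hΦ.mem_three p).1 hp) (ε := 1 / (|M| + 1)) (by positivity)
  filter_upwards [h1, self_mem_nhdsWithin] with b hb hne
  have e : coordVec Φ 1 (T b) 0 0 = coordVec Φ 0 0 (-Y b) (-Z b) +
      coordVec Φ 1 (T b) (Y b) (Z b) := by
    rw [coordVec_add]
    congr 1 <;> ring
  have h2 := hb (coordVec Φ 1 (T b) 0 0) (by
    rw [e]
    exact Submodule.add_mem_sup ((hΦ.mem_two _).2 (by simp)) (hT b hne))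
  simp [Prod.norm_def] at h2
  rw [← div_eq_inv_mul, le_div_iff₀ (by positivity)] at h2
  linarith [le_abs_self M]

theorem affineCoord_injOn (hΦ : AdaptedCoords (ξ x) Φ) {T Y Z : B → ℝ}
    (hT : ∀ b, b ≠ x → coordVec Φ 1 (T b) (Y b) (Z b) ∈ (ξ b).sub 1) : InjOn T {x}ᶜ := by
  intro b hb b' hb' e
  by_contra hne
  have h0 := hξ.eq_zero_of_add_eq_zero (k₁ := 1) (k₂ := 1) (k₃ := 2) (by decide) (by decide)
    (by decide) (by decide) hne hb hb' (hT b hb) (Submodule.smul_mem _ (-1) (hT b' hb'))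
    ((hΦ.mem_two (coordVec Φ 0 0 (Y b' - Y b) (Z b' - Z b))).2 (by simp)) (by
      simp only [smul_coordVec, coordVec_add]
      rw [← coordVec_zero Φ, e]
      congr 1 <;> ring)
  exact one_ne_zero (coordVec_eq_zero Φ h0).1

end Existence

theorem tendsto_arcPt_sigmoid (θ : B ≃ₜ UnitAddCircle) (x : B) :
    Tendsto (fun s => arcPt θ x (Real.sigmoid s)) (cocompact ℝ) (𝓝[≠] x) := by
  refine tendsto_nhdsWithin_of_tendsto_nhds_of_eventually_within _ ?_
    (.of_forall fun s => (arcPt_ne θ x ⟨Real.sigmoid_pos s, Real.sigmoid_lt_one s⟩).symm)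
  have hc : Continuous fun τ => arcPt θ x τ :=
    (continuous_arcPt θ).comp (continuous_const.prodMk continuous_id)
  rw [cocompact_eq_atBot_atTop]
  refine tendsto_sup.2 ⟨?_, ?_⟩
  · have := (hc.tendsto 0).comp Real.tendsto_sigmoid_atBot
    simpa [arcPt, Function.comp_def] using this
  · have := (hc.tendsto 1).comp Real.tendsto_sigmoid_atTop
    have h1 : ((1 : ℝ) : UnitAddCircle) = 0 := AddCircle.coe_period 1
    simpa [arcPt, Function.comp_def, h1] using this

theorem StrictMono.surjective_of_tendsto_abs {G : ℝ → ℝ} (hG : StrictMono G) (hc : Continuous G)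
    (habs : Tendsto (fun s => |G s|) (cocompact ℝ) atTop) : Function.Surjective G := by
  refine hc.surjective ?_ ?_
  · refine tendsto_atTop.2 fun M => ?_
    filter_upwards [(tendsto_atTop.1 (habs.mono_left atTop_le_cocompact) (|M| + |G 0| + 1)),
      eventually_ge_atTop 0] with s h1 h2
    have h3 := hG.monotone h2
    rcases abs_cases (G s) with ⟨e, -⟩ | ⟨e, -⟩
    · linarith [le_abs_self M, abs_nonneg (G 0)]
    · linarith [neg_abs_le (G 0), abs_nonneg M]
  · refine tendsto_atBot.2 fun M => ?_
    filter_upwards [(tendsto_atTop.1 (habs.mono_left atBot_le_cocompact) (|M| + |G 0| + 1)),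
      eventually_le_atBot 0] with s h1 h2
    have h3 := hG.monotone h2
    rcases abs_cases (G s) with ⟨e, -⟩ | ⟨e, -⟩
    · linarith [le_abs_self (G 0), abs_nonneg M]
    · linarith [neg_abs_le M, abs_nonneg (G 0)]

section Existence

variable (θ : B ≃ₜ UnitAddCircle) {ξ : B → FullFlag 4} (hξ : IsHyperconvexFrenet ξ) (x : B)
include hξ

/-- The affine coordinate `T` is continuous and injective off `x` and unbounded near `x`, so it maps
the arc homeomorphically onto `ℝ`; `β` is its inverse. -/
theorem exists_rawChart : ∃ Φ β y z u v w, RawChart ξ x Φ β y z u v w ∧ IsOpenEmbedding β ∧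
    range β = {x}ᶜ ∧ ∀ s t, s < t ↔ sbtw (θ x) (θ (β s)) (θ (β t)) := by
  have : T2Space B := θ.isEmbedding.t2Space
  have : SecondCountableTopology B := θ.secondCountableTopology
  -- The case where `T` increases along the oriented arc, so that `β` respects the orientation. The
  -- decreasing case reduces to it by changing the sign of coordinate `1`.
  have key : ∀ (Φ : Vec 4 ≃L[ℝ] (Fin 4 → ℝ)) (T Y Z U V W : B → ℝ), AdaptedCoords (ξ x) Φ →
      (∀ b, b ≠ x → coordVec Φ 1 (T b) (Y b) (Z b) ∈ (ξ b).sub 1) →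
      (∀ b, b ≠ x → coordVec Φ 0 1 (U b) (V b) ∈ (ξ b).sub 2) →
      (∀ b, b ≠ x → coordVec Φ 0 0 1 (W b) ∈ (ξ b).sub 3) →
      StrictMono (fun s => T (arcPt θ x (Real.sigmoid s))) →
      ∃ Φ β y z u v w, RawChart ξ x Φ β y z u v w ∧ IsOpenEmbedding β ∧
        range β = {x}ᶜ ∧ ∀ s t, s < t ↔ sbtw (θ x) (θ (β s)) (θ (β t)) := by
    intro Φ T Y Z U V W hΦ hT hU hW hmono
    have hIoo : ∀ s, Real.sigmoid s ∈ Ioo (0 : ℝ) 1 :=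
      fun s => ⟨Real.sigmoid_pos s, Real.sigmoid_lt_one s⟩
    have hne : ∀ s, arcPt θ x (Real.sigmoid s) ≠ x := fun s => (arcPt_ne θ x (hIoo s)).symm
    have hγc : Continuous fun s => arcPt θ x (Real.sigmoid s) :=
      (continuous_arcPt θ).comp (continuous_const.prodMk continuous_sigmoid)
    have hGc : Continuous fun s => T (arcPt θ x (Real.sigmoid s)) :=
      continuous_iff_continuousAt.2 fun s =>
        ContinuousAt.comp (continuousAt_affineCoord hξ hΦ hT (hne s)) hγc.continuousAt
    have hsurj := StrictMono.surjective_of_tendsto_abs hmono hGc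
      ((tendsto_abs_affineCoord hξ hΦ hT).comp (tendsto_arcPt_sigmoid θ x))
    let G : ℝ ≃ₜ ℝ := (hmono.orderIsoOfSurjective _ hsurj).toHomeomorph
    have hGapp : ∀ s, G s = T (arcPt θ x (Real.sigmoid s)) := fun s => rfl
    let β : ℝ → B := fun t => arcPt θ x (Real.sigmoid (G.symm t))
    have hTβ : ∀ t, T (β t) = t := fun t => by
      have := G.apply_symm_apply t
      rwa [hGapp] at this
    have hβc : Continuous β := hγc.comp G.symm.continuous
    have hβinj : Function.Injective β := fun s t hst => by rw [← hTβ s, hst, hTβ]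
    have hβne : ∀ t, β t ≠ x := fun t => hne _
    have hrange : range β = {x}ᶜ := by
      refine subset_antisymm (range_subset_iff.2 hβne) fun b hb => ?_
      have h1 : gap θ x b ∈ range Real.sigmoid := by
        rw [Real.range_sigmoid]
        exact ⟨gap_pos θ (Ne.symm hb), gap_lt_one _ _ _⟩
      obtain ⟨s, hs⟩ := h1
      exact ⟨G s, by simp [β, hs, arcPt_gap]⟩
    refine ⟨Φ, β, Y ∘ β, Z ∘ β, U ∘ β, V ∘ β, W ∘ β, ⟨hΦ, hβc, hβinj, hβne, ?_, ?_, ?_, ?_⟩,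
      ?_, hrange, ?_⟩
    · exact (tendsto_arcPt_sigmoid θ x).comp G.symm.isClosedEmbedding.tendsto_cocompact
    · intro t
      have := hT _ (hβne t)
      rwa [hTβ] at this
    · exact fun t => hU _ (hβne t)
    · exact fun t => hW _ (hβne t)
    · refine .of_continuous_injective_isOpenMap hβc hβinj fun O hO => ?_
      have hcont : ContinuousOn T {x}ᶜ := fun b hb =>
        (continuousAt_affineCoord hξ hΦ hT hb).continuousWithinAt
      have e : β '' O = {x}ᶜ ∩ T ⁻¹' O := by
        ext b
        constructor
        · rintro ⟨t, ht, rfl⟩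
          exact ⟨hβne t, by rwa [mem_preimage, hTβ]⟩
        · rintro ⟨hb, hbO⟩
          rw [← hrange] at hb
          obtain ⟨t, rfl⟩ := hb
          rw [mem_preimage, hTβ] at hbO
          exact ⟨t, hbO, rfl⟩
      rw [e]
      exact hcont.isOpen_inter_preimage isOpen_compl_singleton hO
    · intro s t
      rw [sbtw_iff_gap, gap_arcPt θ x (Ioo_subset_Ico_self (hIoo _)),
        gap_arcPt θ x (Ioo_subset_Ico_self (hIoo _)), Real.sigmoid_lt_iff]
      have hG : G.symm s < G.symm t ↔ s < t :=
        (hmono.orderIsoOfSurjective _ hsurj).symm.lt_iff_lt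
      rw [hG]
      exact ⟨fun hst => ⟨Real.sigmoid_pos _, hst⟩, fun hst => hst.2⟩
  obtain ⟨Φ, hΦ⟩ := exists_adaptedCoords (ξ x)
  choose! T Y Z U V W hT hU hW using fun b (hb : b ≠ x) => exists_frame hξ hΦ hb
  have hne : ∀ s, arcPt θ x (Real.sigmoid s) ≠ x := fun s =>
    (arcPt_ne θ x ⟨Real.sigmoid_pos s, Real.sigmoid_lt_one s⟩).symm
  have hγc : Continuous fun s => arcPt θ x (Real.sigmoid s) :=
    (continuous_arcPt θ).comp (continuous_const.prodMk continuous_sigmoid)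
  have hGc : Continuous fun s => T (arcPt θ x (Real.sigmoid s)) :=
    continuous_iff_continuousAt.2 fun s =>
      ContinuousAt.comp (continuousAt_affineCoord hξ hΦ hT (hne s)) hγc.continuousAt
  have hinj : Function.Injective fun s => T (arcPt θ x (Real.sigmoid s)) := fun s s' hs => by
    have h1 := affineCoord_injOn hξ hΦ hT (hne s) (hne s') hs
    have h2 := congrArg (gap θ x) h1
    rw [gap_arcPt θ x ⟨Real.sigmoid_nonneg s, Real.sigmoid_lt_one s⟩,
      gap_arcPt θ x ⟨Real.sigmoid_nonneg s', Real.sigmoid_lt_one s'⟩] at h2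
    exact Real.sigmoid_injective h2
  rcases hGc.strictMono_of_inj hinj with hm | hm
  · exact key Φ T Y Z U V W hΦ hT hU hW hm
  · refine key (flipCoord Φ 1) (fun b => -T b) Y Z (fun b => -U b) (fun b => -V b) W (hΦ.flip 1)
      ?_ ?_ ?_ fun s t hst => neg_lt_neg (hm hst)
    · intro b hb
      rw [coordVec_flip_one, neg_neg]
      exact hT b hb
    · intro b hb
      have := neg_mem (hU b hb)
      rw [← neg_one_smul ℝ, smul_coordVec] at this
      rw [coordVec_flip_one]
      simpa using this
    · intro b hb
      rw [coordVec_flip_one, neg_zero]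
      exact hW b hb

theorem exists_chart : ∃ Φ β y z u v w, Chart θ ξ x Φ β y z u v w := by
  have : T2Space B := θ.isEmbedding.t2Space
  have : SecondCountableTopology B := θ.secondCountableTopology
  obtain ⟨Φ, β, y, z, u, v, w, h, ho, hr, hlt⟩ := exists_rawChart θ hξ x
  -- A sign change of coordinate `2` makes `y` convex. A later sign change of coordinate `3` makes
  -- the quotient of remainders increasing and does not affect `y`.
  have h1 : ∃ Φ y u w, RawChart ξ x Φ β y z u v w ∧ ∀ t s, s ≠ t → 0 < taylorRem y u t s := by
    rcases (h.frenetFunctions hξ).rem_y_pos_or_neg with hp | hn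
    · exact ⟨Φ, y, u, w, h, hp⟩
    · refine ⟨_, _, _, _, h.neg_y, fun t s hs => ?_⟩
      rw [taylorRem_neg]
      exact neg_pos.2 (hn t s hs)
  obtain ⟨Φ, y, u, w, h, hpos⟩ := h1
  rcases (h.frenetFunctions hξ).ratio_strictMono_or_strictAnti with hm | hm
  · exact ⟨Φ, β, y, z, u, v, w, ⟨h, (h.frenetFunctions hξ).convexFunctions hpos hm, ho, hr, hlt⟩⟩
  · refine ⟨_, β, y, _, u, _, _, ⟨h.neg_z, (h.neg_z.frenetFunctions hξ).convexFunctions hpos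
      fun t => ?_, ho, hr, hlt⟩⟩
    have e : quotientAt (taylorRem (fun t => -z t) (fun t => -v t) t) (taylorRem y u t) (-w t) t =
        fun s => -quotientAt (taylorRem z v t) (taylorRem y u t) (w t) t s := by
      ext s
      by_cases hs : s = t
      · subst hs
        rw [quotientAt_self, quotientAt_self]
      · rw [quotientAt_of_ne hs, quotientAt_of_ne hs, taylorRem_neg, neg_div]
    rw [e]
    exact fun a b hab => neg_lt_neg (hm t hab)

end Existence

end ConvexCharts

/-! ### Tangent lines of the convex graph and osculating planes through a point. -/

section OsculatingPlanes

/-- The points whose osculating planes contain `p`. -/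
def zeroSet {B : Type*} (ξ : B → FullFlag 4) (p : Vec 4) : Set B := {b | p ∈ (ξ b).sub 3}

namespace ConvexFunctions

variable {y z u v w : ℝ → ℝ} (h : ConvexFunctions y z u v w)
include h

theorem surjective_u : Function.Surjective u :=
  h.continuous_u.surjective h.tendsto_u_top h.tendsto_u_bot

/-- The height of a point `(u c, k)` above the tangent lines of the graph `(u, v)` increases away
from `c`, to the right. -/
theorem lt_height_right {c k s t : ℝ} (hc : c ≤ t) (hts : t < s) :
    k - v t - w t * (u c - u t) < k - v s - w s * (u c - u s) := by
  have h1 := h.sub_v_lt t s hts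
  have h2 : 0 ≤ (w s - w t) * (u t - u c) := mul_nonneg
    (sub_nonneg.2 (h.strictMono_w hts).le) (sub_nonneg.2 (h.strictMono_u.monotone hc))
  linarith

/-- The product on the left is kept: for `s ≤ c` it is nonnegative, and it is what drives the height
to `+∞` as `w t` tends to `-∞`. -/
theorem lt_height_left {c k s t : ℝ} (hts : t < s) :
    k - v s - w s * (u c - u s) + (w s - w t) * (u c - u s) <
      k - v t - w t * (u c - u t) := by
  have h1 := h.lt_sub_v t s hts
  linarith

theorem height_pos {c k : ℝ} (hk : v c < k) (t : ℝ) : 0 < k - v t - w t * (u c - u t) := by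
  rcases lt_trichotomy t c with ht | rfl | ht
  · have h1 := h.lt_height_left (c := c) (k := k) ht
    simp only [sub_self, mul_zero, sub_zero, add_zero] at h1
    linarith
  · simpa using hk
  · have h1 := h.lt_height_right (k := k) le_rfl ht
    simp only [sub_self, mul_zero, sub_zero] at h1
    linarith

/-- The points below the graph lie on exactly two tangent lines. -/
theorem exists_two_tangents {c k : ℝ} (hk : k < v c) : ∃ a b, a < c ∧ c < b ∧
    ∀ t, k - v t - w t * (u c - u t) = 0 ↔ t = a ∨ t = b := by
  set f : ℝ → ℝ := fun t => k - v t - w t * (u c - u t) with hf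
  have hfc : Continuous f := by
    have h1 := h.continuous_u
    have h2 := h.continuous_v
    have h3 := h.continuous_w
    fun_prop
  have hc : f c < 0 := by
    simp only [hf, sub_self, mul_zero, sub_zero]
    linarith
  have anti : ∀ t s, t < s → s ≤ c → f s < f t := fun t s hts hsc => by
    have h1 := h.lt_height_left (c := c) (k := k) hts
    have h2 : 0 ≤ (w s - w t) * (u c - u s) := mul_nonneg
      (sub_nonneg.2 (h.strictMono_w hts).le) (sub_nonneg.2 (h.strictMono_u.monotone hsc))
    simp only [hf]
    linarith
  have mono : ∀ t s, t < s → c ≤ t → f t < f s := fun t s hts hsc =>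
    h.lt_height_right hsc hts
  obtain ⟨l, hl, hl'⟩ : ∃ l < c, 0 < f l := by
    have hu : 0 < u c - u (c - 1) := sub_pos.2 (h.strictMono_u (by linarith))
    -- The threshold makes `(w (c - 1) - w t) * (u c - u (c - 1))` at least `|f (c - 1)| + 1`, so
    -- that `f t` is positive. The right-hand side is treated alike.
    obtain ⟨t, ht1, ht2⟩ := ((tendsto_atBot.1 h.tendsto_w_bot
      (w (c - 1) - (|f (c - 1)| + 1) / (u c - u (c - 1)))).and (eventually_lt_atBot (c - 1))).exists
    refine ⟨t, by linarith, ?_⟩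
    have h1 := h.lt_height_left (c := c) (k := k) ht2
    have h2 : |f (c - 1)| + 1 ≤ (w (c - 1) - w t) * (u c - u (c - 1)) := by
      rw [← div_le_iff₀ hu]
      linarith
    change f (c - 1) + _ < f t at h1
    linarith [neg_abs_le (f (c - 1))]
  obtain ⟨r, hr, hr'⟩ : ∃ r > c, 0 < f r := by
    have hu : 0 < u (c + 1) - u c := sub_pos.2 (h.strictMono_u (by linarith))
    obtain ⟨t, ht1, ht2⟩ := ((tendsto_atTop.1 h.tendsto_w_top
      (w (c + 1) + (|f (c + 1)| + 1) / (u (c + 1) - u c))).and (eventually_gt_atTop (c + 1))).exists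
    refine ⟨t, by linarith, ?_⟩
    have h1 := h.sub_v_lt (c + 1) t ht2
    have h2 : |f (c + 1)| + 1 ≤ (w t - w (c + 1)) * (u (c + 1) - u c) := by
      rw [← div_le_iff₀ hu]
      linarith
    have h3 : f t - f (c + 1) = -(v t - v (c + 1)) + w t * (u t - u (c + 1)) +
        (w t - w (c + 1)) * (u (c + 1) - u c) := by
      simp only [hf]; ring
    linarith [neg_abs_le (f (c + 1))]
  obtain ⟨a, ⟨ha1, ha2⟩, ha0⟩ := intermediate_value_Ioo' hl.le hfc.continuousOn ⟨hc, hl'⟩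
  obtain ⟨b, ⟨hb1, hb2⟩, hb0⟩ := intermediate_value_Ioo hr.le hfc.continuousOn ⟨hc, hr'⟩
  refine ⟨a, b, ha2, hb1, fun t => ⟨fun ht => ?_, ?_⟩⟩
  · change f t = 0 at ht
    rcases le_total t c with htc | htc
    · left
      rcases lt_trichotomy t a with hta | hta | hta
      · linarith [anti t a hta ha2.le]
      · exact hta
      · linarith [anti a t hta htc]
    · right
      rcases lt_trichotomy t b with hta | hta | hta
      · linarith [mono t b hta htc]
      · exact hta
      · linarith [mono b t hta hb1.le]
  · rintro (rfl | rfl)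
    · exact ha0
    · exact hb0

/-- The points above the graph at `c` lie on a line with the slope of the tangent line at `c` and
through a point of the graph to the left. -/
theorem exists_secant {c k : ℝ} (hk : v c < k) : ∃ a < c, k = v a + w c * (u c - u a) := by
  set f : ℝ → ℝ := fun t => v t + w c * (u c - u t) with hf
  have hfc : Continuous f := by
    have h1 := h.continuous_u
    have h2 := h.continuous_v
    fun_prop
  have hw : 0 < w c - w (c - 1) := sub_pos.2 (h.strictMono_w (by linarith))
  -- As for tangents, with the unboundedness of `u` replacing that of `w`: the threshold pushes `f
  -- t` above `k`.
  obtain ⟨t, ht1, ht2⟩ := ((tendsto_atBot.1 h.tendsto_u_bot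
    (u (c - 1) - (|k - f (c - 1)| + 1) / (w c - w (c - 1)))).and
      (eventually_lt_atBot (c - 1))).exists
  have h1 := h.sub_v_lt t (c - 1) ht2
  have h2 : |k - f (c - 1)| + 1 ≤ (u (c - 1) - u t) * (w c - w (c - 1)) := by
    rw [← div_le_iff₀ hw]
    linarith
  have h3 : f t - f (c - 1) = -(v (c - 1) - v t) + w (c - 1) * (u (c - 1) - u t) +
      (u (c - 1) - u t) * (w c - w (c - 1)) := by
    simp only [hf]; ring
  have h4 : k < f t := by linarith [le_abs_self (k - f (c - 1))]
  have h5 : f c < k := by simpa [hf] using hk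
  obtain ⟨a, ⟨-, ha⟩, ha0⟩ := intermediate_value_Ioo' (show t ≤ c by linarith) hfc.continuousOn
    ⟨h5, h4⟩
  exact ⟨a, ha, ha0.symm⟩

omit h in
theorem oscFun_sub (y z u v w : ℝ → ℝ) (s t : ℝ) (q : Fin 4 → ℝ) :
    oscFun y z u v w s q - oscFun y z u v w t q =
      q 0 * (taylorRem z v s t - w s * taylorRem y u s t) +
      (q 1 - q 0 * t) * (v t - v s - w s * (u t - u s)) -
      jetRem y u t (q 0) (q 1) (q 2) * (w s - w t) := by
  simp only [oscFun, jetRem, taylorRem]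
  ring

/-- Near the diagonal the increment of `oscFun` is `-jetRem * (w s - w t)` up to a small multiple of
`w s - w t`. Strict monotonicity of `w` thus replaces its derivative, which need not exist. -/
theorem abs_oscFun_sub_le {s t : ℝ} (hts : t < s) (q : Fin 4 → ℝ) :
    |oscFun y z u v w s q - oscFun y z u v w t q +
      jetRem y u t (q 0) (q 1) (q 2) * (w s - w t)| ≤
      (w s - w t) * (|q 0| * taylorRem y u s t + |q 1 - q 0 * t| * |u s - u t|) := by
  rw [oscFun_sub, sub_add_cancel]
  have hw := sub_pos.2 (h.strictMono_w hts)
  have hu := sub_pos.2 (h.strictMono_u hts)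
  have h1 : |taylorRem z v s t - w s * taylorRem y u s t| ≤ (w s - w t) * taylorRem y u s t := by
    have e1 := h.lt_rem_left t s hts
    have e2 := h.rem_left_lt t s hts
    rw [abs_le]
    constructor <;> nlinarith
  have h2 : |v t - v s - w s * (u t - u s)| ≤ (w s - w t) * |u s - u t| := by
    have e1 := h.lt_sub_v t s hts
    have e2 := h.sub_v_lt t s hts
    rw [abs_of_pos hu, abs_le]
    constructor <;> nlinarith
  calc _ ≤ |q 0| * |taylorRem z v s t - w s * taylorRem y u s t| +
        |q 1 - q 0 * t| * |v t - v s - w s * (u t - u s)| := by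
        rw [← abs_mul, ← abs_mul]
        exact abs_add_le _ _
    _ ≤ |q 0| * ((w s - w t) * taylorRem y u s t) +
        |q 1 - q 0 * t| * ((w s - w t) * |u s - u t|) := by gcongr
    _ = _ := by ring

theorem continuous_oscFun : Continuous fun r : ℝ × (Fin 4 → ℝ) => oscFun y z u v w r.1 r.2 := by
  have h1 := h.continuous_y
  have h2 := h.continuous_z
  have h3 := h.continuous_u
  have h4 := h.continuous_v
  have h5 := h.continuous_w
  unfold oscFun jetRem
  fun_prop

/-- Near a simple zero, the function defining the osculating planes is strictly monotone, uniformly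
in the vector. -/
theorem exists_strictAntiOn {t₀ : ℝ} {q₀ : Fin 4 → ℝ} {k : ℝ}
    (hk : k = jetRem y u t₀ (q₀ 0) (q₀ 1) (q₀ 2)) (hk0 : k ≠ 0) :
    ∃ δ > 0, ∀ᶠ q in 𝓝 q₀, StrictAntiOn (fun t => k * oscFun y z u v w t q)
      (Ioo (t₀ - δ) (t₀ + δ)) := by
  have h1 := h.continuous_y
  have h3 := h.continuous_u
  have hc : Continuous fun r : (ℝ × ℝ) × (Fin 4 → ℝ) =>
      k * jetRem y u r.1.1 (r.2 0) (r.2 1) (r.2 2) -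
        |k| * (|r.2 0| * taylorRem y u r.1.2 r.1.1 +
          |r.2 1 - r.2 0 * r.1.1| * |u r.1.2 - u r.1.1|) := by
    unfold jetRem taylorRem
    fun_prop
  -- At `s = t = t₀` and `q = q₀` the error terms vanish and `k * k > 0` is left. By continuity the
  -- main term dominates in a whole neighborhood.
  have hpos : 0 < k * jetRem y u t₀ (q₀ 0) (q₀ 1) (q₀ 2) -
        |k| * (|q₀ 0| * taylorRem y u t₀ t₀ + |q₀ 1 - q₀ 0 * t₀| * |u t₀ - u t₀|) := by
    rw [← hk, taylorRem_self, sub_self, abs_zero, mul_zero, mul_zero, add_zero, mul_zero, sub_zero]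
    exact mul_self_pos.2 hk0
  have hev := (hc.tendsto ((t₀, t₀), q₀)).eventually (lt_mem_nhds hpos)
  rw [nhds_prod_eq] at hev
  obtain ⟨P, hP, Q, hQ, hPQ⟩ := eventually_prod_iff.1 hev
  rw [nhds_prod_eq] at hP
  obtain ⟨P₁, hP₁, P₂, hP₂, hPP⟩ := eventually_prod_iff.1 hP
  obtain ⟨δ, hδ, hball⟩ := Metric.eventually_nhds_iff.1 (hP₁.and hP₂)
  refine ⟨δ, hδ, ?_⟩
  filter_upwards [hQ] with q hq t ht s hs hts
  have hdist : ∀ r ∈ Ioo (t₀ - δ) (t₀ + δ), dist r t₀ < δ := fun r hr => by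
    rw [Real.dist_eq, abs_lt]
    constructor <;> linarith [hr.1, hr.2]
  have h5 := hPQ (hPP (hball (hdist t ht)).1 (hball (hdist s hs)).2) hq
  simp only at h5
  have h6 := h.abs_oscFun_sub_le hts q
  have hw := sub_pos.2 (h.strictMono_w hts)
  set J := jetRem y u t (q 0) (q 1) (q 2)
  set M := |q 0| * taylorRem y u s t + |q 1 - q 0 * t| * |u s - u t|
  set X := oscFun y z u v w s q - oscFun y z u v w t q with hX
  have h7 : |k * (X + J * (w s - w t))| ≤ (w s - w t) * (|k| * M) := by
    rw [abs_mul]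
    calc _ ≤ |k| * ((w s - w t) * M) := by gcongr
      _ = _ := by ring
  have h8 := (abs_le.1 h7).2
  have h9 : 0 < (w s - w t) * (k * J - |k| * M) := mul_pos hw h5
  have h10 : k * X < 0 := by linarith
  rw [hX] at h10
  change k * _ < k * _
  linarith

/-- Simple zeros of the function defining the osculating planes persist and remain unique. -/
theorem eventually_existsUnique_zero {t₀ : ℝ} {q₀ : Fin 4 → ℝ}
    (h0 : oscFun y z u v w t₀ q₀ = 0) (hk0 : jetRem y u t₀ (q₀ 0) (q₀ 1) (q₀ 2) ≠ 0)
    {A : Set ℝ} (hA : A ∈ 𝓝 t₀) : ∃ δ > 0, Ioo (t₀ - δ) (t₀ + δ) ⊆ A ∧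
      ∀ᶠ q in 𝓝 q₀, ∃! t, t ∈ Ioo (t₀ - δ) (t₀ + δ) ∧ oscFun y z u v w t q = 0 := by
  set k := jetRem y u t₀ (q₀ 0) (q₀ 1) (q₀ 2) with hk
  obtain ⟨δ₁, hδ₁, hev⟩ := h.exists_strictAntiOn hk hk0
  obtain ⟨δ₂, hδ₂, hball⟩ := Metric.mem_nhds_iff.1 hA
  set δ := min (δ₁ / 2) δ₂ with hδ
  have hδ0 : 0 < δ := lt_min (half_pos hδ₁) hδ₂
  have hle : δ ≤ δ₁ / 2 := min_le_left _ _
  refine ⟨δ, hδ0, ?_, ?_⟩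
  · intro t ht
    refine hball ?_
    rw [Metric.mem_ball, Real.dist_eq, abs_lt]
    have := min_le_right (δ₁ / 2) δ₂
    constructor <;> linarith [ht.1, ht.2]
  have hc := h.continuous_oscFun
  have hcq : ∀ t, Continuous fun q => k * oscFun y z u v w t q := fun t =>
    continuous_const.mul (hc.comp (continuous_const.prodMk continuous_id))
  have hct : ∀ q, Continuous fun t => k * oscFun y z u v w t q := fun q =>
    continuous_const.mul (hc.comp (continuous_id.prodMk continuous_const))
  have hm₀ := hev.self_of_nhds
  have hl : 0 < k * oscFun y z u v w (t₀ - δ) q₀ := by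
    have := hm₀ (a := t₀ - δ) (b := t₀) ⟨by linarith, by linarith⟩ ⟨by linarith, by linarith⟩
      (by linarith)
    simpa [h0] using this
  have hr : k * oscFun y z u v w (t₀ + δ) q₀ < 0 := by
    have := hm₀ (a := t₀) (b := t₀ + δ) ⟨by linarith, by linarith⟩ ⟨by linarith, by linarith⟩
      (by linarith)
    simpa [h0] using this
  filter_upwards [hev, ((hcq _).tendsto q₀).eventually (lt_mem_nhds hl),
    ((hcq _).tendsto q₀).eventually (gt_mem_nhds hr)] with q h1 h2 h3
  obtain ⟨t, ht, ht0⟩ := intermediate_value_Ioo' (show t₀ - δ ≤ t₀ + δ by linarith)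
    (hct q).continuousOn ⟨h3, h2⟩
  have hsub : Ioo (t₀ - δ) (t₀ + δ) ⊆ Ioo (t₀ - δ₁) (t₀ + δ₁) :=
    Ioo_subset_Ioo (by linarith) (by linarith)
  refine ⟨t, ⟨ht, (mul_eq_zero.1 ht0).resolve_left hk0⟩, fun s hs => ?_⟩
  refine h1.injOn (hsub hs.1) (hsub ht) ?_
  simp only [hs.2, mul_zero]
  exact ht0.symm

end ConvexFunctions

variable {B : Type*} [TopologicalSpace B] (θ : B ≃ₜ UnitAddCircle) {ξ : B → FullFlag 4}
  (hξ : IsHyperconvexFrenet ξ)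

include θ hξ in
-- A chart centered away from `b₀`, here at the antipode, sees `b₀` at a finite parameter. Lying off
-- the tangent line at `b₀` is exactly simplicity of the zero.
theorem eventually_existsUnique_mem_three {b₀ : B} {p₀ : Vec 4} (h3 : p₀ ∈ (ξ b₀).sub 3)
    (h2 : p₀ ∉ (ξ b₀).sub 2) {A : Set B} (hA : A ∈ 𝓝 b₀) :
    ∃ A' ⊆ A, IsOpen A' ∧ b₀ ∈ A' ∧ ∀ᶠ p in 𝓝 p₀, ∃! b, b ∈ A' ∧ p ∈ (ξ b).sub 3 := by
  set x := arcPt θ b₀ (1 / 2)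
  have hx : b₀ ≠ x := arcPt_ne θ b₀ (by norm_num)
  obtain ⟨Φ, β, y, z, u, v, w, h⟩ := exists_chart θ hξ x
  obtain ⟨t₀, rfl⟩ : b₀ ∈ range β := by rw [h.range_eq]; exact hx
  rw [h.mem_three_iff hξ] at h3
  have hk : jetRem y u t₀ (Φ p₀ 0) (Φ p₀ 1) (Φ p₀ 2) ≠ 0 := fun h0 => h2 (by
    rw [h.mem_two_iff hξ]
    refine ⟨h0, ?_⟩
    rw [oscFun, h0, mul_zero, sub_zero] at h3
    exact h3)
  obtain ⟨δ, hδ, hsub, hev⟩ := h.toConvexFunctions.eventually_existsUnique_zero h3 hk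
    (h.continuous_param.continuousAt hA)
  refine ⟨β '' Ioo (t₀ - δ) (t₀ + δ), image_subset_iff.2 hsub,
    h.isOpenEmbedding.isOpenMap _ isOpen_Ioo,
    mem_image_of_mem _ ⟨by linarith, by linarith⟩, ?_⟩
  filter_upwards [Φ.continuous.continuousAt.eventually hev] with p hp
  obtain ⟨t, ⟨ht, ht0⟩, huniq⟩ := hp
  refine ⟨β t, ⟨mem_image_of_mem _ ht, (h.mem_three_iff hξ t p).2 ht0⟩, ?_⟩
  rintro _ ⟨⟨s, hs, rfl⟩, hs0⟩
  rw [huniq s ⟨hs, (h.mem_three_iff hξ s p).1 hs0⟩]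

theorem oscFun_add_smul (y z u v w : ℝ → ℝ) (t a b : ℝ) (q r : Fin 4 → ℝ) :
    oscFun y z u v w t (a • q + b • r) =
      a * oscFun y z u v w t q + b * oscFun y z u v w t r := by
  simp only [oscFun, jetRem, Pi.add_apply, Pi.smul_apply, smul_eq_mul]
  ring

include θ hξ in
-- For the point `q` of the curve at parameter `0`, the functional of the osculating plane is
-- positive for `t < 0` and negative for `t > 0`. A point `p` outside `ξ³(x)` is, up to scale, `q`
-- plus a vector of `ξ³(x)`, whose contribution is negligible when `β t` is near `x`; the signs near
-- the two ends persist and force a zero.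
theorem zeroSet_nonempty (p : Vec 4) : (zeroSet ξ p).Nonempty := by
  set x := θ.symm 0
  obtain ⟨Φ, β, y, z, u, v, w, h⟩ := exists_chart θ hξ x
  by_cases hp : p ∈ (ξ x).sub 3
  · exact ⟨x, hp⟩
  have hp0 : Φ p 0 ≠ 0 := fun e => hp ((h.adapted.mem_three p).2 e)
  set α := oscFun y z u v w
  set q : Vec 4 := coordVec Φ 1 0 (y 0) (z 0) with hq
  set e : Vec 4 := (Φ p 0)⁻¹ • p - q with he
  have he0 : Φ e 0 = 0 := by simp [he, hq, hp0]
  have hαq : ∀ t, α t (Φ q) = taylorRem z v t 0 - w t * taylorRem y u t 0 := fun t => by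
    simp only [α, hq, apply_coordVec, oscFun, jetRem, taylorRem]
    simp
  have hαp : ∀ t, α t (Φ p) = Φ p 0 * (α t (Φ q) + α t (Φ e)) := fun t => by
    have e1 : Φ p = Φ p 0 • Φ q + Φ p 0 • Φ e := by
      rw [← map_smul, ← map_smul, ← map_add, ← smul_add, he, add_sub_cancel,
        smul_inv_smul₀ hp0]
    conv_lhs => rw [e1]
    simp only [α]
    rw [oscFun_add_smul, mul_add]
  set C := (|Φ e 1| + |Φ e 2| + |Φ e 3|) + (|Φ q 1| + |Φ q 2| + |Φ q 3|) with hC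
  have hC0 : 0 ≤ C := by positivity
  have hbound : ∀ᶠ t in cocompact ℝ, |α t (Φ e)| ≤ 1 / 3 * |α t (Φ q)| := by
    filter_upwards [h.eventually_zero_le (((hξ.tendsto_sub 3 x).mono_left
      nhdsWithin_le_nhds).comp h.tendsto_param) (ε := 1 / (4 * (C + 1))) (by positivity)] with t ht
    -- The combination of `e` and `q` killed by the functional. Its coordinate `0` is `-α t (Φ e)`,
    -- which is small since the osculating plane is close to `ξ³(x)`.
    set r : Vec 4 := α t (Φ q) • e + (-α t (Φ e)) • q with hr
    have hrm : r ∈ (ξ (β t)).sub 3 := by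
      rw [h.mem_three_iff hξ, hr, map_add, map_smul, map_smul, oscFun_add_smul]
      ring
    rw [← coordVec_apply Φ r] at hrm
    have h1 := ht _ _ _ _ hrm
    have hr0 : Φ r 0 = -α t (Φ e) := by simp [hr, he0, hq]
    have hri : ∀ i, |Φ e i| ≤ C → |Φ q i| ≤ C → |Φ r i| ≤ C * (|α t (Φ q)| + |α t (Φ e)|) := by
      intro i hi hi'
      have e1 : Φ r i = α t (Φ q) * Φ e i - α t (Φ e) * Φ q i := by
        simp [hr]; ring
      rw [e1]
      refine (abs_sub _ _).trans ?_
      rw [abs_mul, abs_mul, mul_add]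
      refine add_le_add ?_ ?_
      · rw [mul_comm]; gcongr
      · rw [mul_comm]; gcongr
    have p1 := abs_nonneg (Φ e 1)
    have p2 := abs_nonneg (Φ e 2)
    have p3 := abs_nonneg (Φ e 3)
    have p4 := abs_nonneg (Φ q 1)
    have p5 := abs_nonneg (Φ q 2)
    have p6 := abs_nonneg (Φ q 3)
    have h2 : max |Φ r 1| (max |Φ r 2| |Φ r 3|) ≤ C * (|α t (Φ q)| + |α t (Φ e)|) :=
      max_le (hri 1 (by linarith) (by linarith)) (max_le (hri 2 (by linarith) (by linarith))
        (hri 3 (by linarith) (by linarith)))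
    rw [hr0, abs_neg] at h1
    have h3 : 1 / (4 * (C + 1)) * max |Φ r 1| (max |Φ r 2| |Φ r 3|) ≤
        1 / 4 * (|α t (Φ q)| + |α t (Φ e)|) := by
      rw [div_mul_eq_mul_div, one_mul, div_le_iff₀ (by positivity)]
      have : 0 ≤ |α t (Φ q)| + |α t (Φ e)| := by positivity
      linarith
    linarith
  rw [cocompact_eq_atBot_atTop] at hbound
  obtain ⟨h1, h2⟩ := eventually_sup.1 hbound
  obtain ⟨l, hl, hl0⟩ := (h1.and (eventually_lt_atBot 0)).exists
  obtain ⟨r, hr, hr0⟩ := (h2.and (eventually_gt_atTop 0)).exists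
  have hlq : 0 < α l (Φ q) := by
    rw [hαq]
    linarith [h.lt_rem_right l 0 hl0]
  have hrq : α r (Φ q) < 0 := by
    rw [hαq]
    linarith [h.rem_left_lt 0 r hr0]
  rw [abs_of_pos hlq] at hl
  rw [abs_of_neg hrq] at hr
  have hc : Continuous fun t => α t (Φ q) + α t (Φ e) :=
    (h.continuous_oscFun.comp (continuous_id.prodMk continuous_const)).add
      (h.continuous_oscFun.comp (continuous_id.prodMk continuous_const))
  obtain ⟨t, -, ht⟩ := intermediate_value_Icc' (show l ≤ r by linarith) hc.continuousOn
    (show (0 : ℝ) ∈ Icc _ _ from ⟨by linarith [le_abs_self (α r (Φ e))],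
      by linarith [neg_abs_le (α l (Φ e))]⟩)
  refine ⟨β t, (h.mem_three_iff hξ t p).2 ?_⟩
  change α t (Φ p) = 0
  rw [hαp]
  simp only at ht
  rw [ht, mul_zero]

end OsculatingPlanes

/-! ### The plane `ξ³(x)`: one or three osculating planes. -/

section Axes

/-- The vector lies on none of the tangent lines of the curve. -/
def OffTangents {B : Type*} (ξ : B → FullFlag 4) (p : Vec 4) : Prop := ∀ b, p ∉ (ξ b).sub 2

theorem zeroSet_smul {B : Type*} (ξ : B → FullFlag 4) {a : ℝ} (ha : a ≠ 0) (p : Vec 4) :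
    zeroSet ξ (a • p) = zeroSet ξ p := by
  ext b
  exact ((ξ b).sub 3).smul_mem_iff ha

theorem mem_span_coordVec (Φ : Vec 4 ≃L[ℝ] (Fin 4 → ℝ)) {a b : ℝ} {q : Vec 4} :
    q ∈ Submodule.span ℝ {coordVec Φ 0 1 a b} ↔
      Φ q 0 = 0 ∧ Φ q 2 = Φ q 1 * a ∧ Φ q 3 = Φ q 1 * b := by
  rw [Submodule.mem_span_singleton]
  constructor
  · rintro ⟨r, rfl⟩
    simp
  · rintro ⟨h0, h2, h3⟩
    refine ⟨Φ q 1, ?_⟩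
    conv_rhs => rw [← coordVec_apply Φ q]
    rw [smul_coordVec, h0, h2, h3, mul_zero, mul_one]

variable {B : Type*} [TopologicalSpace B] {θ : B ≃ₜ UnitAddCircle} {ξ : B → FullFlag 4}
  (hξ : IsHyperconvexFrenet ξ)

namespace Chart

variable {x : B} {Φ : Vec 4 ≃L[ℝ] (Fin 4 → ℝ)} {β : ℝ → B} {y z u v w : ℝ → ℝ}
  (h : Chart θ ξ x Φ β y z u v w)
include h

theorem exists_param {b : B} (hb : x ≠ b) : ∃ t, β t = b := by
  have : b ∈ range β := by
    rw [h.range_eq]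
    exact hb.symm
  exact this

include hξ

theorem mem_axis_iff (t : ℝ) (q : Vec 4) :
    q ∈ (ξ x).sub 1 ⊔ ((ξ (β t)).sub 2 ⊓ (ξ x).sub 3) ↔ Φ q 0 = 0 ∧ Φ q 2 = Φ q 1 * u t := by
  rw [Submodule.mem_sup]
  constructor
  · rintro ⟨a, ha, b, ⟨hb2, hb3⟩, rfl⟩
    have h1 := (h.adapted.mem_one a).1 ha
    have h2 := (h.adapted.mem_three b).1 hb3
    have h3 := ((h.mem_two_iff hξ t b).1 hb2).1
    simp only [jetRem, h2] at h3
    simp only [map_add, Pi.add_apply, h1.1, h1.2.1, h1.2.2, h2]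
    exact ⟨by ring, by linarith⟩
  · rintro ⟨h0, h2⟩
    refine ⟨coordVec Φ 0 0 0 (Φ q 3 - Φ q 1 * v t), h.coordVec_last_mem _,
      Φ q 1 • coordVec Φ 0 1 (u t) (v t), ⟨Submodule.smul_mem _ _ (h.tangent_mem t),
        Submodule.smul_mem _ _ (h.coordVec_mem_three _ _ _)⟩, ?_⟩
    conv_rhs => rw [← coordVec_apply Φ q, h0, h2]
    rw [smul_coordVec, coordVec_add]
    congr 1 <;> ring

/-- The tangent line to the graph `(u, v)` at `s`, evaluated over the abscissa `u t`. -/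
theorem devCtrf_eq (s t : ℝ) : devCtrf ξ x (β s) (β t) =
    Submodule.span ℝ {coordVec Φ 0 1 (u t) (v s + w s * (u t - u s))} := by
  ext q
  rw [mem_span_coordVec, devCtrf, Submodule.mem_inf, h.mem_axis_iff hξ, h.mem_three_iff hξ,
    and_assoc]
  refine and_congr_right fun h0 => and_congr_right fun h2 => ?_
  simp only [oscFun, jetRem, h0, h2]
  constructor <;> intro e <;> linarith

/-- The line with the tangent slope `w t` through the point of the graph at `s`, evaluated over `u
t`: `ξ²(x) ∩ ξ³(β t)` is the point at infinity of that slope. -/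
theorem devPcf_eq (s t : ℝ) : devPcf ξ x (β s) (β t) =
    Submodule.span ℝ {coordVec Φ 0 1 (u t) (v s + w t * (u t - u s))} := by
  ext q
  rw [mem_span_coordVec, devPcf, Submodule.mem_inf, h.mem_axis_iff hξ, and_assoc]
  refine and_congr_right fun h0 => and_congr_right fun h2 => ?_
  rw [Submodule.mem_sup]
  constructor
  · rintro ⟨a, ⟨ha2, ha3⟩, b, ⟨hb2, hb3⟩, rfl⟩
    have e1 := (h.adapted.mem_two a).1 ha2
    have e2 := (h.mem_three_iff hξ t a).1 ha3
    have e3 := (h.adapted.mem_three b).1 hb3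
    have e4 := (h.mem_two_iff hξ s b).1 hb2
    simp only [oscFun, jetRem, e1.1, e1.2, e3] at e2 e4
    simp only [map_add, Pi.add_apply, e1.2] at h2 ⊢
    have e5 : Φ b 2 = Φ b 1 * u s := by linarith [e4.1]
    have e6 : Φ b 3 = Φ b 1 * v s := by linarith [e4.2]
    have e7 : Φ a 3 = w t * Φ a 2 := by linarith
    have e8 : Φ a 2 = Φ b 1 * u t - Φ b 1 * u s := by linarith
    rw [e6, e7, e8]
    ring
  · intro h3
    refine ⟨coordVec Φ 0 0 (Φ q 1 * (u t - u s)) (Φ q 1 * (w t * (u t - u s))),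
      ⟨h.coordVec_mem_two _ _, ?_⟩, Φ q 1 • coordVec Φ 0 1 (u s) (v s),
      ⟨Submodule.smul_mem _ _ (h.tangent_mem s),
        Submodule.smul_mem _ _ (h.coordVec_mem_three _ _ _)⟩, ?_⟩
    · change coordVec Φ 0 0 _ _ ∈ (ξ (β t)).sub 3
      rw [h.mem_three_iff hξ]
      simp [oscFun, jetRem]
      ring
    · conv_rhs => rw [← coordVec_apply Φ q, h0, h2, h3]
      rw [smul_coordVec, coordVec_add]
      congr 1 <;> ring

theorem coordVec_mem_three_param (c k t : ℝ) : coordVec Φ 0 1 (u c) k ∈ (ξ (β t)).sub 3 ↔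
    k - v t - w t * (u c - u t) = 0 := by
  rw [h.mem_three_iff hξ]
  simp [oscFun, jetRem]

theorem offTangents_coordVec {c k : ℝ} (hk : k ≠ v c) : OffTangents ξ (coordVec Φ 0 1 (u c) k) := by
  intro b hb
  by_cases hxb : x = b
  · subst hxb
    have := ((h.adapted.mem_two _).1 hb).2
    simp at this
  obtain ⟨t, rfl⟩ := h.exists_param hxb
  have h1 := (h.mem_two_iff hξ t _).1 hb
  simp [jetRem, sub_eq_zero] at h1
  obtain rfl := h.strictMono_u.injective h1.1
  exact hk h1.2

theorem zeroSet_coordVec_of_lt {c k : ℝ} (hk : k < v c) : ∃ a b, a < c ∧ c < b ∧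
    k - v a - w a * (u c - u a) = 0 ∧
    zeroSet ξ (coordVec Φ 0 1 (u c) k) = {x, β a, β b} := by
  obtain ⟨a, b, ha, hb, hab⟩ := h.exists_two_tangents hk
  refine ⟨a, b, ha, hb, (hab a).2 (.inl rfl), ?_⟩
  ext b'
  simp only [zeroSet, mem_ofPred_eq, mem_insert_iff, mem_singleton_iff]
  by_cases hxb : x = b'
  · subst hxb
    simp [h.coordVec_mem_three]
  obtain ⟨t, rfl⟩ := h.exists_param hxb
  rw [h.coordVec_mem_three_param hξ, hab, h.injective_param.eq_iff, h.injective_param.eq_iff]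
  simp [h.param_ne t]

theorem zeroSet_coordVec_of_gt {c k : ℝ} (hk : v c < k) :
    zeroSet ξ (coordVec Φ 0 1 (u c) k) = {x} := by
  ext b'
  simp only [zeroSet, mem_ofPred_eq, mem_singleton_iff]
  by_cases hxb : x = b'
  · subst hxb
    simp [h.coordVec_mem_three]
  obtain ⟨t, rfl⟩ := h.exists_param hxb
  rw [h.coordVec_mem_three_param hξ]
  exact iff_of_false (h.height_pos hk t).ne' (h.param_ne t)

omit hξ in
theorem eq_smul_coordVec {p : Vec 4} (h3 : p ∈ (ξ x).sub 3) (h2 : p ∉ (ξ x).sub 2) :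
    ∃ c k, Φ p 1 ≠ 0 ∧ p = Φ p 1 • coordVec Φ 0 1 (u c) k := by
  have h0 := (h.adapted.mem_three p).1 h3
  have h1 : Φ p 1 ≠ 0 := fun e => h2 ((h.adapted.mem_two p).2 ⟨h0, e⟩)
  obtain ⟨c, hc⟩ := h.surjective_u (Φ p 2 / Φ p 1)
  refine ⟨c, Φ p 3 / Φ p 1, h1, ?_⟩
  conv_lhs => rw [← coordVec_apply Φ p]
  rw [smul_coordVec, hc, mul_div_cancel₀ _ h1, mul_div_cancel₀ _ h1, h0, mul_zero, mul_one]

end Chart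

variable {x y z : B}

include hξ in
-- By strict convexity the tangent at `y` passes below the graph over `z`, so the point has two
-- tangents: one touches at `y`, the other at some `y'` beyond `z`.
theorem exists_devCtrf_eq_span (h : sbtw (θ x) (θ y) (θ z)) :
    ∃ e, e ≠ 0 ∧ devCtrf ξ x y z = Submodule.span ℝ {e} ∧ OffTangents ξ e ∧
      ∃ y', sbtw (θ x) (θ z) (θ y') ∧ zeroSet ξ e = {x, y, y'} := by
  obtain ⟨hxy, -, hxz⟩ := ne_of_sbtw θ h
  obtain ⟨Φ, β, Y, Z, u, v, w, hC⟩ := exists_chart θ hξ x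
  obtain ⟨s, rfl⟩ := hC.exists_param hxy
  obtain ⟨t, rfl⟩ := hC.exists_param hxz
  have hst := (hC.lt_iff s t).2 h
  have hk : v s + w s * (u t - u s) < v t := by linarith [hC.lt_sub_v s t hst]
  refine ⟨_, fun h0 => ?_, hC.devCtrf_eq hξ s t, hC.offTangents_coordVec hξ hk.ne, ?_⟩
  · exact one_ne_zero (coordVec_eq_zero Φ h0).2.1
  obtain ⟨a, b, ha, hb, -, hZ⟩ := hC.zeroSet_coordVec_of_lt hξ hk
  have hs : β s ∈ zeroSet ξ (coordVec Φ 0 1 (u t) (v s + w s * (u t - u s))) :=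
    (hC.coordVec_mem_three_param hξ _ _ _).2 (by ring)
  rw [hZ] at hs
  -- The plane at `β s` contains the point by construction, and `s < t < b` leaves only the left
  -- point of tangency.
  have hsa : s = a := by
    rcases hs with hs | hs | hs
    · exact absurd hs (hC.param_ne s)
    · exact hC.injective_param hs
    · have := hC.injective_param hs
      linarith
  exact ⟨β b, (hC.lt_iff _ _).1 hb, by rw [hZ, hsa]⟩

include hξ in
theorem exists_devPcf_eq_span (h : sbtw (θ x) (θ y) (θ z)) :
    ∃ e, e ≠ 0 ∧ devPcf ξ x y z = Submodule.span ℝ {e} ∧ OffTangents ξ e ∧ zeroSet ξ e = {x} := by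
  obtain ⟨hxy, -, hxz⟩ := ne_of_sbtw θ h
  obtain ⟨Φ, β, Y, Z, u, v, w, hC⟩ := exists_chart θ hξ x
  obtain ⟨s, rfl⟩ := hC.exists_param hxy
  obtain ⟨t, rfl⟩ := hC.exists_param hxz
  have hst := (hC.lt_iff s t).2 h
  have hk : v t < v s + w t * (u t - u s) := by linarith [hC.sub_v_lt s t hst]
  refine ⟨_, fun h0 => ?_, hC.devPcf_eq hξ s t, hC.offTangents_coordVec hξ hk.ne',
    hC.zeroSet_coordVec_of_gt hξ hk⟩
  exact one_ne_zero (coordVec_eq_zero Φ h0).2.1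

include hξ in
variable (θ) in
/-- A point off the tangent lines lies on one or on three osculating planes. -/
theorem zeroSet_dichotomy {p : Vec 4} (hp : OffTangents ξ p) (hx : x ∈ zeroSet ξ p) :
    (zeroSet ξ p = {x} ∧ ∃ y z, sbtw (θ x) (θ y) (θ z) ∧ p ∈ devPcf ξ x y z) ∨
    ∃ y z y', sbtw (θ x) (θ y) (θ z) ∧ sbtw (θ x) (θ z) (θ y') ∧ zeroSet ξ p = {x, y, y'} ∧
      p ∈ devCtrf ξ x y z := by
  obtain ⟨Φ, β, Y, Z, u, v, w, hC⟩ := exists_chart θ hξ x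
  obtain ⟨c, k, h1, he⟩ := hC.eq_smul_coordVec hx (hp x)
  have hZ : zeroSet ξ p = zeroSet ξ (coordVec Φ 0 1 (u c) k) := by
    conv_lhs => rw [he]
    exact zeroSet_smul ξ h1 _
  rcases lt_trichotomy k (v c) with hk | hk | hk
  · right
    obtain ⟨a, b, ha, hb, ha0, hab⟩ := hC.zeroSet_coordVec_of_lt hξ hk
    refine ⟨β a, β c, β b, (hC.lt_iff _ _).1 ha, (hC.lt_iff _ _).1 hb, hZ.trans hab, ?_⟩
    rw [hC.devCtrf_eq hξ, he, show v a + w a * (u c - u a) = k by linarith]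
    exact Submodule.smul_mem _ _ (Submodule.mem_span_singleton_self _)
  · refine absurd ?_ (hp (β c))
    rw [he, hk]
    exact Submodule.smul_mem _ _ (hC.tangent_mem c)
  · left
    obtain ⟨a, ha, hak⟩ := hC.exists_secant hk
    refine ⟨hZ.trans (hC.zeroSet_coordVec_of_gt hξ hk), β a, β c, (hC.lt_iff _ _).1 ha, ?_⟩
    rw [hC.devPcf_eq hξ, he, ← hak]
    exact Submodule.smul_mem _ _ (Submodule.mem_span_singleton_self _)

include hξ in
theorem eq_of_mem_axis (θ : B ≃ₜ UnitAddCircle) {p : Vec 4}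
    (hp : p ∉ (ξ x).sub 2) {z' : B} (hz : x ≠ z) (hz' : x ≠ z')
    (h : p ∈ (ξ x).sub 1 ⊔ ((ξ z).sub 2 ⊓ (ξ x).sub 3))
    (h' : p ∈ (ξ x).sub 1 ⊔ ((ξ z').sub 2 ⊓ (ξ x).sub 3)) : z = z' := by
  obtain ⟨Φ, β, Y, Z, u, v, w, hC⟩ := exists_chart θ hξ x
  obtain ⟨s, rfl⟩ := hC.exists_param hz
  obtain ⟨t, rfl⟩ := hC.exists_param hz'
  rw [hC.mem_axis_iff hξ] at h h'
  have h1 : Φ p 1 ≠ 0 := fun e => hp ((hC.adapted.mem_two p).2 ⟨h.1, e⟩)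
  rw [hC.strictMono_u.injective (mul_left_cancel₀ h1 (h.2.symm.trans h'.2))]

omit [TopologicalSpace B] in
theorem OffTangents.smul {e : Vec 4} {a : ℝ} (ha : a ≠ 0) (he : OffTangents ξ e) :
    OffTangents ξ (a • e) := fun b hb => he b (((ξ b).sub 2).smul_mem_iff ha |>.1 hb)

include hξ in
/-- The fiber of the developing map over a point is determined by the first entry. -/
theorem eq_of_mem_devCtrf {p : Vec 4} (hp : p ≠ 0) {y' z' : B} (h : sbtw (θ x) (θ y) (θ z))
    (h' : sbtw (θ x) (θ y') (θ z')) (hm : p ∈ devCtrf ξ x y z) (hm' : p ∈ devCtrf ξ x y' z') :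
    y = y' ∧ z = z' := by
  obtain ⟨e, -, he, hoff, y₁, hy₁, hZ⟩ := exists_devCtrf_eq_span hξ h
  rw [he, Submodule.mem_span_singleton] at hm
  obtain ⟨a, rfl⟩ := hm
  have ha : a ≠ 0 := fun h0 => hp (by rw [h0, zero_smul])
  have hz : z = z' := by
    have hm : a • e ∈ devCtrf ξ x y z := he ▸ Submodule.smul_mem _ _
      (Submodule.mem_span_singleton_self _)
    exact eq_of_mem_axis hξ θ (hoff.smul ha x) (ne_of_sbtw θ h).2.2 (ne_of_sbtw θ h').2.2
      hm.1 hm'.1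
  refine ⟨?_, hz⟩
  have h1 : y' ∈ zeroSet ξ e := by
    rw [← zeroSet_smul ξ ha]
    exact hm'.2
  rw [hZ] at h1
  rcases h1 with h1 | h1 | h1
  · exact absurd h1.symm (ne_of_sbtw θ h').1
  · exact h1.symm
  -- The other point of tangency lies beyond `z`, against the orientation of the second triple.
  · rw [h1, ← hz] at h'
    rw [sbtw_iff_gap] at h' hy₁
    exact absurd h'.2 hy₁.2.not_gt

end Axes

/-! ### Topology of projective space and a covering criterion. -/

section ProjectiveSpace

variable {n : ℕ}

/-- The saturation of an open set is the union of its multiples by nonzero scalars. -/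
theorem isOpenQuotientMap_mk' :
    IsOpenQuotientMap (Projectivization.mk' ℝ : {v : Vec n // v ≠ 0} → ℙ ℝ (Vec n)) := by
  have hq : IsQuotientMap (Projectivization.mk' ℝ : {v : Vec n // v ≠ 0} → ℙ ℝ (Vec n)) :=
    isQuotientMap_quot_mk
  refine ⟨hq.surjective, hq.continuous, fun U hU => ?_⟩
  rw [← hq.isOpen_preimage]
  have : Projectivization.mk' ℝ ⁻¹' (Projectivization.mk' ℝ '' U) =
      ⋃ a : ℝˣ, (fun v : {v : Vec n // v ≠ 0} =>
        (⟨a • (v : Vec n), (smul_ne_zero_iff_ne a).2 v.2⟩ : {v : Vec n // v ≠ 0})) ⁻¹' U := by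
    ext v
    simp only [mem_preimage, mem_image, mem_iUnion, Projectivization.mk'_eq_mk,
      Projectivization.mk_eq_mk_iff]
    constructor
    · rintro ⟨w, hw, a, ha⟩
      exact ⟨a, by simpa only [ha] using hw⟩
    · rintro ⟨a, ha⟩
      exact ⟨_, ha, a, rfl⟩
  rw [this]
  refine isOpen_iUnion fun a => hU.preimage ?_
  exact Continuous.subtype_mk (continuous_subtype_val.const_smul a) _

theorem eq_mk_of_mem_submodule {q : ℙ ℝ (Vec n)} {v : Vec n} (hv : v ≠ 0) (h : v ∈ q.submodule) :
    q = .mk ℝ v hv := by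
  rw [Projectivization.submodule_eq, Submodule.mem_span_singleton] at h
  obtain ⟨a, rfl⟩ := h
  exact q.mk_rep.symm.trans
    ((Projectivization.mk_eq_mk_iff' ℝ _ _ hv q.rep_nonzero).2 ⟨a, rfl⟩).symm

theorem eventually_nhds_mk {P : ℙ ℝ (Vec n) → Prop} {e : Vec n} (he : e ≠ 0)
    (h : ∀ᶠ v in 𝓝 e, ∀ hv : v ≠ 0, P (.mk ℝ v hv)) : ∀ᶠ q in 𝓝 (.mk ℝ e he), P q := by
  have h1 := (isOpenQuotientMap_mk' (n := n)).map_nhds_eq ⟨e, he⟩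
  rw [← Projectivization.mk'_eq_mk ℝ ⟨e, he⟩, ← h1, eventually_map]
  filter_upwards [continuous_subtype_val.continuousAt.eventually h] with v hv
  exact hv v.2

theorem tendsto_proj {ι : Type*} {l : Filter ι} {f : ι → Vec n} {g : ι → ℙ ℝ (Vec n)} {e : Vec n}
    (he : e ≠ 0) (hf : Tendsto f l (𝓝 e)) (hg : ∀ i, f i ∈ (g i).submodule) :
    Tendsto g l (𝓝 (.mk ℝ e he)) := by
  have h1 := (isOpenQuotientMap_mk' (n := n)).continuous.tendsto ⟨e, he⟩
  classical
  have h2 : Tendsto (fun i => if h : f i ≠ 0 then (⟨f i, h⟩ : {v : Vec n // v ≠ 0}) else ⟨e, he⟩) l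
      (𝓝 ⟨e, he⟩) := by
    rw [tendsto_subtype_rng]
    refine hf.congr' ?_
    filter_upwards [hf.eventually_ne he] with i hi
    rw [dif_pos hi]
  refine (h1.comp h2).congr' ?_
  filter_upwards [hf.eventually_ne he] with i hi
  rw [Function.comp_apply, dif_pos hi, Projectivization.mk'_eq_mk]
  exact (eq_mk_of_mem_submodule hi (hg i)).symm

theorem tendsto_proj_of_tendsto_starProjection {ι : Type*} {l : Filter ι} {g : ι → ℙ ℝ (Vec n)}
    {q : ℙ ℝ (Vec n)}
    (h : Tendsto (fun i => (g i).submodule.starProjection) l (𝓝 q.submodule.starProjection)) :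
    Tendsto g l (𝓝 q) := by
  have hq : q.rep ∈ q.submodule := by
    rw [Projectivization.submodule_eq]
    exact Submodule.mem_span_singleton_self _
  have h1 := tendsto_clm_apply h (tendsto_const_nhds (x := q.rep))
  rw [Submodule.starProjection_eq_self_iff.2 hq] at h1
  have h2 := tendsto_proj q.rep_nonzero h1 fun i => (g i).submodule.starProjection_apply_mem _
  rwa [Projectivization.mk_rep] at h2

/-- For an open quotient map it suffices that the relation be closed; proportionality is the
vanishing of the `2 × 2` minors. -/
theorem t2Space_projectivization : T2Space (ℙ ℝ (Vec n)) := by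
  rw [t2Space_iff_of_isOpenQuotientMap isOpenQuotientMap_mk']
  have : {q : {v : Vec n // v ≠ 0} × {v : Vec n // v ≠ 0} |
      Projectivization.mk' ℝ q.1 = Projectivization.mk' ℝ q.2} =
      ⋂ i, ⋂ j, {q | (q.1 : Vec n) i * (q.2 : Vec n) j = (q.1 : Vec n) j * (q.2 : Vec n) i} := by
    ext ⟨v, w⟩
    simp only [Projectivization.mk'_eq_mk, mem_iInter, mem_ofPred_eq,
      Projectivization.mk_eq_mk_iff']
    constructor
    · rintro ⟨a, ha⟩ i j
      rw [← ha]
      simp only [PiLp.smul_apply, smul_eq_mul]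
      ring
    · intro h
      obtain ⟨i, hi⟩ : ∃ i, (w : Vec n) i ≠ 0 := by
        by_contra! hw
        exact w.2 (by ext i; exact hw i)
      refine ⟨(v : Vec n) i / (w : Vec n) i, ?_⟩
      ext j
      simp only [PiLp.smul_apply, smul_eq_mul]
      rw [div_mul_eq_mul_div, div_eq_iff hi, h i j]
  rw [this]
  exact isClosed_iInter fun i => isClosed_iInter fun j => isClosed_eq (by fun_prop) (by fun_prop)

theorem secondCountableTopology_projectivization : SecondCountableTopology (ℙ ℝ (Vec n)) :=
  isOpenQuotientMap_mk'.isQuotientMap.secondCountableTopology isOpenQuotientMap_mk'.isOpenMap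

theorem exists_rep_mk {v : Vec n} (hv : v ≠ 0) :
    ∃ a : ℝ, a ≠ 0 ∧ (Projectivization.mk ℝ v hv).rep = a • v := by
  obtain ⟨a, ha⟩ := Projectivization.exists_smul_eq_mk_rep ℝ v hv
  exact ⟨a, a.ne_zero, ha.symm⟩

/-- The point of the projective space with homogeneous coordinates `a` and `1` at the place `i`. -/
def affineVec (i : Fin (n + 1)) (a : Fin n → ℝ) : Vec (n + 1) :=
  WithLp.toLp 2 (i.insertNth 1 a)

@[simp]
theorem affineVec_self (i : Fin (n + 1)) (a : Fin n → ℝ) : affineVec i a i = 1 := by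
  simp [affineVec]

@[simp]
theorem affineVec_succAbove (i : Fin (n + 1)) (a : Fin n → ℝ) (j : Fin n) :
    affineVec i a (i.succAbove j) = a j := by
  simp [affineVec]

theorem affineVec_ne_zero (i : Fin (n + 1)) (a : Fin n → ℝ) : affineVec i a ≠ 0 := fun h => by
  have := congrArg (fun v : Vec (n + 1) => v i) h
  simp at this

theorem continuous_affineVec (i : Fin (n + 1)) : Continuous (affineVec (n := n) i) :=
  (PiLp.continuous_toLp 2 _).comp (continuous_const.finInsertNth i continuous_id)

/-- The affine chart of the projective space in which the `i`-th coordinate is normalized. -/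
def affineChart (i : Fin (n + 1)) : OpenPartialHomeomorph (ℙ ℝ (Vec (n + 1))) (Fin n → ℝ) where
  toFun q j := q.rep (i.succAbove j) / q.rep i
  invFun a := .mk ℝ (affineVec i a) (affineVec_ne_zero i a)
  source := {q | q.rep i ≠ 0}
  target := univ
  map_source' _ _ := mem_univ _
  map_target' a _ := by
    obtain ⟨r, hr, h⟩ := exists_rep_mk (affineVec_ne_zero i a)
    simp [h, hr]
  left_inv' q hq := by
    refine (eq_mk_of_mem_submodule _ ?_).symm
    rw [Projectivization.submodule_eq, Submodule.mem_span_singleton]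
    refine ⟨(q.rep i)⁻¹, ?_⟩
    ext j
    refine Fin.succAboveCases i ?_ (fun j => ?_) j
    · simpa using inv_mul_cancel₀ hq
    · simp [div_eq_inv_mul]
  right_inv' a _ := by
    obtain ⟨r, hr, h⟩ := exists_rep_mk (affineVec_ne_zero i a)
    ext j
    simp [h, hr]
  open_source := by
    rw [isOpen_iff_eventually]
    intro q hq
    induction q using Projectivization.ind with | h e he => ?_
    refine eventually_nhds_mk he ?_
    obtain ⟨r, hr, h⟩ := exists_rep_mk he
    have hc : Continuous fun v : Vec (n + 1) => v i := by fun_prop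
    have he' : e i ≠ 0 := fun h0 => hq (by simp [h, h0])
    filter_upwards [hc.continuousAt.eventually_ne he'] with v hvi hv
    obtain ⟨s, hs, h⟩ := exists_rep_mk hv
    simpa [h, hs] using hvi
  open_target := isOpen_univ
  continuousOn_toFun := by
    intro q hq
    refine ContinuousAt.continuousWithinAt ?_
    induction q using Projectivization.ind with | h e he => ?_
    obtain ⟨r, hr, h⟩ := exists_rep_mk he
    have he' : e i ≠ 0 := fun h0 => hq (by simp [h, h0])
    rw [← Projectivization.mk'_eq_mk ℝ ⟨e, he⟩, isOpenQuotientMap_mk'.continuousAt_comp_iff.symm]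
    have : (fun (q : ℙ ℝ (Vec (n + 1))) j => q.rep (i.succAbove j) / q.rep i) ∘
        Projectivization.mk' ℝ = fun (v : {v : Vec (n + 1) // v ≠ 0}) j =>
          (v : Vec (n + 1)) (i.succAbove j) / (v : Vec (n + 1)) i := by
      ext v j
      obtain ⟨s, hs, h⟩ := exists_rep_mk v.2
      simp [Projectivization.mk'_eq_mk, h, mul_div_mul_left _ _ hs]
    rw [this]
    refine continuousAt_pi.2 fun j => ContinuousAt.div ?_ ?_ he' <;>
    exact Continuous.continuousAt (by fun_prop)
  continuousOn_invFun := by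
    refine Continuous.continuousOn ?_
    exact isOpenQuotientMap_mk'.continuous.comp
      ((continuous_affineVec i).subtype_mk fun a => affineVec_ne_zero i a)

theorem IsTopManifold.of_isOpen {M : Type*} [TopologicalSpace M] (hM : IsTopManifold n M)
    {S : Set M} (hS : IsOpen S) : IsTopManifold n S where
  t2 := by
    have := hM.t2
    infer_instance
  second_countable := by
    have := hM.second_countable
    infer_instance
  locally_euclidean m := by
    obtain ⟨e, he⟩ := hM.locally_euclidean m
    refine ⟨e.subtypeRestr (s := ⟨S, hS⟩) ⟨m⟩, ?_⟩
    rw [OpenPartialHomeomorph.subtypeRestr_source]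
    exact he

theorem isTopManifold_projectivization : IsTopManifold n (ℙ ℝ (Vec (n + 1))) where
  t2 := t2Space_projectivization
  second_countable := secondCountableTopology_projectivization
  locally_euclidean q := by
    obtain ⟨i, hi⟩ : ∃ i, q.rep i ≠ 0 := by
      by_contra! h
      exact q.rep_nonzero (by ext i; exact h i)
    exact ⟨affineChart i, hi⟩

end ProjectiveSpace

/-- The incidence relation between points and subspaces of a hyperconvex curve is closed. -/
theorem IsHyperconvexFrenet.isClosed_incidence {B : Type*} [TopologicalSpace B] {n : ℕ}
    {ξ : B → FullFlag n} (hξ : IsHyperconvexFrenet ξ) (k : Fin (n + 1)) :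
    IsClosed {r : B × ℙ ℝ (Vec n) | r.2.submodule ≤ (ξ r.1).sub k} := by
  have h := (IsOpenQuotientMap.id (X := B)).prodMap (isOpenQuotientMap_mk' (n := n))
  rw [← h.isQuotientMap.isClosed_preimage]
  have : Prod.map id (Projectivization.mk' ℝ) ⁻¹'
      {r : B × ℙ ℝ (Vec n) | r.2.submodule ≤ (ξ r.1).sub k} =
      {r | ((ξ r.1).sub k).starProjection (r.2 : Vec n) = r.2} := by
    ext r
    simp [Projectivization.mk'_eq_mk, Submodule.starProjection_eq_self_iff]
  rw [this]
  have hc : Continuous fun b => ((ξ b).sub k).starProjection :=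
    continuous_iff_continuousAt.2 fun b => hξ.tendsto_sub k b
  exact isClosed_eq ((hc.comp continuous_fst).clm_apply (by fun_prop)) (by fun_prop)

/-- A locally injective proper map all of whose fibers have `n` elements is a covering map. -/
theorem isCoveringMap_of_isProperMap {X Y : Type*} [TopologicalSpace X] [TopologicalSpace Y]
    [T2Space X] [T2Space Y] {f : X → Y} (hf : IsProperMap f) (hinj : IsLocallyInjective f) {n : ℕ}
    (hn : ∀ y, (f ⁻¹' {y}).encard = n) : IsCoveringMap f := by
  intro y
  have hcard : ∀ y, Nat.card (f ⁻¹' {y}) = n := fun y => by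
    rw [Nat.card_coe_set_eq, Set.ncard, hn y, ENat.toNat_natCast]
  have hfin : ∀ y, Finite (f ⁻¹' {y}) := fun y => Set.finite_of_encard_eq_coe (hn y)
  set F := f ⁻¹' {y}
  have hF : Finite F := hfin y
  obtain ⟨A, hA, hAd⟩ := Pairwise.exists_mem_filter_of_disjoint (l := fun i : F => 𝓝 (i : X))
    fun i j hij => disjoint_nhds_nhds.2 fun h => hij (Subtype.ext h)
  choose V hVo hV hVi using hinj
  set N : F → Set X := fun i => interior (A i) ∩ V i
  have hNo : ∀ i, IsOpen (N i) := fun i => isOpen_interior.inter (hVo i)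
  have hmem : ∀ i : F, (i : X) ∈ N i := fun i => ⟨mem_interior_iff_mem_nhds.2 (hA i), hV i⟩
  have hd : ∀ e i j, e ∈ N i → e ∈ N j → i = j := fun e i j hi hj => by
    by_contra h
    exact disjoint_left.1 (hAd h) (interior_subset hi.1) (interior_subset hj.1)
  -- Closedness of `f` makes `U` open, and over `U` no point of the fiber escapes the neighborhoods
  -- `N i`.
  set U : Set Y := (f '' (⋃ i, N i)ᶜ)ᶜ with hU
  have hUo : IsOpen U :=
    (hf.isClosedMap _ (isOpen_iUnion hNo).isClosed_compl).isOpen_compl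
  have hyU : y ∈ U := by
    rintro ⟨e, he, hey⟩
    exact he (mem_iUnion.2 ⟨⟨e, hey⟩, hmem _⟩)
  have hidx : ∀ e : X, f e ∈ U → ∃ i, e ∈ N i := fun e he => by
    by_contra h
    exact he ⟨e, fun h' => h (mem_iUnion.1 h'), rfl⟩
  choose idx hidx using hidx
  set h : f ⁻¹' U → U × F := fun e => (⟨f e, e.2⟩, idx e e.2) with hh
  have hcont : Continuous h := by
    refine ((hf.continuous.comp continuous_subtype_val).subtype_mk _).prodMk ?_
    refine continuous_discrete_rng.2 fun i => ?_
    convert (hNo i).preimage (continuous_subtype_val (p := fun e => e ∈ f ⁻¹' U)) using 1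
    ext e
    refine ⟨fun he => ?_, fun he => hd e _ _ (hidx _ _) he⟩
    rw [← show idx e e.2 = i from he]
    exact hidx _ _
  have hbij : Function.Bijective h := by
    constructor
    · rintro e e' hee
      rw [hh, Prod.mk.injEq, Subtype.mk.injEq] at hee
      refine Subtype.ext (hVi (idx e e.2) (hidx _ _).2 ?_ hee.1)
      rw [hee.2]
      exact (hidx _ _).2
    · rintro ⟨u, i⟩
      have hu : ∀ e : f ⁻¹' {(u : Y)}, f e ∈ U := fun e => by
        rw [show f e = u from e.2]
        exact u.2
      have := hfin u
      -- The fiber over `u` injects into the index set, as `f` is injective on each `N i`. Both have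
      -- `n` elements, so every sheet is reached.
      obtain ⟨e, he⟩ := (Function.Injective.bijective_of_nat_card_le
        (f := fun e : f ⁻¹' {(u : Y)} => idx e (hu e)) (fun e e' hee => by
          refine Subtype.ext (hVi (idx e (hu e)) (hidx _ _).2 ?_ (Eq.trans e.2 (Eq.symm e'.2)))
          rw [show idx e (hu e) = idx e' (hu e') from hee]
          exact (hidx _ _).2)
        (by rw [hcard, hcard])).surjective i
      exact ⟨⟨e, hu e⟩, Prod.ext (Subtype.ext e.2) he⟩
  have hprop : IsProperMap h := isProperMap_of_comp_of_t2 hcont continuous_fst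
    (hf.restrictPreimage U)
  refine IsEvenlyCovered.to_isEvenlyCovered_preimage (I := F) ⟨inferInstance, U, hyU, hUo,
    hUo.preimage hf.continuous,
    (Equiv.ofBijective h hbij).toHomeomorphOfContinuousClosed hcont hprop.isClosedMap,
    fun e => rfl⟩

/-! ### Points of projective space and representing vectors. -/

section Points

theorem submodule_le_iff {n : ℕ} {q : ℙ ℝ (Vec n)} {W : Submodule ℝ (Vec n)} :
    q.submodule ≤ W ↔ q.rep ∈ W := by
  rw [Projectivization.submodule_eq, Submodule.span_singleton_le_iff_mem]

theorem submodule_eq_span_iff {n : ℕ} {q : ℙ ℝ (Vec n)} {e : Vec n} (he : e ≠ 0) :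
    q.submodule = Submodule.span ℝ {e} ↔ q = .mk ℝ e he := by
  rw [← Projectivization.submodule_mk e he, Projectivization.submodule_injective.eq_iff]

theorem rep_mem_span_iff {n : ℕ} {q : ℙ ℝ (Vec n)} {e : Vec n} (he : e ≠ 0) :
    q.rep ∈ Submodule.span ℝ {e} ↔ q = .mk ℝ e he := by
  rw [← Projectivization.submodule_mk e he]
  constructor
  · intro h
    rw [eq_mk_of_mem_submodule q.rep_nonzero h, q.mk_rep]
  · rintro rfl
    rw [← submodule_le_iff]

theorem continuous_starProjection_submodule {n : ℕ} :
    Continuous fun q : ℙ ℝ (Vec n) => q.submodule.starProjection := by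
  have := t2Space_projectivization (n := n)
  refine continuous_iff_continuousAt.2 fun q => tendsto_starProjection_of_mem
    (.of_forall fun p => by rw [p.finrank_submodule, q.finrank_submodule])
    fun g hg v v₀ hv hlim => ?_
  by_cases h0 : v₀ = 0
  · rw [h0]
    exact zero_mem _
  rw [tendsto_nhds_unique (f := id) hg (tendsto_proj h0 hlim hv), Projectivization.submodule_mk]
  exact Submodule.mem_span_singleton_self _

variable {B : Type*} {ξ : B → FullFlag 4}

theorem mem_Omega_iff {q : ℙ ℝ (Vec 4)} : q ∈ Omega ξ ↔ OffTangents ξ q.rep := by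
  simp only [Omega, bdryOmega, mem_compl_iff, mem_ofPred_eq, not_exists, submodule_le_iff,
    OffTangents]

theorem zeroSet_rep_mk {e : Vec 4} (he : e ≠ 0) :
    zeroSet ξ (Projectivization.mk ℝ e he).rep = zeroSet ξ e := by
  obtain ⟨a, ha, h⟩ := exists_rep_mk he
  rw [h, zeroSet_smul ξ ha]

theorem mk_mem_Omega {e : Vec 4} (he : e ≠ 0) (h : OffTangents ξ e) :
    Projectivization.mk ℝ e he ∈ Omega ξ := by
  obtain ⟨a, ha, hr⟩ := exists_rep_mk he
  rw [mem_Omega_iff, hr]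
  exact h.smul ha

end Points

/-! ### The two parts of `Omega`. -/

section Components

variable {B : Type*} [TopologicalSpace B] (θ : B ≃ₜ UnitAddCircle) {ξ : B → FullFlag 4}
  (hξ : IsHyperconvexFrenet ξ)

include θ in
theorem compactSpace_circle : CompactSpace B := θ.symm.compactSpace

include θ in
theorem t2Space_circle : T2Space B := θ.isEmbedding.t2Space

include θ hξ

theorem isOpen_Omega : IsOpen (Omega ξ) := by
  have := compactSpace_circle θ
  have h : bdryOmega ξ = Prod.snd '' {r : B × ℙ ℝ (Vec 4) | r.2.submodule ≤ (ξ r.1).sub 2} := by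
    ext q
    simp [bdryOmega]
  rw [Omega, isOpen_compl_iff, h]
  exact isClosedMap_snd_of_compactSpace _ (hξ.isClosed_incidence 2)

theorem eventually_existsUnique_zero_proj {q₀ : ℙ ℝ (Vec 4)} (hq : q₀ ∈ Omega ξ) {b₀ : B}
    (hb : b₀ ∈ zeroSet ξ q₀.rep) {A : Set B} (hA : A ∈ 𝓝 b₀) :
    ∃ A' ⊆ A, IsOpen A' ∧ b₀ ∈ A' ∧ ∀ᶠ q in 𝓝 q₀, ∃! b, b ∈ A' ∧ b ∈ zeroSet ξ q.rep := by
  obtain ⟨A', hA', ho, hmem, h⟩ :=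
    eventually_existsUnique_mem_three θ hξ hb (mem_Omega_iff.1 hq b₀) hA
  refine ⟨A', hA', ho, hmem, ?_⟩
  rw [← q₀.mk_rep]
  refine eventually_nhds_mk q₀.rep_nonzero ?_
  filter_upwards [h] with v hv hv0
  rw [zeroSet_rep_mk hv0]
  exact hv

/-- No new osculating planes appear far from the old ones: the incidence relation is closed and the
circle is compact, so projecting along it is a closed map. -/
theorem eventually_zeroSet_subset {q₀ : ℙ ℝ (Vec 4)} {O : Set B} (hO : IsOpen O)
    (h : zeroSet ξ q₀.rep ⊆ O) : ∀ᶠ q in 𝓝 q₀, zeroSet ξ q.rep ⊆ O := by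
  have := compactSpace_circle θ
  have hc : IsClosed ({r : B × ℙ ℝ (Vec 4) | r.2.submodule ≤ (ξ r.1).sub 3} ∩ Prod.fst ⁻¹' Oᶜ) :=
    (hξ.isClosed_incidence 3).inter (hO.isClosed_compl.preimage continuous_fst)
  have hc' := isClosedMap_snd_of_compactSpace _ hc
  have hq : q₀ ∈ (Prod.snd '' ({r : B × ℙ ℝ (Vec 4) | r.2.submodule ≤ (ξ r.1).sub 3} ∩
      Prod.fst ⁻¹' Oᶜ))ᶜ := by
    rintro ⟨⟨b, q⟩, ⟨hb, hbO⟩, rfl⟩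
    exact hbO (h (submodule_le_iff.1 hb))
  filter_upwards [hc'.isOpen_compl.mem_nhds hq] with q hq' b hb
  by_contra hbO
  exact hq' ⟨(b, q), ⟨submodule_le_iff.2 hb, hbO⟩, rfl⟩

theorem isOpen_setOf_zeroSet_eq_singleton :
    IsOpen {q | q ∈ Omega ξ ∧ ∃ b, zeroSet ξ q.rep = {b}} := by
  rw [isOpen_iff_eventually]
  rintro q₀ ⟨hq, b₀, hb⟩
  obtain ⟨A', -, ho, hmem, h⟩ := eventually_existsUnique_zero_proj θ hξ hq
    (by rw [hb]; rfl) univ_mem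
  filter_upwards [(isOpen_Omega θ hξ).mem_nhds hq, h,
    eventually_zeroSet_subset θ hξ ho (by rwa [hb, singleton_subset_iff])] with q h1 h2 h3
  obtain ⟨b, hb1, hb2⟩ := h2
  exact ⟨h1, b, eq_singleton_iff_unique_mem.2 ⟨hb1.2, fun c hc => hb2 c ⟨h3 hc, hc⟩⟩⟩

/-- Two distinct zeros persist in disjoint neighborhoods, so nearby points have at least two. -/
theorem isOpen_setOf_zeroSet_ne_singleton :
    IsOpen {q | q ∈ Omega ξ ∧ ¬ ∃ b, zeroSet ξ q.rep = {b}} := by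
  have := t2Space_circle θ
  rw [isOpen_iff_eventually]
  rintro q₀ ⟨hq, hb⟩
  obtain ⟨b₀, hb₀⟩ := zeroSet_nonempty θ hξ q₀.rep
  obtain ⟨b₁, hb₁, hne⟩ : ∃ b₁ ∈ zeroSet ξ q₀.rep, b₁ ≠ b₀ := by
    by_contra! h
    exact hb ⟨b₀, eq_singleton_iff_unique_mem.2 ⟨hb₀, h⟩⟩
  obtain ⟨O₀, O₁, ho₀, ho₁, hm₀, hm₁, hd⟩ := t2_separation hne.symm
  obtain ⟨A₀, hA₀, -, -, h₀⟩ := eventually_existsUnique_zero_proj θ hξ hq hb₀ (ho₀.mem_nhds hm₀)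
  obtain ⟨A₁, hA₁, -, -, h₁⟩ := eventually_existsUnique_zero_proj θ hξ hq hb₁ (ho₁.mem_nhds hm₁)
  filter_upwards [(isOpen_Omega θ hξ).mem_nhds hq, h₀, h₁] with q h1 h2 h3
  refine ⟨h1, fun ⟨b, h⟩ => ?_⟩
  obtain ⟨c₀, ⟨hc₀, hz₀⟩, -⟩ := h2
  obtain ⟨c₁, ⟨hc₁, hz₁⟩, -⟩ := h3
  rw [h] at hz₀ hz₁
  exact disjoint_left.1 hd (hA₀ hc₀) (by rw [show c₀ = c₁ from hz₀.trans hz₁.symm]; exact hA₁ hc₁)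

theorem Omega1_eq : Omega1 θ ξ = {q | q ∈ Omega ξ ∧ ∃ b, zeroSet ξ q.rep = {b}} := by
  ext q
  constructor
  · rintro ⟨t, ht⟩
    obtain ⟨e, he, hd, hoff, hz⟩ := exists_devPcf_eq_span hξ t.2
    rw [hd, submodule_eq_span_iff he] at ht
    rw [ht]
    exact ⟨mk_mem_Omega he hoff, _, (zeroSet_rep_mk he).trans hz⟩
  · rintro ⟨hq, b, hb⟩
    have hbm : b ∈ zeroSet ξ q.rep := by rw [hb]; rfl
    rcases zeroSet_dichotomy θ hξ (mem_Omega_iff.1 hq) hbm with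
      ⟨-, y, z, h, hm⟩ | ⟨y, z, y', h, -, hz, -⟩
    · refine ⟨⟨(b, y, z), h⟩, ?_⟩
      obtain ⟨e, he, hd, -⟩ := exists_devPcf_eq_span hξ h
      rw [hd, rep_mem_span_iff he] at hm
      exact (submodule_eq_span_iff he).2 hm |>.trans hd.symm
    · have hy : y ∈ zeroSet ξ q.rep := by rw [hz]; simp
      rw [hb] at hy
      exact absurd (Eq.symm hy) (ne_of_sbtw θ h).1

end Components

/-! ### Constancy of dimensions and continuity of the axes. -/

section Dimensions

variable {B : Type*} [TopologicalSpace B] {ξ : B → FullFlag 4} (hξ : IsHyperconvexFrenet ξ)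
include hξ

theorem IsHyperconvexFrenet.disjoint_sub {x z : B} (h : x ≠ z) {k l : Fin 5} (hk : 0 < (k : ℕ))
    (hl : 0 < (l : ℕ)) (hkl : (k : ℕ) + l ≤ 4) : Disjoint ((ξ x).sub k) ((ξ z).sub l) :=
  Submodule.disjoint_def.2 fun _ h₁ h₂ => hξ.eq_zero_of_mem_two hk hl hkl h h₁ h₂

theorem IsHyperconvexFrenet.finrank_two_inf_three {x z : B} (h : x ≠ z) :
    Module.finrank ℝ ↥((ξ z).sub 2 ⊓ (ξ x).sub 3) = 1 := by
  have h1 := Submodule.finrank_sup_add_finrank_inf_eq ((ξ z).sub 2) ((ξ x).sub 3)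
  have h2 := Submodule.finrank_sup_add_finrank_inf_eq ((ξ z).sub 2) ((ξ x).sub 2)
  have h3 : (ξ z).sub 2 ⊔ (ξ x).sub 2 ≤ (ξ z).sub 2 ⊔ (ξ x).sub 3 :=
    sup_le_sup_left ((ξ x).mono (by decide)) _
  have h4 := Submodule.finrank_mono h3
  have h5 := ((ξ z).sub 2 ⊔ (ξ x).sub 3).finrank_le
  rw [(hξ.disjoint_sub h.symm (by decide) (by decide) (by decide)).eq_bot, finrank_bot,
    (ξ z).finrank_sub, (ξ x).finrank_sub] at h2
  rw [(ξ z).finrank_sub, (ξ x).finrank_sub] at h1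
  rw [finrank_euclideanSpace_fin] at h5
  simp only [Fin.isValue, Fin.coe_ofNat_eq_mod] at h1 h2
  omega

theorem IsHyperconvexFrenet.finrank_axis {x z : B} (h : x ≠ z) :
    Module.finrank ℝ ↥((ξ x).sub 1 ⊔ ((ξ z).sub 2 ⊓ (ξ x).sub 3)) = 2 := by
  have h1 := Submodule.finrank_sup_add_finrank_inf_eq ((ξ x).sub 1) ((ξ z).sub 2 ⊓ (ξ x).sub 3)
  have h2 : Disjoint ((ξ x).sub 1) ((ξ z).sub 2 ⊓ (ξ x).sub 3) :=
    (hξ.disjoint_sub h (by decide) (by decide) (by decide)).mono_right inf_le_left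
  rw [h2.eq_bot, finrank_bot, hξ.finrank_two_inf_three h, (ξ x).finrank_sub] at h1
  simpa using h1

theorem IsHyperconvexFrenet.finrank_transversal {x y z : B} (hy : x ≠ y) (hz : x ≠ z) :
    Module.finrank ℝ ↥(((ξ x).sub 2 ⊓ (ξ z).sub 3) ⊔ ((ξ y).sub 2 ⊓ (ξ x).sub 3)) = 2 := by
  have h1 := Submodule.finrank_sup_add_finrank_inf_eq ((ξ x).sub 2 ⊓ (ξ z).sub 3)
    ((ξ y).sub 2 ⊓ (ξ x).sub 3)
  have h2 : Disjoint ((ξ x).sub 2 ⊓ (ξ z).sub 3) ((ξ y).sub 2 ⊓ (ξ x).sub 3) :=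
    (hξ.disjoint_sub hy (by decide) (by decide) (by decide)).mono inf_le_left inf_le_left
  rw [h2.eq_bot, finrank_bot, hξ.finrank_two_inf_three hy, hξ.finrank_two_inf_three hz.symm] at h1
  simpa using h1

variable {ι : Type*} {l : Filter ι} {f g : ι → B} {x z : B}

theorem IsHyperconvexFrenet.tendsto_sub_comp (hf : Tendsto f l (𝓝 x)) (k : Fin 5) :
    Tendsto (fun i => ((ξ (f i)).sub k).starProjection) l (𝓝 ((ξ x).sub k).starProjection) :=
  (hξ.tendsto_sub k x).comp hf

variable [T2Space B]

theorem IsHyperconvexFrenet.tendsto_two_inf_three (hf : Tendsto f l (𝓝 x))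
    (hg : Tendsto g l (𝓝 z)) (h : x ≠ z) :
    Tendsto (fun i => ((ξ (g i)).sub 2 ⊓ (ξ (f i)).sub 3).starProjection) l
      (𝓝 ((ξ z).sub 2 ⊓ (ξ x).sub 3).starProjection) := by
  refine tendsto_starProjection_inf (hξ.tendsto_sub_comp hg 2) (hξ.tendsto_sub_comp hf 3) ?_
  filter_upwards [(hf.prodMk_nhds hg).eventually
    (isClosed_diagonal.isOpen_compl.mem_nhds (x := (x, z)) h)] with i hi
  rw [hξ.finrank_two_inf_three h, hξ.finrank_two_inf_three hi]

theorem IsHyperconvexFrenet.tendsto_axis (hf : Tendsto f l (𝓝 x))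
    (hg : Tendsto g l (𝓝 z)) (h : x ≠ z) :
    Tendsto (fun i => ((ξ (f i)).sub 1 ⊔ ((ξ (g i)).sub 2 ⊓ (ξ (f i)).sub 3)).starProjection) l
      (𝓝 ((ξ x).sub 1 ⊔ ((ξ z).sub 2 ⊓ (ξ x).sub 3)).starProjection) := by
  refine tendsto_starProjection_sup (hξ.tendsto_sub_comp hf 1) (hξ.tendsto_two_inf_three hf hg h) ?_
  filter_upwards [(hf.prodMk_nhds hg).eventually
    (isClosed_diagonal.isOpen_compl.mem_nhds (x := (x, z)) h)] with i hi
  rw [hξ.finrank_axis h, hξ.finrank_axis hi]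

end Dimensions

/-! ### The developing map and its fibers. -/

section DevelopingMap

variable {B : Type*} [TopologicalSpace B] (θ : B ≃ₜ UnitAddCircle) {ξ : B → FullFlag 4}
  (hξ : IsHyperconvexFrenet ξ)

include hξ

theorem exists_devPcf_point (t : PosTriple θ) :
    ∃ q : ℙ ℝ (Vec 4), q.submodule = devPcf ξ t.1.1 t.1.2.1 t.1.2.2 := by
  obtain ⟨e, he, hd, -⟩ := exists_devPcf_eq_span hξ t.2
  exact ⟨.mk ℝ e he, by rw [hd, Projectivization.submodule_mk]⟩

theorem exists_devCtrf_point (t : PosTriple θ) :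
    ∃ q : ℙ ℝ (Vec 4), q.submodule = devCtrf ξ t.1.1 t.1.2.1 t.1.2.2 := by
  obtain ⟨e, he, hd, -⟩ := exists_devCtrf_eq_span hξ t.2
  exact ⟨.mk ℝ e he, by rw [hd, Projectivization.submodule_mk]⟩

theorem continuous_of_submodule_eq_devPcf {F : PosTriple θ → ℙ ℝ (Vec 4)}
    (hF : ∀ t, (F t).submodule = devPcf ξ t.1.1 t.1.2.1 t.1.2.2) : Continuous F := by
  have := t2Space_circle θ
  refine continuous_iff_continuousAt.2 fun t => tendsto_proj_of_tendsto_starProjection ?_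
  have hx : Tendsto (fun t : PosTriple θ => t.1.1) (𝓝 t) (𝓝 t.1.1) :=
    Continuous.tendsto (by fun_prop) t
  have hy : Tendsto (fun t : PosTriple θ => t.1.2.1) (𝓝 t) (𝓝 t.1.2.1) :=
    Continuous.tendsto (by fun_prop) t
  have hz : Tendsto (fun t : PosTriple θ => t.1.2.2) (𝓝 t) (𝓝 t.1.2.2) :=
    Continuous.tendsto (by fun_prop) t
  have hd : ∀ t : PosTriple θ, Module.finrank ℝ ↥(devPcf ξ t.1.1 t.1.2.1 t.1.2.2) = 1 :=
    fun t => by rw [← hF, (F t).finrank_submodule]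
  have hne := fun t : PosTriple θ => ne_of_sbtw θ t.2
  simp only [hF]
  refine tendsto_starProjection_inf (hξ.tendsto_axis hx hz (hne t).2.2)
    (tendsto_starProjection_sup (hξ.tendsto_two_inf_three hz hx (hne t).2.2.symm)
      (hξ.tendsto_two_inf_three hx hy (hne t).1) (.of_forall fun s => ?_))
    (.of_forall fun s => (hd s).trans (hd t).symm)
  rw [hξ.finrank_transversal (hne t).1 (hne t).2.2, hξ.finrank_transversal (hne s).1 (hne s).2.2]

theorem continuous_of_submodule_eq_devCtrf {F : PosTriple θ → ℙ ℝ (Vec 4)}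
    (hF : ∀ t, (F t).submodule = devCtrf ξ t.1.1 t.1.2.1 t.1.2.2) : Continuous F := by
  have := t2Space_circle θ
  refine continuous_iff_continuousAt.2 fun t => tendsto_proj_of_tendsto_starProjection ?_
  have hx : Tendsto (fun t : PosTriple θ => t.1.1) (𝓝 t) (𝓝 t.1.1) :=
    Continuous.tendsto (by fun_prop) t
  have hy : Tendsto (fun t : PosTriple θ => t.1.2.1) (𝓝 t) (𝓝 t.1.2.1) :=
    Continuous.tendsto (by fun_prop) t
  have hz : Tendsto (fun t : PosTriple θ => t.1.2.2) (𝓝 t) (𝓝 t.1.2.2) :=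
    Continuous.tendsto (by fun_prop) t
  have hd : ∀ t : PosTriple θ, Module.finrank ℝ ↥(devCtrf ξ t.1.1 t.1.2.1 t.1.2.2) = 1 :=
    fun t => by rw [← hF, (F t).finrank_submodule]
  simp only [hF]
  exact tendsto_starProjection_inf (hξ.tendsto_axis hx hz (ne_of_sbtw θ t.2).2.2)
    (hξ.tendsto_sub_comp hy 3) (.of_forall fun s => (hd s).trans (hd t).symm)

theorem isPreconnected_Omega1 : IsPreconnected (Omega1 θ ξ) := by
  have := preconnectedSpace_posTriple θ
  choose F hF using exists_devPcf_point θ hξ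
  have : Omega1 θ ξ = range F := by
    ext q
    simp only [Omega1, mem_ofPred_eq, mem_range, ← hF, Projectivization.submodule_injective.eq_iff,
      eq_comm]
  rw [this]
  exact isPreconnected_range (continuous_of_submodule_eq_devPcf θ hξ hF)

/-- The points with one osculating plane and those with several form disjoint open sets covering
`Omega`. The first set is `Omega1`, a preconnected set, hence the component of each of its points.
Connectedness of the second set is not needed. -/
theorem Omega2_eq : Omega2 θ ξ = {q | q ∈ Omega ξ ∧ ¬ ∃ b, zeroSet ξ q.rep = {b}} := by
  have h1 := Omega1_eq θ hξ
  ext q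
  refine and_congr_right fun hq => not_congr ⟨fun h => ?_, fun h => ?_⟩
  · have hm : q ∈ Omega1 θ ξ := h ▸ mem_connectedComponentIn hq
    rw [h1] at hm
    exact hm.2
  · have hm : q ∈ Omega1 θ ξ := h1 ▸ ⟨hq, h⟩
    refine Subset.antisymm ?_ ((isPreconnected_Omega1 θ hξ).subset_connectedComponentIn hm
      (h1 ▸ fun _ hp => hp.1))
    rw [h1]
    refine IsPreconnected.subset_left_of_subset_union
      (isOpen_setOf_zeroSet_eq_singleton θ hξ) (isOpen_setOf_zeroSet_ne_singleton θ hξ)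
      (disjoint_left.2 fun _ h h' => h'.2 h.2) (fun p hp => ?_)
      ⟨q, mem_connectedComponentIn hq, hq, h⟩ isPreconnected_connectedComponentIn
    have hp' := connectedComponentIn_subset _ _ hp
    by_cases hs : ∃ b, zeroSet ξ p.rep = {b}
    · exact .inl ⟨hp', hs⟩
    · exact .inr ⟨hp', hs⟩

theorem isOpen_Omega2 : IsOpen (Omega2 θ ξ) :=
  Omega2_eq θ hξ ▸ isOpen_setOf_zeroSet_ne_singleton θ hξ

variable {θ} in
theorem exists_mem_devCtrf {q : ℙ ℝ (Vec 4)} (hq : q ∈ Omega2 θ ξ) {x : B}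
    (hx : x ∈ zeroSet ξ q.rep) : ∃ y z y', sbtw (θ x) (θ y) (θ z) ∧ sbtw (θ x) (θ z) (θ y') ∧
      zeroSet ξ q.rep = {x, y, y'} ∧ q.submodule = devCtrf ξ x y z := by
  rw [Omega2_eq θ hξ] at hq
  rcases zeroSet_dichotomy θ hξ (mem_Omega_iff.1 hq.1) hx with h | ⟨y, z, y', h, h', hz, hm⟩
  · exact absurd ⟨x, h.1⟩ hq.2
  · refine ⟨y, z, y', h, h', hz, ?_⟩
    obtain ⟨e, he, hd, -⟩ := exists_devCtrf_eq_span hξ h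
    rw [hd, rep_mem_span_iff he] at hm
    rw [hd, submodule_eq_span_iff he, hm]

variable {θ} in
theorem zeroSet_of_submodule_eq_devCtrf {q : ℙ ℝ (Vec 4)} {x y z : B}
    (h : sbtw (θ x) (θ y) (θ z)) (hq : q.submodule = devCtrf ξ x y z) :
    q ∈ Omega ξ ∧ ∃ y', sbtw (θ x) (θ z) (θ y') ∧ zeroSet ξ q.rep = {x, y, y'} := by
  obtain ⟨e, he, hd, hoff, y', hy', hz⟩ := exists_devCtrf_eq_span hξ h
  rw [hd, submodule_eq_span_iff he] at hq
  rw [hq, zeroSet_rep_mk he]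
  exact ⟨mk_mem_Omega he hoff, y', hy', hz⟩

theorem mem_Omega2_of_submodule_eq_devCtrf {q : ℙ ℝ (Vec 4)} {t : PosTriple θ}
    (hq : q.submodule = devCtrf ξ t.1.1 t.1.2.1 t.1.2.2) : q ∈ Omega2 θ ξ := by
  obtain ⟨ho, y', -, hz⟩ := zeroSet_of_submodule_eq_devCtrf hξ t.2 hq
  rw [Omega2_eq θ hξ]
  refine ⟨ho, fun ⟨b, hb⟩ => (ne_of_sbtw θ t.2).1 ?_⟩
  rw [hb] at hz
  have h1 : t.1.1 ∈ ({b} : Set B) := by rw [hz]; simp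
  have h2 : t.1.2.1 ∈ ({b} : Set B) := by rw [hz]; simp
  exact h1.trans h2.symm

theorem isManifold_Omega2 : IsTopManifold 3 (Omega2 θ ξ) :=
  isTopManifold_projectivization.of_isOpen (isOpen_Omega2 θ hξ)

include θ in
-- Distinct zeros with a common limit would contradict local uniqueness of the zero near that limit.
theorem ne_of_tendsto_zeros {ι : Type*} {l : Filter ι} [l.NeBot] {q : ι → ℙ ℝ (Vec 4)}
    {q₀ : ℙ ℝ (Vec 4)} (hq₀ : q₀ ∈ Omega ξ) (hq : Tendsto q l (𝓝 q₀)) {f g : ι → B} {x y : B}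
    (hf : Tendsto f l (𝓝 x)) (hg : Tendsto g l (𝓝 y)) (hfz : ∀ i, f i ∈ zeroSet ξ (q i).rep)
    (hgz : ∀ i, g i ∈ zeroSet ξ (q i).rep) (hx : x ∈ zeroSet ξ q₀.rep) (hne : ∀ i, f i ≠ g i) :
    x ≠ y := by
  rintro rfl
  obtain ⟨A, -, hAo, hA, hu⟩ := eventually_existsUnique_zero_proj θ hξ hq₀ hx univ_mem
  obtain ⟨i, h1, h2, h3⟩ := ((hf.eventually (hAo.mem_nhds hA)).and
    ((hg.eventually (hAo.mem_nhds hA)).and (hq.eventually hu))).exists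
  exact hne i (h3.unique ⟨h1, hfz i⟩ ⟨h2, hgz i⟩)

section Fibers

variable {θ} {dev : PosTriple θ → Omega2 θ ξ}
  (hdev : ∀ t, (dev t : ℙ ℝ (Vec 4)).submodule = devCtrf ξ t.1.1 t.1.2.1 t.1.2.2)
include hdev

theorem fst_mem_zeroSet (t : PosTriple θ) : t.1.1 ∈ zeroSet ξ (dev t : ℙ ℝ (Vec 4)).rep := by
  obtain ⟨-, y', -, hz⟩ := zeroSet_of_submodule_eq_devCtrf hξ t.2 (hdev t)
  rw [hz]
  exact mem_insert _ _

theorem eq_of_fst_eq {t t' : PosTriple θ} (h : dev t = dev t') (h1 : t.1.1 = t'.1.1) : t = t' := by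
  obtain ⟨⟨x, y, z⟩, ht⟩ := t
  obtain ⟨⟨x', y', z'⟩, ht'⟩ := t'
  obtain rfl : x = x' := h1
  have hm := hdev ⟨(x, y, z), ht⟩
  have hm' := hdev ⟨(x, y', z'), ht'⟩
  rw [h] at hm
  obtain ⟨rfl, rfl⟩ := eq_of_mem_devCtrf hξ (Projectivization.rep_nonzero _) ht ht'
    (submodule_le_iff.1 hm.le) (submodule_le_iff.1 hm'.le)
  rfl

/-- Taking the first entry is a bijection from the fiber onto the osculating planes through `q`, of
which there are three. -/
theorem encard_fiber (q : Omega2 θ ξ) : (dev ⁻¹' {q}).encard = 3 := by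
  have hinj : InjOn (fun t : PosTriple θ => t.1.1) (dev ⁻¹' {q}) := fun t ht t' ht' h =>
    eq_of_fst_eq hξ hdev (Eq.trans ht (Eq.symm ht')) h
  have himg : (fun t : PosTriple θ => t.1.1) '' (dev ⁻¹' {q}) =
      zeroSet ξ (q : ℙ ℝ (Vec 4)).rep := by
    ext x
    constructor
    · rintro ⟨t, rfl, rfl⟩
      exact fst_mem_zeroSet hξ hdev t
    · intro hx
      obtain ⟨y, z, y', h, -, -, hq⟩ := exists_mem_devCtrf hξ q.2 hx
      refine ⟨⟨(x, y, z), h⟩, Subtype.ext (Projectivization.submodule_injective ?_), rfl⟩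
      rw [hdev, hq]
  rw [← hinj.encard_image, himg, encard_eq_three]
  obtain ⟨x, hx⟩ := zeroSet_nonempty θ hξ (q : ℙ ℝ (Vec 4)).rep
  obtain ⟨y, z, y', h, h', hz, -⟩ := exists_mem_devCtrf hξ q.2 hx
  refine ⟨x, y, y', (ne_of_sbtw θ h).1, (ne_of_sbtw θ h').2.2, ?_, hz⟩
  rintro rfl
  rw [sbtw_iff_gap] at h h'
  exact absurd h.2 h'.2.not_gt

theorem continuous_dev : Continuous dev :=
  (continuous_of_submodule_eq_devCtrf θ hξ hdev).subtype_mk fun t => (dev t).2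

theorem isLocallyInjective_dev : IsLocallyInjective dev := by
  rw [isLocallyInjective_iff_nhds]
  intro t
  obtain ⟨A, -, hAo, hA, hu⟩ := eventually_existsUnique_zero_proj θ hξ
    (dev t).2.1 (fst_mem_zeroSet hξ hdev t) univ_mem
  have hc : Continuous fun t => (dev t : ℙ ℝ (Vec 4)) :=
    continuous_of_submodule_eq_devCtrf θ hξ hdev
  have hx : Continuous fun t : PosTriple θ => t.1.1 := by fun_prop
  refine ⟨_, inter_mem (hx.continuousAt.preimage_mem_nhds (hAo.mem_nhds hA))
    (hc.continuousAt.eventually hu), fun s hs s' hs' h => eq_of_fst_eq hξ hdev h ?_⟩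
  refine hs.2.unique ⟨hs.1, fst_mem_zeroSet hξ hdev s⟩ ⟨hs'.1, ?_⟩
  rw [h]
  exact fst_mem_zeroSet hξ hdev s'

/-- Along an ultrafilter all entries converge because the circle is compact, and only degeneration
of the triple has to be excluded. The three zeros stay distinct in the limit, and `z` is caught
between `y` and `y'`, away from `x`. -/
theorem isProperMap_dev : IsProperMap dev := by
  have := t2Space_circle θ
  have := compactSpace_circle θ
  have := t2Space_projectivization (n := 4)
  rw [isProperMap_iff_ultrafilter_of_t2]
  refine ⟨continuous_dev hξ hdev, fun 𝒰 q hq => ?_⟩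
  have hq' : Tendsto (fun t => (dev t : ℙ ℝ (Vec 4))) 𝒰 (𝓝 q) :=
    (continuous_subtype_val.tendsto q).comp hq
  choose y' hy' hz using fun t => (zeroSet_of_submodule_eq_devCtrf hξ t.2 (hdev t)).2
  have hlim : ∀ f : PosTriple θ → B, ∃ x, Tendsto f 𝒰 (𝓝 x) := fun f =>
    ⟨_, (𝒰.map f).le_nhds_lim⟩
  obtain ⟨X, hX⟩ := hlim fun t => t.1.1
  obtain ⟨Y, hY⟩ := hlim fun t => t.1.2.1
  obtain ⟨Z, hZ⟩ := hlim fun t => t.1.2.2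
  obtain ⟨Y', hY'⟩ := hlim y'
  have hzero : ∀ {f : PosTriple θ → B} {x : B}, Tendsto f 𝒰 (𝓝 x) →
      (∀ t, f t ∈ zeroSet ξ (dev t : ℙ ℝ (Vec 4)).rep) → x ∈ zeroSet ξ (q : ℙ ℝ (Vec 4)).rep :=
    fun hf h => submodule_le_iff.1 ((hξ.isClosed_incidence 3).mem_of_tendsto
      (hf.prodMk_nhds hq') (.of_forall fun t => submodule_le_iff.2 (h t)))
  have hxz : ∀ t, t.1.1 ∈ zeroSet ξ (dev t : ℙ ℝ (Vec 4)).rep := fun t => by rw [hz]; simp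
  have hyz : ∀ t, t.1.2.1 ∈ zeroSet ξ (dev t : ℙ ℝ (Vec 4)).rep := fun t => by rw [hz]; simp
  have hyz' : ∀ t, y' t ∈ zeroSet ξ (dev t : ℙ ℝ (Vec 4)).rep := fun t => by rw [hz]; simp
  have hgap : ∀ t, gap θ t.1.1 t.1.2.1 < gap θ t.1.1 t.1.2.2 ∧
      gap θ t.1.1 t.1.2.2 < gap θ t.1.1 (y' t) := fun t =>
    ⟨((sbtw_iff_gap θ).1 t.2).2, ((sbtw_iff_gap θ).1 (hy' t)).2⟩
  have hXY : X ≠ Y := ne_of_tendsto_zeros θ hξ q.2.1 hq' hX hY hxz hyz (hzero hX hxz)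
    fun t => (ne_of_sbtw θ t.2).1
  have hXY' : X ≠ Y' := ne_of_tendsto_zeros θ hξ q.2.1 hq' hX hY' hxz hyz' (hzero hX hxz)
    fun t => (ne_of_sbtw θ (hy' t)).2.2
  have hYY' : Y ≠ Y' := ne_of_tendsto_zeros θ hξ q.2.1 hq' hY hY' hyz hyz' (hzero hY hyz)
    fun t h => by
      have := hgap t
      rw [← h] at this
      exact absurd this.1 this.2.not_gt
  have hev : ∀ {f g h : PosTriple θ → B} {a b c : B}, Tendsto f 𝒰 (𝓝 a) → Tendsto g 𝒰 (𝓝 b) →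
      Tendsto h 𝒰 (𝓝 c) → sbtw (θ a) (θ b) (θ c) → ∃ t, sbtw (θ (f t)) (θ (g t)) (θ (h t)) :=
    fun hf hg hh h => ((hf.prodMk_nhds (hg.prodMk_nhds hh)).eventually
      ((isOpen_sbtw θ).mem_nhds h)).exists
  -- The limits being distinct, the opposite orientation would be an open condition contradicted by
  -- nearby triples.
  have hS : sbtw (θ X) (θ Y) (θ Y') := by
    refine (sbtw_total θ hXY hYY' hXY').resolve_right fun h => ?_
    obtain ⟨t, ht⟩ := hev hX hY' hY h
    exact absurd ((sbtw_iff_gap θ).1 ht).2 ((hgap t).1.trans (hgap t).2).not_gt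
  -- If `z` tended to `X`, some triple would have `z`, `y`, `y'` in positive order, whereas `z` lies
  -- between `y` and `y'` as seen from `x`.
  have hXZ : X ≠ Z := by
    rintro rfl
    obtain ⟨t, ht⟩ := hev hZ hY hY' hS
    exact sbtw_asymm (sbtw_trans_right (sbtw_cyclic_right t.2) ht) (sbtw_cyclic_right (hy' t))
  have haxis : (q : ℙ ℝ (Vec 4)).rep ∈ (ξ X).sub 1 ⊔ ((ξ Z).sub 2 ⊓ (ξ X).sub 3) := by
    have h1 := tendsto_clm_apply ((continuous_starProjection_submodule.tendsto _).comp hq')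
      (tendsto_const_nhds (x := (q : ℙ ℝ (Vec 4)).rep))
    rw [Submodule.starProjection_eq_self_iff.2 (submodule_le_iff.1 le_rfl)] at h1
    refine mem_of_tendsto_starProjection (hξ.tendsto_axis hX hZ hXZ) h1 (.of_forall fun t => ?_)
    exact (hdev t).le.trans inf_le_left (Submodule.starProjection_apply_mem _ _)
  obtain ⟨Y₁, Z₁, Y₁', h, h', hz₁, hq₁⟩ := exists_mem_devCtrf hξ q.2 (hzero hX hxz)
  obtain rfl : Z = Z₁ := eq_of_mem_axis hξ θ (mem_Omega_iff.1 q.2.1 X) hXZ (ne_of_sbtw θ h).2.2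
    haxis (submodule_le_iff.1 hq₁.le).1
  have hYm := hzero hY hyz
  have hYm' := hzero hY' hyz'
  rw [hz₁] at hYm hYm'
  simp only [mem_insert_iff, mem_singleton_iff, hXY.symm, hXY'.symm, false_or] at hYm hYm'
  -- The limits `Y` and `Y'` are the two zeros other than `X`, and the orientation decides which is
  -- which. The limit triple is then the positive triple of the fiber with first entry `X`.
  obtain rfl : Y = Y₁ := by
    refine hYm.resolve_right fun hY1 => ?_
    rcases hYm' with hY2 | hY2
    · rw [hY1, hY2] at hS
      rw [sbtw_iff_gap] at h h' hS
      linarith [h.2, h'.2, hS.2]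
    · exact hYY' (hY1.trans hY2.symm)
  refine ⟨⟨(X, Y, Z), h⟩, ?_⟩
  change Tendsto id (𝒰 : Filter (PosTriple θ)) _
  rw [tendsto_subtype_rng]
  exact hX.prodMk_nhds (hY.prodMk_nhds hZ)

theorem isSheetedCovering_dev : IsSheetedCovering 3 dev := by
  have := (isTopManifold_posTriple θ).t2
  have := (isManifold_Omega2 θ hξ).t2
  exact ⟨isCoveringMap_of_isProperMap (isProperMap_dev hξ hdev) (isLocallyInjective_dev hξ hdev)
    (encard_fiber hξ hdev), encard_fiber hξ hdev⟩

end Fibers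

end DevelopingMap

end HyperconvexFrenet

end

open HyperconvexFrenet in
theorem proposition3p9 {B : Type*} [TopologicalSpace B] (θ : B ≃ₜ UnitAddCircle)
    (ξ : B → FullFlag 4) (hξ : IsHyperconvexFrenet ξ) :
    ∃ dev : PosTriple θ → Omega2 θ ξ,
      (∀ t : PosTriple θ,
        (dev t : ℙ ℝ (Vec 4)).submodule = devCtrf ξ t.1.1 t.1.2.1 t.1.2.2) ∧
      IsSheetedCovering 3 dev ∧
      IsJFoliation 3 1 2 (leavesG θ) dev := by
  choose F hF using exists_devCtrf_point θ hξ
  set dev : PosTriple θ → Omega2 θ ξ := fun t =>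
    ⟨F t, mem_Omega2_of_submodule_eq_devCtrf θ hξ (hF t)⟩
  have hdev : ∀ t, (dev t : ℙ ℝ (Vec 4)).submodule = devCtrf ξ t.1.1 t.1.2.1 t.1.2.2 := hF
  refine ⟨dev, hdev, isSheetedCovering_dev hξ hdev, isManifold_Omega2 θ hξ,
    isTopManifold_posTriple θ, isFoliation_leavesG θ, isSheetedCovering_dev hξ hdev, ?_⟩
  -- The first entry is constant on a leaf and determines the point of the fiber.
  rintro _ ⟨x₀, z₀, -, rfl⟩ t ht t' ht' h
  exact eq_of_fst_eq hξ hdev h (ht.1.trans ht'.1.symm)
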